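/- Let $X$ be a connected Dynkin diagram of finite type, one of $A_r$ ($r\ge1$), $B_r$ ($r\ge3$), $C_r$ ($r\ge2$), $D_r$ ($r\ge4$), $E_6,E_7,E_8,F_4,G_2$, with vertex set $I=\{1,\dots,r\}$, and let $k\ge2$ be an integer. The vertices are labelled as follows: in types $A,B,C,F_4,G_2$ they form the chain $1-2-\cdots-r$, where $\alpha_r$ is the short simple root for $B_r$, the long simple root for $C_r$, $\alpha_3,\alpha_4$ are the short ones for $F_4$, and $\alpha_2$ is the short one for $G_2$; in type $D_r$ the vertices $1-\cdots-(r-2)$ form a chain and $r-1$, $r$ are both joined to $r-2$; in types $E_6,E_7,E_8$ the vertices $1-\cdots-(r-1)$ form a chain and $r$ is joined to $3$, $3$, $5$ respectively. Let $(\cdot|\cdot)$ be the invariant form normalized so that long roots have square length $2$; write $\alpha_a$ for the simple roots, $\alpha_a^\vee=2\alpha_a/(\alpha_a|\alpha_a)$, and $C_{ab}=(\alpha_a^\vee|\alpha_b)$ for the Cartan matrix. Let $\omega_a$ be the fundamental weights, $(\omega_a|\alpha_b^\vee)=\delta_{ab}$, $P=\bigoplus_a\mathbb Z\omega_a$, $Q^\vee=\bigoplus_a\mathbb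 Z\alpha_a^\vee$, $\rho=\sum_a\omega_a$, $\Delta_+$ the set of positive roots, and $W$ the Weyl group with length function $\ell$. Let $\theta=\sum_{a\in I}c_a\alpha_a^\vee$ be the highest root, $c_0=1$, $h^\vee=\sum_{i=0}^r c_i$, and let $$\hat P^k_+=\Big\{\hat\lambda=\sum_{i=0}^r\lambda_i\hat\omega_i : \lambda_i\in\mathbb Z_{\ge0},\ \sum_{i=0}^rc_i\lambda_i=k\Big\},\qquad \lambda=\sum_{a=1}^r\lambda_a\omega_a .$$ For $\hat\lambda,\hat\mu,\hat\nu\in\hat P^k_+$ put $$S_{\hat\lambda,\hat\mu}=\frac{i^{|\Delta_+|}}{\sqrt{|P/Q^\vee|(k+h^\vee)^r}}\sum_{w\in W}(-1)^{\ell(w)}\exp\Big(-\frac{2\pi i\,(w(\lambda+\rho)|\mu+\rho)}{k+h^\vee}\Big),\qquad N_{\hat\lambda\hat\mu}^{\hat\nu}=\sum_{\hat\omega\in\hat P^k_+}\frac{S_{\hat\lambda,\hat\omega}\,S_{\hat\mu,\hat\omega}\,\overline{S_{\hat\nu,\hat\omega}}}{S_{k\hat\omega_0,\hat\omega}} .$$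 Then the product $V_{\hat\lambda}\cdot V_{\hat\mu}=\sum_{\hat\nu}N_{\hat\lambda\hat\mu}^{\hat\nu}V_{\hat\nu}$ makes the free $\mathbb Z$-module $R$ with basis $\{V_{\hat\lambda}:\hat\lambda\in\hat P^k_+\}$ a commutative ring (the WZW fusion ring; in particular the numbers $N_{\hat\lambda\hat\mu}^{\hat\nu}$ are integers). For $a\in I$ define $\tau_a\hat\omega_0$ by: - $A_r$: $\tau_a\hat\omega_0=\hat\omega_a$; - $B_r$: $\hat\omega_1$ if $a$ is odd, $\hat\omega_0$ if $a$ is even; - $C_r$: $\hat\omega_0$ if $a\le r-1$, and $\hat\omega_r$ if $a=r$; - $D_r$: for $a\le r-2$, $\hat\omega_1$ if $a$ is odd and $\hat\omega_0$ if $a$ is even; and $\hat\omega_a$ if $a\in\{r-1,r\}$; - $E_6$: $\hat\omega_1,\hat\omega_5,\hat\omega_0,\hat\omega_1,\hat\omega_5,\hat\omega_0$ for $a=1,\dots,6$; - $E_7$: $\hat\omega_0,\hat\omega_0,\hat\omega_0,\hat\omega_6,\hat\omega_0,\hat\omega_6,\hat\omega_6$ for $a=1,\dots,7$; - $E_8,F_4,G_2$: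 $\hat\omega_0$. Then the elements $Q^{(a)}=V_{k(\tau_a\hat\omega_0)}$, $a\in I$, of $R$ solve the boundary $Q$-system $$\big(Q^{(a)}\big)^2=\prod_{b\in I:\ C_{ab}<0}\big(Q^{(b)}\big)^{-C_{ab}},\qquad a\in I .$$ -/

import Mathlib

/-! Dynkin diagrams of finite type, the modular S-matrix, the Verlinde numbers and
the fusion ring of level `k`. -/

/-- The connected Dynkin diagrams of finite type. -/
inductive DynkinDiagram : Type
  | A (r : ℕ) (hr : 1 ≤ r)
  | B (r : ℕ) (hr : 3 ≤ r)
  | C (r : ℕ) (hr : 2 ≤ r)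
  | D (r : ℕ) (hr : 4 ≤ r)
  | E6
  | E7
  | E8
  | F4
  | G2

namespace DynkinDiagram

/-- The number `r` of vertices. -/
def rank : DynkinDiagram → ℕ
  | A r _ => r
  | B r _ => r
  | C r _ => r
  | D r _ => r
  | E6 => 6
  | E7 => 7
  | E8 => 8
  | F4 => 4
  | G2 => 2

/-- The vertex set `I = {1, …, r}`. The element `a : Fin r` stands for the vertex with label
`a + 1`. -/
abbrev Vertex (X : DynkinDiagram) : Type := Fin X.rank

/-- The vertex set `Î = {0, 1, …, r}` of the extended diagram, an element standing for the vertex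
with the same label. The vertex `a` of the finite diagram is `a.succ`. -/
abbrev ExtVertex (X : DynkinDiagram) : Type := Fin (X.rank + 1)

/-- The Cartan matrix with the convention `C_{ab} = (α_a^∨ | α_b)`. (Mathlib's matrices follow the
transposed convention.) Labels: in types `A`, `B`, `C`, `F₄`, `G₂` the vertices form the chain
`1 - 2 - ⋯ - r`; in type `B` the root `α_r` is short, in type `C` it is long, in type `F₄` the roots
`α₃, α₄` are short, in type `G₂` the root `α₂` is short. In type `D` the vertices `r - 1` and `r`
are both joined to `r - 2`. In type `E_r` the vertices `1 - ⋯ - (r - 1)` form a chain and `r` is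
joined to `3`, `3`, `5` for `r = 6, 7, 8`. -/
def cartan : (X : DynkinDiagram) → Matrix X.Vertex X.Vertex ℤ
  | A r _ => CartanMatrix.A r
  | B r _ => (CartanMatrix.B r).transpose
  | C r _ => (CartanMatrix.C r).transpose
  | D r _ => CartanMatrix.D r
  | E6 => !![ 2, -1,  0,  0,  0,  0;
             -1,  2, -1,  0,  0,  0;
              0, -1,  2, -1,  0, -1;
              0,  0, -1,  2, -1,  0;
              0,  0,  0, -1,  2,  0;
              0,  0, -1,  0,  0,  2]
  | E7 => !![ 2, -1,  0,  0,  0,  0,  0;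
             -1,  2, -1,  0,  0,  0,  0;
              0, -1,  2, -1,  0,  0, -1;
              0,  0, -1,  2, -1,  0,  0;
              0,  0,  0, -1,  2, -1,  0;
              0,  0,  0,  0, -1,  2,  0;
              0,  0, -1,  0,  0,  0,  2]
  | E8 => !![ 2, -1,  0,  0,  0,  0,  0,  0;
             -1,  2, -1,  0,  0,  0,  0,  0;
              0, -1,  2, -1,  0,  0,  0,  0;
              0,  0, -1,  2, -1,  0,  0,  0;
              0,  0,  0, -1,  2, -1,  0, -1;
              0,  0,  0,  0, -1,  2, -1,  0;
              0,  0,  0,  0,  0, -1,  2,  0;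
              0,  0,  0,  0, -1,  0,  0,  2]
  | F4 => CartanMatrix.F₄.transpose
  | G2 => CartanMatrix.G₂.transpose

/-- The numbers `t_a = 2 / (α_a | α_a)`, where long roots have square length `2`. -/
def t : (X : DynkinDiagram) → X.Vertex → ℕ
  | A _ _ => fun _ => 1
  | B r _ => fun a => if a.val + 1 = r then 2 else 1
  | C r _ => fun a => if a.val + 1 = r then 1 else 2
  | D _ _ => fun _ => 1
  | E6 => fun _ => 1
  | E7 => fun _ => 1
  | E8 => fun _ => 1
  | F4 => ![1, 1, 2, 2]
  | G2 => ![1, 3]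

/-- The comarks `c_1, …, c_r`: the highest root is `θ = ∑ c_a α_a^∨`. -/
def finComark : (X : DynkinDiagram) → X.Vertex → ℕ
  | A _ _ => fun _ => 1
  | B r _ => fun a => if a.val = 0 ∨ a.val + 1 = r then 1 else 2
  | C _ _ => fun _ => 1
  | D r _ => fun a => if a.val = 0 ∨ r ≤ a.val + 2 then 1 else 2
  | E6 => ![1, 2, 3, 2, 1, 2]
  | E7 => ![2, 3, 4, 3, 2, 1, 2]
  | E8 => ![2, 3, 4, 5, 6, 4, 2, 3]
  | F4 => ![2, 3, 2, 1]
  | G2 => ![2, 1]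

/-- The comarks `c_0 = 1, c_1, …, c_r`. -/
def comark (X : DynkinDiagram) : X.ExtVertex → ℕ := Fin.cons 1 X.finComark

/-- The dual Coxeter number `h^∨ = c_0 + c_1 + ⋯ + c_r`. -/
def dualCoxeter (X : DynkinDiagram) : ℕ := ∑ i, X.comark i

/-! ### The weight lattice and the Weyl group -/

/-- The weight lattice `P`: `x` stands for the weight `∑ x_a ω_a`. -/
abbrev Weight (X : DynkinDiagram) : Type := X.Vertex → ℤ

/-- The simple root `α_b = ∑_a C_{ab} ω_a`. -/
def simpleRoot (X : DynkinDiagram) (b : X.Vertex) : X.Weight := fun a => X.cartan a b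

/-- The Weyl vector `ρ = ∑ ω_a`. -/
def rho (X : DynkinDiagram) : X.Weight := fun _ => 1

/-- The image `Q^∨` of the coroot lattice in `P`, generated by `α_a^∨ = t_a α_a`. -/
def corootLattice (X : DynkinDiagram) : AddSubgroup X.Weight :=
  AddSubgroup.closure (Set.range fun a => X.t a • X.simpleRoot a)

/-- The Gram matrix `(ω_a | ω_b)` of the normalized form. It is determined by
`(ω_a | α_b^∨) = δ_{ab}`, where `α_b^∨ = t_b ∑_a C_{ab} ω_a`. -/
noncomputable def gram (X : DynkinDiagram) : Matrix X.Vertex X.Vertex ℚ :=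
  Matrix.diagonal (fun a => (X.t a : ℚ)⁻¹) * (X.cartan.map (Int.cast : ℤ → ℚ))⁻¹

/-- The normalized symmetric bilinear form `(x | y)` on `P`. -/
noncomputable def form (X : DynkinDiagram) (x y : X.Weight) : ℚ :=
  ∑ a, ∑ b, (x a : ℚ) * X.gram a b * (y b : ℚ)

theorem simpleRoot_self (X : DynkinDiagram) (a : X.Vertex) : X.simpleRoot a a = 2 := by
  cases X with
  | A r hr => exact congrFun (CartanMatrix.A_diag r) a
  | B r hr => exact CartanMatrix.B_diag r a
  | C r hr => exact CartanMatrix.C_diag r a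
  | D r hr => exact CartanMatrix.D_diag r a
  | E6 => revert a; decide
  | E7 => revert a; decide
  | E8 => revert a; decide
  | F4 => revert a; decide
  | G2 => revert a; decide

/-- The simple reflection `s_a x = x - (α_a^∨ | x) α_a = x - x_a α_a` of `P`. -/
def simpleReflection (X : DynkinDiagram) (a : X.Vertex) : X.Weight ≃ₗ[ℤ] X.Weight :=
  Module.reflection (x := X.simpleRoot a) (f := LinearMap.proj a) (X.simpleRoot_self a)

/-- The Weyl group `W`, generated by the simple reflections. -/
def weylGroup (X : DynkinDiagram) : Subgroup (X.Weight ≃ₗ[ℤ] X.Weight) :=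
  Subgroup.closure (Set.range X.simpleReflection)

/-- The length `ℓ(w)`: the least length of a word in the simple reflections with product `w`. -/
noncomputable def length (X : DynkinDiagram) (w : X.weylGroup) : ℕ :=
  sInf {n | ∃ l : List X.Vertex, l.length = n ∧
    (l.map X.simpleReflection).prod = (w : X.Weight ≃ₗ[ℤ] X.Weight)}

/-- The set `Δ₊` of positive roots: the Weyl group images of simple roots which are non-negative
combinations of simple roots. -/
def positiveRoots (X : DynkinDiagram) : Set X.Weight :=
  {x | (∃ w : X.weylGroup, ∃ a, x = (w : X.Weight ≃ₗ[ℤ] X.Weight) (X.simpleRoot a)) ∧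
    ∃ n : X.Vertex → ℕ, x = ∑ a, n a • X.simpleRoot a}

/-! ### Level `k` weights, the modular S-matrix and the Verlinde numbers -/

/-- The finite set `P̂₊ᵏ` of dominant affine weights `∑ x_i ω̂_i` of level `∑ c_i x_i = k`. -/
def LevelWeight (X : DynkinDiagram) (k : ℕ) : Type :=
  {x : X.ExtVertex → ℕ // ∑ i, X.comark i * x i = k}

theorem comark_pos (X : DynkinDiagram) (i : X.ExtVertex) : 0 < X.comark i := by
  refine Fin.cases (by simp [comark]) (fun a => ?_) i
  show 0 < X.finComark a
  cases X with
  | A r hr => simp [finComark]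
  | B r hr => simp only [finComark]; split_ifs <;> omega
  | C r hr => simp [finComark]
  | D r hr => simp only [finComark]; split_ifs <;> omega
  | E6 => revert a; decide
  | E7 => revert a; decide
  | E8 => revert a; decide
  | F4 => revert a; decide
  | G2 => revert a; decide

instance (X : DynkinDiagram) (k : ℕ) : Finite (X.LevelWeight k) := by
  have h : ∀ (x : X.LevelWeight k) (i : X.ExtVertex), x.1 i < k + 1 := by
    intro x i
    have h1 : X.comark i * x.1 i ≤ ∑ j, X.comark j * x.1 j :=
      Finset.single_le_sum (f := fun j => X.comark j * x.1 j) (fun _ _ => Nat.zero_le _)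
        (Finset.mem_univ i)
    have h2 : x.1 i ≤ X.comark i * x.1 i := Nat.le_mul_of_pos_left _ (X.comark_pos i)
    have h3 := x.2
    omega
  refine Finite.of_injective
    (fun (x : X.LevelWeight k) (i : X.ExtVertex) => (⟨x.1 i, h x i⟩ : Fin (k + 1))) ?_
  intro x y hxy
  apply Subtype.ext
  funext i
  exact congrArg Fin.val (congrFun hxy i)

noncomputable instance (X : DynkinDiagram) (k : ℕ) : Fintype (X.LevelWeight k) :=
  Fintype.ofFinite _

/-- The projection `∑_{i ≥ 0} x_i ω̂_i ↦ ∑_{i ≥ 1} x_i ω_i` to the finite weight lattice. -/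
def finitePart (X : DynkinDiagram) {k : ℕ} (x : X.LevelWeight k) : X.Weight :=
  fun a => (x.1 a.succ : ℤ)

/-- The weight `k ω̂_i`, for a vertex `i` with comark `1`. -/
def multipleFundamental (X : DynkinDiagram) (k : ℕ) (i : X.ExtVertex) (hi : X.comark i = 1) :
    X.LevelWeight k :=
  ⟨Pi.single i k, by
    rw [Finset.sum_eq_single i (fun j _ hj => by simp [Pi.single_eq_of_ne hj])
      (fun h => absurd (Finset.mem_univ i) h)]
    simp [hi]⟩

/-- The weight `k ω̂₀`, which is the level `k` affinization of `0`. -/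
def vacuum (X : DynkinDiagram) (k : ℕ) : X.LevelWeight k := X.multipleFundamental k 0 rfl

/-- The entries `S_{x, y}` of the modular S-matrix (the Weyl group is finite):
`i^{|Δ₊|} / √(|P/Q^∨| (k+h^∨)^r) · ∑_{w ∈ W} (-1)^{ℓ(w)} exp(-2πi (w(x+ρ) | y+ρ) / (k+h^∨))`. -/
noncomputable def modularS (X : DynkinDiagram) {k : ℕ} (x y : X.LevelWeight k) : ℂ :=
  Complex.I ^ X.positiveRoots.ncard /
      (Real.sqrt ((X.corootLattice.index : ℝ) * ((k : ℝ) + X.dualCoxeter) ^ X.rank) : ℂ) *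
    ∑ᶠ w : X.weylGroup, (-1 : ℂ) ^ X.length w *
      Complex.exp (-(2 * Real.pi * Complex.I *
        (X.form ((w : X.Weight ≃ₗ[ℤ] X.Weight) (X.finitePart x + X.rho))
          (X.finitePart y + X.rho) : ℂ) / ((k : ℂ) + X.dualCoxeter)))

/-- The number `N_{x y}^z` given by the Verlinde formula. -/
noncomputable def verlinde (X : DynkinDiagram) {k : ℕ} (x y z : X.LevelWeight k) : ℂ :=
  ∑ u : X.LevelWeight k, X.modularS x u * X.modularS y u * (starRingEnd ℂ) (X.modularS z u) /
    X.modularS (X.vacuum k) u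

/-! ### The fusion ring -/

/-- The elements of the free `ℤ`-module with basis indexed by `P̂₊ᵏ`: integral linear combinations
of the basis elements, with coefficientwise addition. -/
def FusionModule (X : DynkinDiagram) (k : ℕ) : Type := X.LevelWeight k →₀ ℤ

/-- The basis element `V_x`. -/
noncomputable def V (X : DynkinDiagram) {k : ℕ} (x : X.LevelWeight k) : X.FusionModule k :=
  (Finsupp.single x 1 : X.LevelWeight k →₀ ℤ)

/-- The coefficient of `V_z` in an element of the free module. -/
def coeff (X : DynkinDiagram) {k : ℕ} (f : X.FusionModule k) (z : X.LevelWeight k) : ℤ :=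
  (show X.LevelWeight k →₀ ℤ from f) z

/-- A commutative ring structure on the free module is the fusion ring structure if its addition is
that of the module (coefficientwise) and its product is `V_x V_y = ∑_z N_{x y}^z V_z`. There is at
most one such structure. -/
structure IsFusionRing (X : DynkinDiagram) (k : ℕ) (R : CommRing (X.FusionModule k)) : Prop where
  coeff_add : ∀ (f g : X.FusionModule k) (z : X.LevelWeight k),
    X.coeff (R.add f g) z = X.coeff f z + X.coeff g z
  coeff_mul : ∀ x y z : X.LevelWeight k,
    ((X.coeff (R.mul (X.V x) (X.V y)) z : ℤ) : ℂ) = X.verlinde x y z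

/-- The family `(Q_a)` solves the boundary Q-system
`Q_a ^ 2 = ∏_{b ∼ a} Q_b ^ (- C_{ab})`, where `b ∼ a` means `C_{ab} < 0`. -/
def IsBoundarySolution (X : DynkinDiagram) {R : Type*} [CommRing R] (q : X.Vertex → R) : Prop :=
  ∀ a, q a ^ 2 = ∏ b with X.cartan a b < 0, q b ^ (-X.cartan a b).toNat

/-! ### The diagram automorphisms `τ_a` -/

/-- The vertex `τ_a(0)` of the extended diagram, so that `τ_a ω̂₀ = ω̂_{τ_a(0)}`; the automorphism
`τ_a` in the group of outer automorphisms is determined by it. -/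
def tauZero : (X : DynkinDiagram) → X.Vertex → X.ExtVertex
  | A _ _ => fun a => a.succ
  | B _ _ => fun a => if (a.val + 1) % 2 = 1 then 1 else 0
  | C r _ => fun a => if a.val + 1 = r then a.succ else 0
  | D r _ => fun a =>
      if a.val + 1 ≤ r - 2 then (if (a.val + 1) % 2 = 1 then 1 else 0) else a.succ
  | E6 => ![1, 5, 0, 1, 5, 0]
  | E7 => ![0, 0, 0, 6, 0, 6, 6]
  | E8 => fun _ => 0
  | F4 => fun _ => 0
  | G2 => fun _ => 0

theorem comark_tauZero (X : DynkinDiagram) (a : X.Vertex) : X.comark (X.tauZero a) = 1 := by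
  cases X with
  | A r hr => rfl
  | B r hr =>
    simp only [tauZero]
    split_ifs
    · obtain ⟨n, rfl⟩ : ∃ n, r = n + 1 := ⟨r - 1, by omega⟩
      rfl
    · rfl
  | C r hr =>
    simp only [tauZero]
    split_ifs <;> rfl
  | D r hr =>
    simp only [tauZero]
    split_ifs with h1 h2
    · obtain ⟨n, rfl⟩ : ∃ n, r = n + 1 := ⟨r - 1, by omega⟩
      rfl
    · rfl
    · show (if a.val = 0 ∨ r ≤ a.val + 2 then 1 else 2) = 1
      rw [if_pos (Or.inr (by omega))]
  | E6 => revert a; decide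
  | E7 => revert a; decide
  | E8 => rfl
  | F4 => rfl
  | G2 => rfl

/-- The weight `k (τ_a ω̂₀)`. -/
def tauWeight (X : DynkinDiagram) (k : ℕ) (a : X.Vertex) : X.LevelWeight k :=
  X.multipleFundamental k (X.tauZero a) (X.comark_tauZero a)

end DynkinDiagram

/-!
The S-matrix is studied through the alternating sums
`A_x(y) = ∑_w (-1)^{ℓ(w)} exp (-2πi (wx | y) / K)` with `K = k + h^∨`. They are `K Q^∨`-periodic and
alternating under the Weyl group, hence alternating under the affine Weyl group `W ⋉ K Q^∨`, whose
open alcove has as its integral points the weights `λ + ρ` with `λ` of level `k`. Three facts about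
them prove the theorem.

*Unitarity* (`sum_modularS_mul_conj`). By character orthogonality on the finite group `P / K Q^∨`,
which has `|P / Q^∨| K^r` elements, and because the affine Weyl group acts freely on the open alcove
(`InAlcove.eq_one_of_smul_eq`) while alternating sums vanish on its walls (`alternant_reduce`), the
rows of the S-matrix are orthonormal.

*Integrality* (`exists_modularS_mul_eq`). Multiplying alternating sums by sums of exponentials over
Weyl group orbits gives sums of alternating sums. By induction on the length of `x`, every `A_x` is
a multiple `f A_ρ` in which `f` is an integral combination of orbit sums and so preserves the
`ℤ`-span of the `A_{λ + ρ}` (`exists_alternantFun_eq_mul`). Hence `S_{0,u} ≠ 0`, and the products of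
the normalized rows `u ↦ S_{λ,u} / S_{0,u}` are integral combinations of normalized rows; by
unitarity the coefficients are the Verlinde numbers. The map sending `V_λ` to its normalized row is
therefore an isomorphism of the fusion ring with a ring of functions on the level weights.

*Simple currents* (`modularS_multipleFundamental`). If the vertex `c` has comark `1` and `α_c` is
long, then `k ω_c + ρ = K ω_c + (ρ - h^∨ ω_c)`, where `ρ - h^∨ ω_c` is conjugate to `ρ` because no
root is orthogonal to it and its pairings with the roots are less than `h^∨`. The sign of
the conjugating element is `exp (2πi (ω_c | ρ))`, because `2ρ` is the sum of the positive roots.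
Since `w ω_c ≡ ω_c` modulo `Q^∨`, the normalized row of `k ω_c` is `μ ↦ exp (-2πi (ω_c | μ))`.

So the normalized rows of the elements `Q^{(a)}` are characters of the weight lattice, and the
boundary Q-system says that `∑_b C_{ab} ω_{τ_b}` pairs integrally with the weights, where `ω_{τ_b}`
is the fundamental weight of `τ_b ω̂_0`. This combination lies in `Q^∨` (`sum_cartan_smul_tau_mem`).

The facts on root systems that this uses, such as the finiteness of the Weyl group, the exchange
property and the dominance order, are derived from the Cartan matrices. The simple roots with a
given square length `2 / s` and all their conjugates are vectors of minimal length in a lattice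
stable under the Weyl group, and this bounds their coefficients (`exists_rootComb_of_mem_roots`).
-/

namespace DynkinDiagram

open Finset

/-! ### The Cartan matrices -/

theorem _root_.Fin.sum_ite_val_eq {R : Type*} [AddCommMonoid R] {r : ℕ} (n : ℕ) (F : ℕ → R) :
    ∑ b : Fin r, (if b.val = n then F b.val else 0) = if n < r then F n else 0 := by
  split_ifs with hn
  · rw [Finset.sum_eq_single (⟨n, hn⟩ : Fin r)]
    · simp
    · intro b _ hb
      exact if_neg fun h => hb (Fin.ext h)
    · simp
  · exact Finset.sum_eq_zero fun b _ => if_neg fun h => hn (by have := b.2; omega)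

theorem _root_.Fin.sum_ite_and_val_eq {R : Type*} [AddCommMonoid R] {r : ℕ} (p : Prop)
    [Decidable p] (n : ℕ) (F : ℕ → R) :
    ∑ b : Fin r, (if p ∧ b.val = n then F b.val else 0) = if p ∧ n < r then F n else 0 := by
  by_cases hp : p <;> simp [hp, Fin.sum_ite_val_eq]

/-- A row of the Cartan matrix of type `A` applied to a vector. -/
theorem sum_cartan_A {r : ℕ} (F : ℕ → ℤ) (a : Fin r) :
    ∑ b, CartanMatrix.A r a b * F b.val =
      2 * F a.val - (if 0 < a.val then F (a.val - 1) else 0) -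
        (if a.val + 1 < r then F (a.val + 1) else 0) := by
  have h : ∀ b : Fin r, CartanMatrix.A r a b * F b.val =
      2 * (if b.val = a.val then F b.val else 0)
        - (if 0 < a.val ∧ b.val = a.val - 1 then F b.val else 0)
        - (if b.val = a.val + 1 then F b.val else 0) := by
    intro b
    simp only [CartanMatrix.A, Matrix.of_apply, Fin.ext_iff]
    grind
  have ha := a.2
  simp only [h, Finset.sum_sub_distrib, ← Finset.mul_sum, Fin.sum_ite_val_eq,
    Fin.sum_ite_and_val_eq]
  grind

/-- A row of the Cartan matrix `C_{ab} = (α_a^∨ | α_b)` of type `B` applied to a vector. -/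
theorem sum_cartan_B {r : ℕ} (F : ℕ → ℤ) (a : Fin r) :
    ∑ b, (CartanMatrix.B r).transpose a b * F b.val =
      2 * F a.val - (if 0 < a.val then (if a.val + 1 = r then 2 else 1) * F (a.val - 1) else 0) -
        (if a.val + 1 < r then F (a.val + 1) else 0) := by
  have h : ∀ b : Fin r, (CartanMatrix.B r).transpose a b * F b.val =
      2 * (if b.val = a.val then F b.val else 0)
        - (if a.val + 1 = r then 2 else 1) *
          (if 0 < a.val ∧ b.val = a.val - 1 then F b.val else 0)
        - (if b.val = a.val + 1 then F b.val else 0) := by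
    intro b
    simp only [CartanMatrix.B, Matrix.transpose_apply, Matrix.of_apply, Fin.ext_iff]
    grind
  have ha := a.2
  simp only [h, Finset.sum_sub_distrib, ← Finset.mul_sum, Fin.sum_ite_val_eq,
    Fin.sum_ite_and_val_eq]
  grind

/-- A row of the Cartan matrix `C_{ab} = (α_a^∨ | α_b)` of type `C` applied to a vector. -/
theorem sum_cartan_C {r : ℕ} (F : ℕ → ℤ) (a : Fin r) :
    ∑ b, (CartanMatrix.C r).transpose a b * F b.val =
      2 * F a.val - (if 0 < a.val then F (a.val - 1) else 0) -
        (if a.val + 1 < r then (if a.val + 2 = r then 2 else 1) * F (a.val + 1) else 0) := by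
  have h : ∀ b : Fin r, (CartanMatrix.C r).transpose a b * F b.val =
      2 * (if b.val = a.val then F b.val else 0)
        - (if 0 < a.val ∧ b.val = a.val - 1 then F b.val else 0)
        - (if a.val + 2 = r then 2 else 1) *
          (if b.val = a.val + 1 then F b.val else 0) := by
    intro b
    simp only [CartanMatrix.C, Matrix.transpose_apply, Matrix.of_apply, Fin.ext_iff]
    grind
  have ha := a.2
  simp only [h, Finset.sum_sub_distrib, ← Finset.mul_sum, Fin.sum_ite_val_eq,
    Fin.sum_ite_and_val_eq]
  grind

/-- A row of the Cartan matrix of type `D` applied to a vector. -/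
theorem sum_cartan_D {r : ℕ} (hr : 4 ≤ r) (F : ℕ → ℤ) (a : Fin r) :
    ∑ b, CartanMatrix.D r a b * F b.val =
      2 * F a.val - (if 0 < a.val then (if a.val + 1 < r then F (a.val - 1) else 0) else 0) -
        (if a.val + 2 < r then F (a.val + 1) else 0) -
        (if a.val + 3 = r then F (a.val + 2) else 0) -
        (if a.val + 1 = r then F (a.val - 2) else 0) := by
  have h : ∀ b : Fin r, CartanMatrix.D r a b * F b.val =
      2 * (if b.val = a.val then F b.val else 0)
        - (if (0 < a.val ∧ a.val + 1 < r) ∧ b.val = a.val - 1 then F b.val else 0)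
        - (if a.val + 2 < r ∧ b.val = a.val + 1 then F b.val else 0)
        - (if a.val + 3 = r ∧ b.val = a.val + 2 then F b.val else 0)
        - (if a.val + 1 = r ∧ b.val = a.val - 2 then F b.val else 0) := by
    intro b
    have ha := a.2
    have hb := b.2
    simp only [CartanMatrix.D, Matrix.of_apply, Fin.ext_iff]
    grind (splits := 30)
  have ha := a.2
  simp only [h, Finset.sum_sub_distrib, ← Finset.mul_sum, Fin.sum_ite_val_eq,
    Fin.sum_ite_and_val_eq]
  grind

theorem cartan_self (X : DynkinDiagram) (a : X.Vertex) : X.cartan a a = 2 :=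
  X.simpleRoot_self a

theorem cartan_nonpos (X : DynkinDiagram) (a b : X.Vertex) (h : a ≠ b) : X.cartan a b ≤ 0 := by
  cases X with
  | A r hr => exact CartanMatrix.A_apply_le_zero_of_ne r a b h
  | B r hr => exact CartanMatrix.B_off_diag_nonpos r b a h.symm
  | C r hr => exact CartanMatrix.C_off_diag_nonpos r b a h.symm
  | D r hr => exact CartanMatrix.D_off_diag_nonpos r a b h
  | E6 => exact neg_nonneg.1 ((by decide : ∀ a b : Fin 6, a ≠ b → 0 ≤ -E6.cartan a b) a b h)
  | E7 => exact neg_nonneg.1 ((by decide : ∀ a b : Fin 7, a ≠ b → 0 ≤ -E7.cartan a b) a b h)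
  | E8 => exact neg_nonneg.1 ((by decide : ∀ a b : Fin 8, a ≠ b → 0 ≤ -E8.cartan a b) a b h)
  | F4 => exact neg_nonneg.1 ((by decide : ∀ a b : Fin 4, a ≠ b → 0 ≤ -F4.cartan a b) a b h)
  | G2 => exact neg_nonneg.1 ((by decide : ∀ a b : Fin 2, a ≠ b → 0 ≤ -G2.cartan a b) a b h)

theorem t_pos (X : DynkinDiagram) (a : X.Vertex) : 0 < X.t a := by
  cases X with
  | A r hr => simp [t]
  | B r hr => simp only [t]; split_ifs <;> omega
  | C r hr => simp only [t]; split_ifs <;> omega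
  | D r hr => simp [t]
  | E6 => simp [t]
  | E7 => simp [t]
  | E8 => simp [t]
  | F4 => revert a; decide
  | G2 => revert a; decide

theorem exists_t_eq_one (X : DynkinDiagram) : ∃ a, X.t a = 1 := by
  cases X with
  | A r hr => exact ⟨⟨0, hr⟩, rfl⟩
  | B r hr => exact ⟨⟨0, by simp only [rank]; omega⟩, by simp only [t]; rw [if_neg]; omega⟩
  | C r hr => exact ⟨⟨r - 1, by simp only [rank]; omega⟩, by simp only [t]; rw [if_pos]; omega⟩
  | D r hr => exact ⟨⟨0, by simp only [rank]; omega⟩, rfl⟩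
  | E6 => exact ⟨(0 : Fin 6), rfl⟩
  | E7 => exact ⟨(0 : Fin 7), rfl⟩
  | E8 => exact ⟨(0 : Fin 8), rfl⟩
  | F4 => exact ⟨(0 : Fin 4), rfl⟩
  | G2 => exact ⟨(0 : Fin 2), rfl⟩

/-- The Cartan matrix is symmetrized by the numbers `t_a`. -/
theorem t_mul_cartan (X : DynkinDiagram) (a b : X.Vertex) :
    (X.t b : ℤ) * X.cartan a b = X.t a * X.cartan b a := by
  cases X with
  | A r hr =>
    change Fin r at a b
    have ha := a.2
    have hb := b.2
    simp only [t, cartan, CartanMatrix.A, Matrix.of_apply, Fin.ext_iff]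
    grind
  | B r hr =>
    change Fin r at a b
    have ha := a.2
    have hb := b.2
    simp only [t, cartan, CartanMatrix.B, Matrix.transpose_apply, Matrix.of_apply, Fin.ext_iff]
    grind
  | C r hr =>
    change Fin r at a b
    have ha := a.2
    have hb := b.2
    simp only [t, cartan, CartanMatrix.C, Matrix.transpose_apply, Matrix.of_apply, Fin.ext_iff]
    grind
  | D r hr =>
    change Fin r at a b
    have ha := a.2
    have hb := b.2
    simp only [t, cartan, CartanMatrix.D, Matrix.of_apply, Fin.ext_iff]
    grind
  | E6 => revert a b; decide
  | E7 => revert a b; decide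
  | E8 => revert a b; decide
  | F4 => revert a b; decide
  | G2 => revert a b; decide

/-- There is a positive vector with positive image under the Cartan matrix: a multiple of the
coordinate vector of `2ρ` with respect to the simple roots. -/
theorem exists_pos_cartan_mul_pos (X : DynkinDiagram) :
    ∃ v : X.Vertex → ℤ, (∀ a, 0 < v a) ∧ ∀ a, 0 < ∑ b, X.cartan a b * v b := by
  cases X with
  | A r hr =>
    refine ⟨fun a => ((a.val : ℤ) + 1) * (r - a.val), fun a => ?_, fun a => ?_⟩
    · have ha := a.2
      simp only [rank] at ha
      exact mul_pos (by omega) (by omega)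
    · change Fin r at a
      refine lt_of_lt_of_eq (b := (2 : ℤ)) (by norm_num)
        (Eq.trans ?_ (sum_cartan_A (fun n => ((n : ℤ) + 1) * (r - n)) a).symm)
      obtain ⟨n, hn⟩ := a
      rcases n with _ | _ | n <;>
        simp only [Nat.add_sub_cancel, Nat.zero_add, lt_irrefl, if_false] <;> push_cast <;>
        (try split_ifs) <;>
        first
        | omega
        | ring1
        | (have e : (r : ℤ) = n + 3 := by omega
           rw [e]; ring1)
  | B r hr =>
    refine ⟨fun a => ((a.val : ℤ) + 1) * (2 * r - a.val - 1), fun a => ?_, fun a => ?_⟩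
    · have ha := a.2
      simp only [rank] at ha
      exact mul_pos (by omega) (by omega)
    · change Fin r at a
      refine lt_of_lt_of_eq (b := (2 : ℤ)) (by norm_num)
        (Eq.trans ?_ (sum_cartan_B (fun n => ((n : ℤ) + 1) * (2 * r - n - 1)) a).symm)
      obtain ⟨n, hn⟩ := a
      rcases n with _ | _ | n <;>
        simp only [Nat.add_sub_cancel, Nat.zero_add, lt_irrefl, if_false] <;> push_cast <;>
        (try split_ifs) <;>
        first
        | omega
        | ring1
        | (have e : (r : ℤ) = n + 3 := by omega
           rw [e]; ring1)
  | C r hr =>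
    refine ⟨fun a => if a.val + 1 = r then (r : ℤ) * (r + 1) else
      2 * ((a.val : ℤ) + 1) * (2 * r - a.val), fun a => ?_, fun a => ?_⟩
    · have ha := a.2
      simp only [rank] at ha
      dsimp only
      split_ifs
      · positivity
      · exact mul_pos (by omega) (by omega)
    · change Fin r at a
      refine lt_of_lt_of_eq (b := (4 : ℤ)) (by norm_num)
        (Eq.trans ?_ (sum_cartan_C (fun n => if n + 1 = r then (r : ℤ) * (r + 1) else
          2 * ((n : ℤ) + 1) * (2 * r - n)) a).symm)
      obtain ⟨n, hn⟩ := a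
      rcases n with _ | _ | n <;>
        simp only [Nat.add_sub_cancel, Nat.zero_add, lt_irrefl, if_false] <;> push_cast <;>
        (try split_ifs) <;>
        first
        | omega
        | ring1
        | (have e : (r : ℤ) = n + 3 := by omega
           rw [e]; ring1)
        | (have e : (r : ℤ) = n + 4 := by omega
           rw [e]; ring1)
        | (have e : (r : ℤ) = 2 := by omega
           rw [e]; ring1)
        | (have e : (r : ℤ) = 3 := by omega
           rw [e]; ring1)
  | D r hr =>
    refine ⟨fun a => if r ≤ a.val + 2 then (r : ℤ) * (r - 1) else
      2 * ((a.val : ℤ) + 1) * (2 * r - a.val - 2), fun a => ?_, fun a => ?_⟩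
    · have ha := a.2
      simp only [rank] at ha
      dsimp only
      split_ifs
      · exact mul_pos (by omega) (by omega)
      · exact mul_pos (by omega) (by omega)
    · change Fin r at a
      refine lt_of_lt_of_eq (b := (4 : ℤ)) (by norm_num)
        (Eq.trans ?_ (sum_cartan_D hr (fun n => if r ≤ n + 2 then (r : ℤ) * (r - 1) else
          2 * ((n : ℤ) + 1) * (2 * r - n - 2)) a).symm)
      obtain ⟨n, hn⟩ := a
      rcases n with _ | _ | n <;>
        simp only [Nat.add_sub_cancel, Nat.zero_add, lt_irrefl, if_false] <;> push_cast <;>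
        (try split_ifs) <;>
        first
        | omega
        | ring1
        | (have e : (r : ℤ) = n + 3 := by omega
           rw [e]; ring1)
        | (have e : (r : ℤ) = n + 4 := by omega
           rw [e]; ring1)
        | (have e : (r : ℤ) = n + 5 := by omega
           rw [e]; ring1)
        | (have e : (r : ℤ) = 4 := by omega
           rw [e]; ring1)
  | E6 =>
    let v : Fin 6 → ℤ := ![16, 30, 42, 30, 16, 22]
    exact ⟨v, (by decide : ∀ a, 0 < v a), (by decide : ∀ a : Fin 6, 0 < ∑ b, E6.cartan a b * v b)⟩
  | E7 =>
    let v : Fin 7 → ℤ := ![34, 66, 96, 75, 52, 27, 49]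
    exact ⟨v, (by decide : ∀ a, 0 < v a), (by decide : ∀ a : Fin 7, 0 < ∑ b, E7.cartan a b * v b)⟩
  | E8 =>
    let v : Fin 8 → ℤ := ![58, 114, 168, 220, 270, 182, 92, 136]
    exact ⟨v, (by decide : ∀ a, 0 < v a), (by decide : ∀ a : Fin 8, 0 < ∑ b, E8.cartan a b * v b)⟩
  | F4 =>
    let v : Fin 4 → ℤ := ![16, 30, 42, 22]
    exact ⟨v, (by decide : ∀ a, 0 < v a), (by decide : ∀ a : Fin 4, 0 < ∑ b, F4.cartan a b * v b)⟩
  | G2 =>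
    let v : Fin 2 → ℤ := ![6, 10]
    exact ⟨v, (by decide : ∀ a, 0 < v a), (by decide : ∀ a : Fin 2, 0 < ∑ b, G2.cartan a b * v b)⟩

/-! ### The highest root and the fundamental weights -/

/-- The coordinates of the highest root `θ` in the basis of fundamental weights. -/
def highestRoot : (X : DynkinDiagram) → X.Weight
  | A r _ => fun a => (if a.val = 0 then 1 else 0) + (if a.val + 1 = r then 1 else 0)
  | B _ _ => fun a => if a.val = 1 then 1 else 0
  | C _ _ => fun a => if a.val = 0 then 2 else 0
  | D _ _ => fun a => if a.val = 1 then 1 else 0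
  | E6 => ![0, 0, 0, 0, 0, 1]
  | E7 => ![1, 0, 0, 0, 0, 0, 0]
  | E8 => ![1, 0, 0, 0, 0, 0, 0, 0]
  | F4 => ![1, 0, 0, 0]
  | G2 => ![1, 0]

theorem highestRoot_nonneg (X : DynkinDiagram) (a : X.Vertex) : 0 ≤ X.highestRoot a := by
  cases X with
  | A r hr => simp only [highestRoot]; split_ifs <;> norm_num
  | B r hr => simp only [highestRoot]; split_ifs <;> norm_num
  | C r hr => simp only [highestRoot]; split_ifs <;> norm_num
  | D r hr => simp only [highestRoot]; split_ifs <;> norm_num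
  | E6 => exact neg_nonpos.1 ((by decide : ∀ a : Fin 6, -E6.highestRoot a ≤ 0) a)
  | E7 => exact neg_nonpos.1 ((by decide : ∀ a : Fin 7, -E7.highestRoot a ≤ 0) a)
  | E8 => exact neg_nonpos.1 ((by decide : ∀ a : Fin 8, -E8.highestRoot a ≤ 0) a)
  | F4 => exact neg_nonpos.1 ((by decide : ∀ a : Fin 4, -F4.highestRoot a ≤ 0) a)
  | G2 => exact neg_nonpos.1 ((by decide : ∀ a : Fin 2, -G2.highestRoot a ≤ 0) a)

/-- `θ = ∑ c_a α_a^∨`, where `α_a^∨ = t_a α_a`. -/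
theorem sum_cartan_mul_comark (X : DynkinDiagram) (a : X.Vertex) :
    ∑ b, X.cartan a b * (X.t b * X.finComark b : ℕ) = X.highestRoot a := by
  cases X with
  | A r hr =>
    change Fin r at a
    refine (sum_cartan_A (fun _ => ((1 * 1 : ℕ) : ℤ)) a).trans ?_
    have ha := a.2
    simp only [highestRoot]
    split_ifs <;> omega
  | B r hr =>
    change Fin r at a
    refine (sum_cartan_B (fun n => (((if n + 1 = r then 2 else 1) *
      (if n = 0 ∨ n + 1 = r then 1 else 2) : ℕ) : ℤ)) a).trans ?_
    have ha := a.2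
    simp only [highestRoot]
    split_ifs <;> first | omega | (simp only [false_or] at *; omega)
  | C r hr =>
    change Fin r at a
    refine (sum_cartan_C (fun n => (((if n + 1 = r then 1 else 2) * 1 : ℕ) : ℤ)) a).trans ?_
    have ha := a.2
    simp only [highestRoot]
    split_ifs <;> omega
  | D r hr =>
    change Fin r at a
    refine (sum_cartan_D hr (fun n =>
      ((1 * (if n = 0 ∨ r ≤ n + 2 then 1 else 2) : ℕ) : ℤ)) a).trans ?_
    have ha := a.2
    simp only [highestRoot]
    split_ifs <;> first | omega | (simp only [false_or] at *; omega)
  | E6 => revert a; decide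
  | E7 => revert a; decide
  | E8 => revert a; decide
  | F4 => revert a; decide
  | G2 => revert a; decide

/-- The highest root has square length `2`. -/
theorem sum_comark_mul_highestRoot (X : DynkinDiagram) :
    ∑ a, (X.finComark a : ℤ) * X.highestRoot a = 2 := by
  cases X with
  | A r hr =>
    have h := Fin.sum_ite_val_eq (r := r) 0 (fun _ => (1 : ℤ))
    have h' := Fin.sum_ite_val_eq (r := r) (r - 1) (fun _ => (1 : ℤ))
    rw [if_pos (by omega)] at h h'
    have h2 : ∀ a : Fin r, a.val + 1 = r ↔ a.val = r - 1 := fun a => by omega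
    simp only [finComark, highestRoot, Nat.cast_one, one_mul, Finset.sum_add_distrib]
    refine congrArg₂ (· + ·) h (Eq.trans (Finset.sum_congr rfl fun a _ => ?_) h')
    exact if_congr (h2 a) rfl rfl
  | B r hr =>
    refine Eq.trans (Finset.sum_congr rfl fun a _ => ?_)
      ((Fin.sum_ite_val_eq (r := r) 1 (fun _ => (2 : ℤ))).trans (if_pos (by omega)))
    simp only [finComark, highestRoot]
    grind
  | C r hr =>
    refine Eq.trans (Finset.sum_congr rfl fun a _ => ?_)
      ((Fin.sum_ite_val_eq (r := r) 0 (fun _ => (2 : ℤ))).trans (if_pos (by omega)))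
    simp only [finComark, highestRoot]
    grind
  | D r hr =>
    refine Eq.trans (Finset.sum_congr rfl fun a _ => ?_)
      ((Fin.sum_ite_val_eq (r := r) 1 (fun _ => (2 : ℤ))).trans (if_pos (by omega)))
    simp only [finComark, highestRoot]
    grind
  | E6 => decide
  | E7 => decide
  | E8 => decide
  | F4 => decide
  | G2 => decide

theorem finComark_pos (X : DynkinDiagram) (a : X.Vertex) : 0 < X.finComark a :=
  X.comark_pos a.succ

/-- The fundamental weight `ω_i`, with `ω_0 = 0`. -/
def fundamental (X : DynkinDiagram) (i : X.ExtVertex) : X.Weight :=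
  fun c => if i = c.succ then 1 else 0

theorem fundamental_zero (X : DynkinDiagram) : X.fundamental 0 = 0 := by
  funext c
  exact if_neg (Fin.succ_ne_zero c).symm

theorem fundamental_succ (X : DynkinDiagram) (b c : X.Vertex) :
    X.fundamental b.succ c = if b = c then 1 else 0 := by
  simp only [fundamental, Fin.succ_inj]

theorem fundamental_apply (X : DynkinDiagram) (i : X.ExtVertex) (c : X.Vertex) :
    X.fundamental i c = if i.val = c.val + 1 then 1 else 0 :=
  if_congr (by rw [Fin.ext_iff, Fin.val_succ]) rfl rfl

theorem tauZero_eq_zero_or (X : DynkinDiagram) (a : X.Vertex) :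
    X.tauZero a = 0 ∨ ∃ c : X.Vertex, X.tauZero a = c.succ ∧ X.t c = 1 := by
  cases X with
  | A r hr => exact Or.inr ⟨a, rfl, rfl⟩
  | B r hr =>
    simp only [tauZero]
    split_ifs
    · obtain ⟨n, rfl⟩ : ∃ n, r = n + 1 := ⟨r - 1, by omega⟩
      refine Or.inr ⟨(0 : Fin (n + 1)), rfl, ?_⟩
      simp only [t]
      rw [if_neg]
      simp
      omega
    · exact Or.inl rfl
  | C r hr =>
    simp only [tauZero]
    split_ifs with h
    · exact Or.inr ⟨a, rfl, if_pos h⟩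
    · exact Or.inl rfl
  | D r hr =>
    simp only [tauZero]
    split_ifs
    · obtain ⟨n, rfl⟩ : ∃ n, r = n + 1 := ⟨r - 1, by omega⟩
      exact Or.inr ⟨(0 : Fin (n + 1)), rfl, rfl⟩
    · exact Or.inl rfl
    · exact Or.inr ⟨a, rfl, rfl⟩
  | E6 =>
    change Fin 6 at a
    fin_cases a <;>
    first
    | exact Or.inl rfl
    | exact Or.inr ⟨(0 : Fin 6), rfl, rfl⟩
    | exact Or.inr ⟨(4 : Fin 6), rfl, rfl⟩
  | E7 =>
    change Fin 7 at a
    fin_cases a <;>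
    first
    | exact Or.inl rfl
    | exact Or.inr ⟨(0 : Fin 7), rfl, rfl⟩
    | exact Or.inr ⟨(5 : Fin 7), rfl, rfl⟩
  | E8 => exact Or.inl rfl
  | F4 => exact Or.inl rfl
  | G2 => exact Or.inl rfl

/-! ### The coroot lattice -/

theorem simpleRoot_apply (X : DynkinDiagram) (a b : X.Vertex) :
    X.simpleRoot b a = X.cartan a b := rfl

/-- The combination `∑ n_a α_a` of simple roots. -/
def rootComb (X : DynkinDiagram) : (X.Vertex → ℤ) →+ X.Weight where
  toFun n := ∑ a, n a • X.simpleRoot a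
  map_zero' := by simp
  map_add' m n := by simp [add_smul, Finset.sum_add_distrib]

theorem rootComb_def (X : DynkinDiagram) (n : X.Vertex → ℤ) :
    X.rootComb n = ∑ a, n a • X.simpleRoot a := rfl

theorem rootComb_apply (X : DynkinDiagram) (n : X.Vertex → ℤ) (a : X.Vertex) :
    X.rootComb n a = ∑ b, X.cartan a b * n b := by
  simp only [rootComb_def, Finset.sum_apply, Pi.smul_apply, simpleRoot_apply, smul_eq_mul, mul_comm]

/-- Elements of `Q^∨` are the combinations of simple roots whose coefficients are divisible by the
numbers `t_a`. -/
theorem mem_corootLattice_iff (X : DynkinDiagram) (x : X.Weight) :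
    x ∈ X.corootLattice ↔ ∃ n : X.Vertex → ℤ, X.rootComb n = x ∧ ∀ a, (X.t a : ℤ) ∣ n a := by
  constructor
  · intro hx
    induction hx using AddSubgroup.closure_induction with
    | mem x hx =>
      obtain ⟨a, rfl⟩ := hx
      refine ⟨Pi.single a (X.t a : ℤ), ?_, fun b => ?_⟩
      · rw [rootComb_def, Finset.sum_eq_single a]
        · simp
        · intro b _ hb
          simp [Pi.single_eq_of_ne hb]
        · simp
      · by_cases h : b = a
        · subst h
          simp
        · simp [Pi.single_eq_of_ne h]
    | zero => exact ⟨0, map_zero _, fun a => dvd_zero _⟩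
    | add x y _ _ hx hy =>
      obtain ⟨m, rfl, hm⟩ := hx
      obtain ⟨n, rfl, hn⟩ := hy
      exact ⟨m + n, map_add _ _ _, fun a => dvd_add (hm a) (hn a)⟩
    | neg x _ hx =>
      obtain ⟨m, rfl, hm⟩ := hx
      exact ⟨-m, map_neg _ _, fun a => (dvd_neg).2 (hm a)⟩
  · rintro ⟨n, rfl, hn⟩
    choose m hm using hn
    rw [rootComb_def]
    refine sum_mem fun a _ => ?_
    have h : n a • X.simpleRoot a = m a • (X.t a • X.simpleRoot a) := by
      rw [hm a, mul_comm, mul_smul, natCast_zsmul]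
    rw [h]
    exact AddSubgroup.zsmul_mem _ (AddSubgroup.subset_closure (Set.mem_range_self a)) _

theorem simpleRoot_mem_corootLattice (X : DynkinDiagram) {a : X.Vertex} (ha : X.t a = 1) :
    X.simpleRoot a ∈ X.corootLattice := by
  have h : X.t a • X.simpleRoot a ∈ X.corootLattice := AddSubgroup.subset_closure ⟨a, rfl⟩
  rwa [ha, one_smul] at h

theorem zsmul_mem_of_two {G : Type*} [AddCommGroup G] {H : AddSubgroup G} {x : G}
    (hx : (2 : ℤ) • x ∈ H) {n : ℤ} (hn : 2 ∣ n) : n • x ∈ H := by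
  obtain ⟨m, rfl⟩ := hn
  rw [mul_comm, mul_smul]
  exact H.zsmul_mem hx m

/-- In simply laced types `∑_b C_{ab} ω_b = α_a`, so that it is enough to compare `ω_b` with the
weight attached to `τ_b`. -/
theorem sum_cartan_smul_tau_mem_of_simplyLaced (X : DynkinDiagram) (ht : ∀ a, X.t a = 1)
    (h : ∀ b, X.fundamental b.succ - X.fundamental (X.tauZero b) ∈ X.corootLattice) (a : X.Vertex) :
    ∑ b, X.cartan a b • X.fundamental (X.tauZero b) ∈ X.corootLattice := by
  have h1 : ∑ b, X.cartan a b • X.fundamental b.succ = X.simpleRoot a := by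
    funext c
    have h2 := X.t_mul_cartan a c
    rw [ht, ht, Nat.cast_one, one_mul, one_mul] at h2
    simp only [Finset.sum_apply, Pi.smul_apply, fundamental_succ, smul_eq_mul, mul_ite, mul_one,
      mul_zero, Finset.sum_ite_eq', Finset.mem_univ, if_true, simpleRoot_apply, h2]
  have h2 : ∑ b, X.cartan a b • X.fundamental (X.tauZero b) = X.simpleRoot a -
      ∑ b, X.cartan a b • (X.fundamental b.succ - X.fundamental (X.tauZero b)) := by
    rw [← h1, ← Finset.sum_sub_distrib]
    refine Finset.sum_congr rfl fun b _ => ?_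
    rw [← smul_sub, sub_sub_cancel]
  rw [h2]
  exact sub_mem (X.simpleRoot_mem_corootLattice (ht a))
    (sum_mem fun b _ => AddSubgroup.zsmul_mem _ (h b) _)

theorem sum_cartan_smul_tau_mem_A (r : ℕ) (hr : 1 ≤ r) (a : (A r hr).Vertex) :
    ∑ b, (A r hr).cartan a b • (A r hr).fundamental ((A r hr).tauZero b) ∈
      (A r hr).corootLattice := by
  refine sum_cartan_smul_tau_mem_of_simplyLaced _ (fun _ => rfl) (fun b => ?_) a
  have h : (A r hr).tauZero b = b.succ := rfl
  rw [h, sub_self]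
  exact zero_mem _

theorem sum_cartan_smul_tau_mem_B (r : ℕ) (hr : 3 ≤ r) (a : (B r hr).Vertex) :
    ∑ b, (B r hr).cartan a b • (B r hr).fundamental ((B r hr).tauZero b) ∈
      (B r hr).corootLattice := by
  have hone : (1 : (B r hr).ExtVertex).val = 1 := by
    obtain ⟨n, rfl⟩ : ∃ n, r = n + 1 := ⟨r - 1, by omega⟩
    rfl
  have h2 : (2 : ℤ) • (B r hr).fundamental 1 ∈ (B r hr).corootLattice := by
    rw [mem_corootLattice_iff]
    refine ⟨fun _ => 2, ?_, fun b => ?_⟩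
    · funext c
      have hc : c.val < r := c.2
      rw [rootComb_apply, Pi.smul_apply, fundamental_apply, hone]
      refine (sum_cartan_B (r := r) (fun _ => 2) c).trans ?_
      rw [smul_eq_mul]
      split_ifs <;> omega
    · simp only [t]
      split_ifs <;> norm_num
  have h1 : ∀ b : (B r hr).Vertex, (B r hr).fundamental ((B r hr).tauZero b) =
      (if b.val % 2 = 0 then 1 else 0 : ℤ) • (B r hr).fundamental 1 := by
    intro b
    simp only [tauZero]
    split_ifs
    · rw [one_smul]
    · omega
    · omega
    · rw [zero_smul, fundamental_zero]
  simp only [h1, ← mul_smul, ← Finset.sum_smul]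
  refine zsmul_mem_of_two h2
    ((sum_cartan_B (r := r) (fun n => if n % 2 = 0 then 1 else 0) a).symm ▸ ?_)
  have ha : a.val < r := a.2
  split_ifs <;> omega

theorem sum_cartan_smul_tau_mem_C (r : ℕ) (hr : 2 ≤ r) (a : (C r hr).Vertex) :
    ∑ b, (C r hr).cartan a b • (C r hr).fundamental ((C r hr).tauZero b) ∈
      (C r hr).corootLattice := by
  have hlast : (Fin.last _ : (C r hr).ExtVertex).val = r := rfl
  have h2 : (2 : ℤ) • (C r hr).fundamental (Fin.last _) ∈ (C r hr).corootLattice := by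
    rw [mem_corootLattice_iff]
    refine ⟨fun d => if d.val + 1 = r then r else 2 * (d.val + 1), ?_, fun b => ?_⟩
    · funext c
      have hc : c.val < r := c.2
      rw [rootComb_apply, Pi.smul_apply, fundamental_apply, hlast]
      refine (sum_cartan_C (r := r)
        (fun d => if d + 1 = r then (r : ℤ) else 2 * (d + 1)) c).trans ?_
      rw [smul_eq_mul]
      split_ifs <;> omega
    · simp only [t]
      split_ifs
      · simp
      · exact ⟨_, rfl⟩
  have h1 : ∀ b : (C r hr).Vertex, (C r hr).fundamental ((C r hr).tauZero b) =
      (if b.val + 1 = r then 1 else 0 : ℤ) • (C r hr).fundamental (Fin.last _) := by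
    intro b
    simp only [tauZero]
    split_ifs with h
    · rw [one_smul]
      congr 1
      exact Fin.ext h
    · rw [zero_smul, fundamental_zero]
  simp only [h1, ← mul_smul, ← Finset.sum_smul]
  refine zsmul_mem_of_two h2
    ((sum_cartan_C (r := r) (fun n => if n + 1 = r then 1 else 0) a).symm ▸ ?_)
  have ha : a.val < r := a.2
  split_ifs <;> omega

theorem cartan_D_chain {r : ℕ} (n : ℕ) (hn : n + 3 < r) (c : Fin r) :
    CartanMatrix.D r c ⟨n, by omega⟩ = 2 * (if n = c.val then 1 else 0) -
      (if 0 < n then 1 else 0) * (if n - 1 = c.val then 1 else 0) -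
      (if n + 1 = c.val then 1 else 0) := by
  have hc := c.2
  simp only [CartanMatrix.D, Matrix.of_apply, Fin.ext_iff]
  grind

/-- In type `D_r` the fundamental weights of the chain satisfy `ω_n ≡ n ω_1` modulo the root
lattice, and `2 ω_1` lies in the root lattice. -/
theorem fundamental_sub_tau_mem_D (r : ℕ) (hr : 4 ≤ r) (b : (D r hr).Vertex) :
    (D r hr).fundamental b.succ - (D r hr).fundamental ((D r hr).tauZero b) ∈
      (D r hr).corootLattice := by
  obtain ⟨w, hw⟩ : ∃ w : ℕ → (D r hr).Weight, ∀ n c, w n c = if n = c.val then 1 else 0 :=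
    ⟨fun n c => if n = c.val then 1 else 0, fun _ _ => rfl⟩
  have hf : ∀ (i : (D r hr).ExtVertex) (n : ℕ), i.val = n + 1 → (D r hr).fundamental i = w n := by
    intro i n h
    funext c
    rw [fundamental_apply, hw, h]
    exact if_congr Nat.succ_inj rfl rfl
  have h2 : (2 : ℤ) • w 0 ∈ (D r hr).corootLattice := by
    rw [mem_corootLattice_iff]
    refine ⟨fun d => if r ≤ d.val + 2 then 1 else 2, ?_, fun b => one_dvd _⟩
    funext c
    have hc : c.val < r := c.2
    rw [rootComb_apply, Pi.smul_apply, hw]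
    refine (sum_cartan_D hr (fun d => if r ≤ d + 2 then 1 else 2) c).trans ?_
    rw [smul_eq_mul]
    split_ifs <;> omega
  have hα : ∀ n, n + 3 < r → (2 : ℤ) • w n - (if 0 < n then 1 else 0 : ℤ) • w (n - 1) - w (n + 1) ∈
      (D r hr).corootLattice := by
    intro n hn
    have h : (2 : ℤ) • w n - (if 0 < n then 1 else 0 : ℤ) • w (n - 1) - w (n + 1) =
        (D r hr).simpleRoot (⟨n, by simp only [rank]; omega⟩ : (D r hr).Vertex) := by
      funext c
      have hc : c.val < r := c.2
      rw [Pi.sub_apply, Pi.sub_apply, Pi.smul_apply, Pi.smul_apply, hw, hw, hw, simpleRoot_apply]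
      exact (cartan_D_chain n hn c).symm
    rw [h]
    exact simpleRoot_mem_corootLattice _ rfl
  have hchain : ∀ n, n + 2 < r → w n - ((n : ℤ) + 1) • w 0 ∈ (D r hr).corootLattice := by
    intro n
    induction n using Nat.strong_induction_on with
    | _ n ih =>
      intro hn
      rcases n with _ | _ | n
      · simp
      · have h := neg_mem (hα 0 (by omega))
        convert h using 1
        simp only [lt_irrefl, if_false]
        push_cast
        module
      · have h := hα (n + 1) (by omega)
        have h3 := ih n (by omega) (by omega)
        have h4 := AddSubgroup.zsmul_mem _ (ih (n + 1) (by omega) (by omega)) 2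
        convert sub_mem (sub_mem h4 h3) h using 1
        rw [if_pos (by omega), Nat.add_sub_cancel]
        push_cast
        module
  have hb : b.val < r := b.2
  by_cases h : b.val + 1 ≤ r - 2
  · have h5 := hchain b.val (by omega)
    have h6 : (D r hr).fundamental ((D r hr).tauZero b) =
        (if b.val % 2 = 0 then 1 else 0 : ℤ) • w 0 := by
      simp only [tauZero]
      rw [if_pos h]
      split_ifs
      · rw [one_smul]
        refine hf _ 0 ?_
        obtain ⟨n, rfl⟩ : ∃ n, r = n + 1 := ⟨r - 1, by omega⟩
        rfl
      · omega
      · omega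
      · rw [zero_smul, fundamental_zero]
    rw [h6, hf b.succ b.val (Fin.val_succ b)]
    have h7 : ((b.val : ℤ) + 1 - (if b.val % 2 = 0 then 1 else 0 : ℤ)) • w 0 ∈
        (D r hr).corootLattice := by
      refine zsmul_mem_of_two h2 ?_
      split_ifs <;> omega
    convert add_mem h5 h7 using 1
    module
  · have h5 : (D r hr).tauZero b = b.succ := by
      simp only [tauZero]
      rw [if_neg h]
    rw [h5, sub_self]
    exact zero_mem _

theorem fundamental_sub_tau_mem_E6 (b : E6.Vertex) :
    E6.fundamental b.succ - E6.fundamental (E6.tauZero b) ∈ E6.corootLattice := by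
  let N : Fin 6 → E6.Vertex → ℤ := ![![0, 0, 0, 0, 0, 0], ![1, 2, 2, 1, 0, 1], ![2, 4, 6, 4, 2, 3],
    ![0, 1, 2, 2, 1, 1], ![0, 0, 0, 0, 0, 0], ![1, 2, 3, 2, 1, 2]]
  have h : ∀ b c : Fin 6, ∑ d, E6.cartan c d * N b d =
      (if b = c then 1 else 0) - E6.fundamental (E6.tauZero b) c := by decide
  refine (mem_corootLattice_iff _ _).2 ⟨N b, ?_, fun a => one_dvd _⟩
  funext c
  refine (rootComb_apply _ _ c).trans ((h b c).trans ?_)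
  rw [Pi.sub_apply, fundamental_succ]
  rfl

theorem fundamental_sub_tau_mem_E7 (b : E7.Vertex) :
    E7.fundamental b.succ - E7.fundamental (E7.tauZero b) ∈ E7.corootLattice := by
  let N : Fin 7 → E7.Vertex → ℤ := ![![2, 3, 4, 3, 2, 1, 2], ![3, 6, 8, 6, 4, 2, 4],
    ![4, 8, 12, 9, 6, 3, 6], ![2, 4, 6, 5, 3, 1, 3], ![2, 4, 6, 5, 4, 2, 3],
    ![0, 0, 0, 0, 0, 0, 0], ![1, 2, 3, 2, 1, 0, 2]]
  have h : ∀ b c : Fin 7, ∑ d, E7.cartan c d * N b d =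
      (if b = c then 1 else 0) - E7.fundamental (E7.tauZero b) c := by decide
  refine (mem_corootLattice_iff _ _).2 ⟨N b, ?_, fun a => one_dvd _⟩
  funext c
  refine (rootComb_apply _ _ c).trans ((h b c).trans ?_)
  rw [Pi.sub_apply, fundamental_succ]
  rfl

/-- The congruence modulo `Q^∨` behind the boundary Q-system. -/
theorem sum_cartan_smul_tau_mem (X : DynkinDiagram) (a : X.Vertex) :
    ∑ b, X.cartan a b • X.fundamental (X.tauZero b) ∈ X.corootLattice := by
  cases X with
  | A r hr => exact sum_cartan_smul_tau_mem_A r hr a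
  | B r hr => exact sum_cartan_smul_tau_mem_B r hr a
  | C r hr => exact sum_cartan_smul_tau_mem_C r hr a
  | D r hr =>
    exact sum_cartan_smul_tau_mem_of_simplyLaced _ (fun _ => rfl) (fundamental_sub_tau_mem_D r hr) a
  | E6 =>
    exact sum_cartan_smul_tau_mem_of_simplyLaced _ (fun _ => rfl) fundamental_sub_tau_mem_E6 a
  | E7 =>
    exact sum_cartan_smul_tau_mem_of_simplyLaced _ (fun _ => rfl) fundamental_sub_tau_mem_E7 a
  | E8 =>
    refine sum_mem fun b _ => ?_
    rw [show E8.tauZero b = 0 from rfl, fundamental_zero, smul_zero]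
    exact zero_mem _
  | F4 =>
    refine sum_mem fun b _ => ?_
    rw [show F4.tauZero b = 0 from rfl, fundamental_zero, smul_zero]
    exact zero_mem _
  | G2 =>
    refine sum_mem fun b _ => ?_
    rw [show G2.tauZero b = 0 from rfl, fundamental_zero, smul_zero]
    exact zero_mem _

/-! ### The normalized form -/

/-- A symmetric matrix with non-positive off-diagonal entries which maps some positive vector to a
positive vector is positive definite. -/
theorem sum_mul_mul_pos {ι : Type*} [Fintype ι] {B : ι → ι → ℚ} (hs : ∀ a b, B a b = B b a)
    (hoff : ∀ a b, a ≠ b → B a b ≤ 0) {v : ι → ℚ} (hv : ∀ a, 0 < v a)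
    (hB : ∀ a, 0 < ∑ b, B a b * v b) {y : ι → ℚ} (hy : y ≠ 0) :
    0 < ∑ a, ∑ b, B a b * y a * y b := by
  have h1 : ∀ a b, B a b * (v b / v a * y a ^ 2) / 2 + B b a * (v a / v b * y b ^ 2) / 2 ≤
      B a b * y a * y b := by
    intro a b
    have ha := hv a
    have hb := hv b
    have h : B a b * y a * y b -
        (B a b * (v b / v a * y a ^ 2) / 2 + B b a * (v a / v b * y b ^ 2) / 2) =
        -B a b * ((v b * y a - v a * y b) ^ 2 / (2 * v a * v b)) := by
      rw [hs b a]
      field_simp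
      ring
    rw [← sub_nonneg, h]
    by_cases hab : a = b
    · subst hab
      simp
    · exact mul_nonneg (neg_nonneg.2 (hoff a b hab)) (by positivity)
  have h2 : ∑ a, ∑ b, (B a b * (v b / v a * y a ^ 2) / 2 + B b a * (v a / v b * y b ^ 2) / 2) =
      ∑ a, (y a ^ 2 / v a) * ∑ b, B a b * v b := by
    simp only [Finset.sum_add_distrib]
    rw [Finset.sum_comm (f := fun a b => B b a * (v a / v b * y b ^ 2) / 2)]
    simp only [← Finset.sum_add_distrib, Finset.mul_sum]
    refine Finset.sum_congr rfl fun a _ => Finset.sum_congr rfl fun b _ => ?_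
    ring
  obtain ⟨c, hc⟩ := Function.ne_iff.1 hy
  calc 0 < ∑ a, (y a ^ 2 / v a) * ∑ b, B a b * v b := by
        refine Finset.sum_pos' (fun a _ => ?_) ⟨c, Finset.mem_univ c, ?_⟩
        · exact mul_nonneg (div_nonneg (sq_nonneg _) (hv a).le) (hB a).le
        · exact mul_pos (div_pos (pow_pos_of_ne hc) (hv c)) (hB c)
    _ ≤ _ := h2 ▸ Finset.sum_le_sum fun a _ => Finset.sum_le_sum fun b _ => h1 a b
where
  pow_pos_of_ne {q : ℚ} (h : q ≠ 0) : 0 < q ^ 2 := by positivity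

theorem cast_t_pos (X : DynkinDiagram) (a : X.Vertex) : (0 : ℚ) < X.t a :=
  Nat.cast_pos.2 (X.t_pos a)

/-- The numbers `(α_a | α_b) = C_{ab} / t_a`. -/
theorem cartan_div_t_comm (X : DynkinDiagram) (a b : X.Vertex) :
    (X.cartan a b : ℚ) / X.t a = X.cartan b a / X.t b := by
  rw [div_eq_div_iff (X.cast_t_pos a).ne' (X.cast_t_pos b).ne', mul_comm, mul_comm _ (X.t a : ℚ)]
  exact_mod_cast X.t_mul_cartan a b

theorem cartan_posDef (X : DynkinDiagram) {y : X.Vertex → ℚ} (hy : y ≠ 0) :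
    0 < ∑ a, ∑ b, (X.cartan a b : ℚ) / X.t a * y a * y b := by
  obtain ⟨v, hv, hC⟩ := X.exists_pos_cartan_mul_pos
  refine sum_mul_mul_pos X.cartan_div_t_comm (fun a b hab => ?_) (v := fun a => v a)
    (fun a => by exact_mod_cast hv a) (fun a => ?_) hy
  · exact div_nonpos_of_nonpos_of_nonneg (by exact_mod_cast X.cartan_nonpos a b hab)
      (X.cast_t_pos a).le
  · have h : ∑ b, (X.cartan a b : ℚ) / X.t a * v b =
        ((∑ b, X.cartan a b * v b : ℤ) : ℚ) / X.t a := by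
      rw [Int.cast_sum, Finset.sum_div]
      refine Finset.sum_congr rfl fun b _ => ?_
      rw [Int.cast_mul]
      ring
    rw [h]
    exact div_pos (by exact_mod_cast hC a) (X.cast_t_pos a)

theorem det_cartan_ne_zero (X : DynkinDiagram) :
    (X.cartan.map (Int.cast : ℤ → ℚ)).det ≠ 0 := by
  intro h
  obtain ⟨y, hy, h0⟩ := Matrix.exists_mulVec_eq_zero_iff.2 h
  refine (X.cartan_posDef hy).ne' (Finset.sum_eq_zero fun a _ => ?_)
  have h1 : ∑ b, (X.cartan a b : ℚ) * y b = 0 := congrFun h0 a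
  have h2 : ∑ b, (X.cartan a b : ℚ) / X.t a * y a * y b =
      y a / X.t a * ∑ b, (X.cartan a b : ℚ) * y b := by
    rw [Finset.mul_sum]
    exact Finset.sum_congr rfl fun b _ => by ring
  rw [h2, h1, mul_zero]

/-- The rational coordinates of a weight with respect to the simple roots. -/
noncomputable def coord (X : DynkinDiagram) (x : X.Weight) : X.Vertex → ℚ :=
  (X.cartan.map (Int.cast : ℤ → ℚ))⁻¹.mulVec fun a => (x a : ℚ)

theorem sum_cartan_mul_coord (X : DynkinDiagram) (x : X.Weight) (a : X.Vertex) :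
    ∑ b, (X.cartan a b : ℚ) * X.coord x b = x a := by
  have h : (X.cartan.map (Int.cast : ℤ → ℚ)).mulVec (X.coord x) = fun a => (x a : ℚ) := by
    rw [coord, Matrix.mulVec_mulVec,
      Matrix.mul_nonsing_inv _ (isUnit_iff_ne_zero.2 X.det_cartan_ne_zero), Matrix.one_mulVec]
  exact congrFun h a

theorem coord_rootComb (X : DynkinDiagram) (n : X.Vertex → ℤ) (a : X.Vertex) :
    X.coord (X.rootComb n) a = n a := by
  have h : (fun a => (X.rootComb n a : ℚ)) =
      (X.cartan.map (Int.cast : ℤ → ℚ)).mulVec (fun b => (n b : ℚ)) := by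
    funext a
    rw [rootComb_apply, Int.cast_sum]
    exact Finset.sum_congr rfl fun b _ => Int.cast_mul _ _
  rw [coord, h, Matrix.mulVec_mulVec,
    Matrix.nonsing_inv_mul _ (isUnit_iff_ne_zero.2 X.det_cartan_ne_zero), Matrix.one_mulVec]

theorem rootComb_injective (X : DynkinDiagram) : Function.Injective X.rootComb := by
  intro m n h
  funext a
  have h1 := X.coord_rootComb m a
  rw [h, coord_rootComb] at h1
  exact_mod_cast h1.symm

theorem form_eq_sum_coord (X : DynkinDiagram) (x y : X.Weight) :
    X.form x y = ∑ a, (x a : ℚ) * X.coord y a / X.t a := by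
  refine Finset.sum_congr rfl fun a _ => ?_
  rw [coord, Matrix.mulVec, dotProduct, Finset.mul_sum, Finset.sum_div]
  refine Finset.sum_congr rfl fun b _ => ?_
  rw [gram, Matrix.diagonal_mul]
  ring

theorem form_eq_sum_coord_coord (X : DynkinDiagram) (x y : X.Weight) :
    X.form x y = ∑ a, ∑ b, (X.cartan a b : ℚ) / X.t a * X.coord y a * X.coord x b := by
  rw [form_eq_sum_coord]
  refine Finset.sum_congr rfl fun a _ => ?_
  rw [← X.sum_cartan_mul_coord x a, Finset.sum_mul, Finset.sum_div]
  exact Finset.sum_congr rfl fun b _ => by ring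

theorem form_comm (X : DynkinDiagram) (x y : X.Weight) : X.form x y = X.form y x := by
  rw [form_eq_sum_coord_coord, form_eq_sum_coord_coord, Finset.sum_comm]
  refine Finset.sum_congr rfl fun a _ => Finset.sum_congr rfl fun b _ => ?_
  rw [X.cartan_div_t_comm]
  ring

theorem coord_ne_zero (X : DynkinDiagram) {x : X.Weight} (hx : x ≠ 0) : X.coord x ≠ 0 := by
  intro h
  apply hx
  funext a
  have h1 := X.sum_cartan_mul_coord x a
  simp only [h, Pi.zero_apply, mul_zero, Finset.sum_const_zero] at h1
  exact_mod_cast h1.symm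

theorem form_self_pos (X : DynkinDiagram) {x : X.Weight} (hx : x ≠ 0) : 0 < X.form x x := by
  rw [form_eq_sum_coord_coord]
  exact X.cartan_posDef (X.coord_ne_zero hx)

theorem form_add_left (X : DynkinDiagram) (x y z : X.Weight) :
    X.form (x + y) z = X.form x z + X.form y z := by
  simp only [form_eq_sum_coord, ← Finset.sum_add_distrib, Pi.add_apply]
  exact Finset.sum_congr rfl fun a _ => by push_cast; ring

/-- The form as an additive map of its first argument. -/
noncomputable def formHom (X : DynkinDiagram) (z : X.Weight) : X.Weight →+ ℚ :=
  AddMonoidHom.mk' (fun x => X.form x z) fun x y => X.form_add_left x y z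

theorem formHom_apply (X : DynkinDiagram) (z x : X.Weight) : X.formHom z x = X.form x z := rfl

theorem form_add_right (X : DynkinDiagram) (x y z : X.Weight) :
    X.form x (y + z) = X.form x y + X.form x z := by
  rw [X.form_comm, form_add_left, X.form_comm y, X.form_comm z]

theorem form_zero_left (X : DynkinDiagram) (z : X.Weight) : X.form 0 z = 0 := map_zero (X.formHom z)

theorem form_neg_left (X : DynkinDiagram) (x z : X.Weight) : X.form (-x) z = -X.form x z :=
  map_neg (X.formHom z) x

theorem form_neg_right (X : DynkinDiagram) (x z : X.Weight) : X.form x (-z) = -X.form x z := by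
  rw [form_comm, form_neg_left, form_comm]

theorem form_sub_left (X : DynkinDiagram) (x y z : X.Weight) :
    X.form (x - y) z = X.form x z - X.form y z := map_sub (X.formHom z) x y

theorem form_sub_right (X : DynkinDiagram) (x y z : X.Weight) :
    X.form x (y - z) = X.form x y - X.form x z := by
  rw [X.form_comm, form_sub_left, X.form_comm y, X.form_comm z]

theorem form_zsmul_left (X : DynkinDiagram) (n : ℤ) (x z : X.Weight) :
    X.form (n • x) z = n * X.form x z := by
  rw [← formHom_apply, map_zsmul, zsmul_eq_mul, formHom_apply]

theorem form_zsmul_right (X : DynkinDiagram) (n : ℤ) (x z : X.Weight) :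
    X.form x (n • z) = n * X.form x z := by
  rw [form_comm, form_zsmul_left, form_comm]

theorem form_sum_left {ι : Type*} (X : DynkinDiagram) (s : Finset ι) (x : ι → X.Weight)
    (z : X.Weight) : X.form (∑ i ∈ s, x i) z = ∑ i ∈ s, X.form (x i) z :=
  map_sum (X.formHom z) x s

theorem form_rootComb (X : DynkinDiagram) (x : X.Weight) (n : X.Vertex → ℤ) :
    X.form x (X.rootComb n) = ∑ a, (n a : ℚ) * (x a / X.t a) := by
  rw [form_eq_sum_coord]
  refine Finset.sum_congr rfl fun a _ => ?_
  rw [coord_rootComb]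
  ring

theorem rootComb_single (X : DynkinDiagram) (a : X.Vertex) (m : ℤ) :
    X.rootComb (Pi.single a m) = m • X.simpleRoot a := by
  rw [rootComb_def, Finset.sum_eq_single a]
  · simp
  · intro b _ hb
    simp [Pi.single_eq_of_ne hb]
  · simp

theorem form_simpleRoot (X : DynkinDiagram) (x : X.Weight) (a : X.Vertex) :
    X.form x (X.simpleRoot a) = x a / X.t a := by
  have h := X.rootComb_single a 1
  rw [one_smul] at h
  rw [← h, form_rootComb, Finset.sum_eq_single a]
  · simp
  · intro b _ hb
    simp [Pi.single_eq_of_ne hb]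
  · simp

theorem form_simpleRoot_self (X : DynkinDiagram) (a : X.Vertex) :
    X.form (X.simpleRoot a) (X.simpleRoot a) = 2 / X.t a := by
  rw [form_simpleRoot, simpleRoot_self, Int.cast_ofNat]

/-- The pairing of weights with `Q^∨` is integral. -/
theorem exists_int_form (X : DynkinDiagram) (x : X.Weight) {m : X.Weight}
    (hm : m ∈ X.corootLattice) : ∃ n : ℤ, X.form x m = n := by
  obtain ⟨n, rfl, hn⟩ := (X.mem_corootLattice_iff m).1 hm
  choose p hp using hn
  refine ⟨∑ a, p a * x a, ?_⟩
  rw [form_rootComb, Int.cast_sum]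
  refine Finset.sum_congr rfl fun a _ => ?_
  have := (X.cast_t_pos a).ne'
  rw [hp a]
  push_cast
  field_simp

/-- The lattice `Q^∨` is dual to the weight lattice: a weight which pairs with all weights into
`K ℤ` lies in `K Q^∨`. -/
theorem exists_eq_smul_of_form (X : DynkinDiagram) {K : ℕ} {x : X.Weight}
    (h : ∀ y, ∃ n : ℤ, X.form x y = K * n) : ∃ m ∈ X.corootLattice, x = K • m := by
  choose n hn using fun a => h (X.fundamental (Fin.succ a))
  have hx : ∀ a, X.coord x a = ((X.t a * (K * n a) : ℤ) : ℚ) := by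
    intro a
    have h1 := hn a
    rw [form_comm, form_eq_sum_coord, Finset.sum_eq_single a] at h1
    · rw [fundamental_succ, if_pos rfl, div_eq_iff (X.cast_t_pos a).ne'] at h1
      rw [Int.cast_one, one_mul] at h1
      rw [h1]
      push_cast
      ring
    · intro b _ hb
      rw [fundamental_succ, if_neg hb.symm]
      simp
    · simp
  refine ⟨X.rootComb fun a => X.t a * n a, (X.mem_corootLattice_iff _).2
    ⟨_, rfl, fun a => Dvd.intro _ rfl⟩, ?_⟩
  funext a
  have h2 := X.sum_cartan_mul_coord x a
  simp only [hx] at h2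
  rw [Pi.smul_apply, rootComb_apply, nsmul_eq_mul, Finset.mul_sum]
  have h3 : ((∑ b, X.cartan a b * (X.t b * (K * n b)) : ℤ) : ℚ) = (x a : ℚ) := by
    rw [← h2]
    push_cast
    rfl
  rw [← Int.cast_injective h3]
  exact Finset.sum_congr rfl fun b _ => by ring

/-! ### The Weyl group -/

/-- The simple reflection as an element of the Weyl group. -/
def simpleRefl (X : DynkinDiagram) (a : X.Vertex) : X.weylGroup :=
  ⟨X.simpleReflection a, Subgroup.subset_closure ⟨a, rfl⟩⟩

theorem simpleRefl_smul (X : DynkinDiagram) (a : X.Vertex) (x : X.Weight) :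
    X.simpleRefl a • x = x - x a • X.simpleRoot a :=
  Module.reflection_apply x (X.simpleRoot_self a)

theorem simpleRefl_mul_self (X : DynkinDiagram) (a : X.Vertex) :
    X.simpleRefl a * X.simpleRefl a = 1 :=
  Subtype.ext (LinearEquiv.ext fun x => Module.involutive_reflection (X.simpleRoot_self a) x)

theorem simpleRefl_inv (X : DynkinDiagram) (a : X.Vertex) :
    (X.simpleRefl a)⁻¹ = X.simpleRefl a :=
  inv_eq_of_mul_eq_one_left (X.simpleRefl_mul_self a)

theorem simpleRefl_simpleRoot (X : DynkinDiagram) (a : X.Vertex) :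
    X.simpleRefl a • X.simpleRoot a = -X.simpleRoot a := by
  rw [simpleRefl_smul, simpleRoot_self]
  module

/-- The product of a word in the simple reflections. -/
def wordProd (X : DynkinDiagram) (l : List X.Vertex) : X.weylGroup := (l.map X.simpleRefl).prod

theorem wordProd_nil (X : DynkinDiagram) : X.wordProd [] = 1 := rfl

theorem wordProd_cons (X : DynkinDiagram) (a : X.Vertex) (l : List X.Vertex) :
    X.wordProd (a :: l) = X.simpleRefl a * X.wordProd l := by
  simp [wordProd]

theorem wordProd_append (X : DynkinDiagram) (l l' : List X.Vertex) :
    X.wordProd (l ++ l') = X.wordProd l * X.wordProd l' := by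
  simp [wordProd]

theorem wordProd_singleton (X : DynkinDiagram) (a : X.Vertex) :
    X.wordProd [a] = X.simpleRefl a := by
  simp [wordProd]

theorem wordProd_reverse (X : DynkinDiagram) (l : List X.Vertex) :
    X.wordProd l.reverse = (X.wordProd l)⁻¹ := by
  induction l with
  | nil => simp [wordProd]
  | cons a l ih =>
    rw [List.reverse_cons, wordProd_append, ih, X.wordProd_cons a l, mul_inv_rev,
      wordProd_singleton, simpleRefl_inv]

theorem exists_wordProd_eq (X : DynkinDiagram) (w : X.weylGroup) : ∃ l, X.wordProd l = w := by
  obtain ⟨w, hw⟩ := w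
  induction hw using Subgroup.closure_induction with
  | mem x hx =>
    obtain ⟨a, rfl⟩ := hx
    exact ⟨[a], X.wordProd_singleton a⟩
  | one => exact ⟨[], rfl⟩
  | mul x y _ _ hx hy =>
    obtain ⟨l, hl⟩ := hx
    obtain ⟨l', hl'⟩ := hy
    exact ⟨l ++ l', by rw [wordProd_append, hl, hl']; rfl⟩
  | inv x _ hx =>
    obtain ⟨l, hl⟩ := hx
    exact ⟨l.reverse, by rw [wordProd_reverse, hl]; rfl⟩

theorem weyl_induction (X : DynkinDiagram) {p : X.weylGroup → Prop} (one : p 1)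
    (mul : ∀ a w, p w → p (X.simpleRefl a * w)) (w : X.weylGroup) : p w := by
  obtain ⟨l, rfl⟩ := X.exists_wordProd_eq w
  induction l with
  | nil => exact one
  | cons a l ih => exact X.wordProd_cons a l ▸ mul a _ ih

theorem coe_wordProd (X : DynkinDiagram) (l : List X.Vertex) :
    (X.wordProd l : X.Weight ≃ₗ[ℤ] X.Weight) = (l.map X.simpleReflection).prod := by
  induction l with
  | nil => rfl
  | cons a l ih =>
    rw [wordProd_cons, List.map_cons, List.prod_cons, ← ih]
    rfl

theorem exists_wordProd_length (X : DynkinDiagram) (w : X.weylGroup) :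
    ∃ l, X.wordProd l = w ∧ l.length = X.length w := by
  obtain ⟨l, hl⟩ := X.exists_wordProd_eq w
  obtain ⟨l', h1, h2⟩ := Nat.sInf_mem (s := {n | ∃ l : List X.Vertex, l.length = n ∧
    (l.map X.simpleReflection).prod = (w : X.Weight ≃ₗ[ℤ] X.Weight)})
    ⟨l.length, l, rfl, by rw [← coe_wordProd, hl]⟩
  exact ⟨l', Subtype.ext (by rw [coe_wordProd, h2]), h1⟩

theorem length_wordProd_le (X : DynkinDiagram) (l : List X.Vertex) :
    X.length (X.wordProd l) ≤ l.length :=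
  Nat.sInf_le ⟨l, rfl, (X.coe_wordProd l).symm⟩

theorem form_smul_smul (X : DynkinDiagram) (w : X.weylGroup) (x y : X.Weight) :
    X.form (w • x) (w • y) = X.form x y := by
  induction w using X.weyl_induction with
  | one => rw [one_smul, one_smul]
  | mul a w ih =>
    rw [mul_smul, mul_smul, ← ih]
    generalize w • x = x
    generalize w • y = y
    have := (X.cast_t_pos a).ne'
    rw [simpleRefl_smul, simpleRefl_smul, form_sub_left, form_sub_right, form_sub_right,
      form_zsmul_left, form_zsmul_left, form_zsmul_right, form_zsmul_right, form_simpleRoot,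
      form_simpleRoot_self, X.form_comm (X.simpleRoot a) y, form_simpleRoot]
    field_simp
    ring

theorem form_smul_left (X : DynkinDiagram) (w : X.weylGroup) (x y : X.Weight) :
    X.form (w • x) y = X.form x (w⁻¹ • y) := by
  rw [← X.form_smul_smul w x, smul_inv_smul]

/-! ### Roots -/

/-- The roots: the Weyl group images of the simple roots. -/
def roots (X : DynkinDiagram) : Set X.Weight :=
  {x | ∃ (w : X.weylGroup) (a : X.Vertex), x = w • X.simpleRoot a}

theorem simpleRoot_mem_roots (X : DynkinDiagram) (a : X.Vertex) : X.simpleRoot a ∈ X.roots :=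
  ⟨1, a, (one_smul _ _).symm⟩

theorem smul_mem_roots (X : DynkinDiagram) (w : X.weylGroup) {β : X.Weight} (hβ : β ∈ X.roots) :
    w • β ∈ X.roots := by
  obtain ⟨v, a, rfl⟩ := hβ
  exact ⟨w * v, a, (mul_smul _ _ _).symm⟩

theorem neg_mem_roots (X : DynkinDiagram) {β : X.Weight} (hβ : β ∈ X.roots) : -β ∈ X.roots := by
  obtain ⟨v, a, rfl⟩ := hβ
  exact ⟨v * X.simpleRefl a, a, by rw [mul_smul, simpleRefl_simpleRoot, smul_neg]⟩

/-- The coefficient vectors `n` such that `s ∑ n_a α_a` is a combination of the `t_a α_a`. For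
`s = 1` they describe `Q^∨`, and for `s = t_c` a lattice containing the roots conjugate to `α_c`. -/
def Divisible (X : DynkinDiagram) (s : ℕ) (n : X.Vertex → ℤ) : Prop :=
  ∀ a, (X.t a : ℤ) ∣ s * n a

theorem Divisible.dvd_rootComb {X : DynkinDiagram} {s : ℕ} {n : X.Vertex → ℤ}
    (h : X.Divisible s n) (a : X.Vertex) : (X.t a : ℤ) ∣ s * X.rootComb n a := by
  choose m hm using h
  rw [rootComb_apply, Finset.mul_sum]
  refine Finset.dvd_sum fun b _ => ⟨X.cartan b a * m b, ?_⟩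
  rw [mul_left_comm, hm b, mul_left_comm, ← mul_assoc, t_mul_cartan, mul_assoc]

theorem exists_divisible_of_smul (X : DynkinDiagram) (s : ℕ) (w : X.weylGroup) {n : X.Vertex → ℤ}
    (hn : X.Divisible s n) : ∃ m, w • X.rootComb n = X.rootComb m ∧ X.Divisible s m := by
  induction w using X.weyl_induction with
  | one => exact ⟨n, one_smul _ _, hn⟩
  | mul a w ih =>
    obtain ⟨m, h, hm⟩ := ih
    refine ⟨m - Pi.single a (X.rootComb m a), ?_, fun b => ?_⟩
    · rw [mul_smul, h, simpleRefl_smul, map_sub, rootComb_single]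
    · by_cases hb : b = a
      · subst hb
        rw [Pi.sub_apply, Pi.single_eq_same, mul_sub]
        exact dvd_sub (hm b) (hm.dvd_rootComb b)
      · rw [Pi.sub_apply, Pi.single_eq_of_ne hb, sub_zero]
        exact hm b

theorem smul_mem_corootLattice (X : DynkinDiagram) (w : X.weylGroup) {x : X.Weight}
    (hx : x ∈ X.corootLattice) : w • x ∈ X.corootLattice := by
  obtain ⟨n, rfl, hn⟩ := (X.mem_corootLattice_iff x).1 hx
  obtain ⟨m, h, hm⟩ := X.exists_divisible_of_smul 1 w (n := n)
    (fun a => by rw [Nat.cast_one, one_mul]; exact hn a)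
  exact (X.mem_corootLattice_iff _).2 ⟨m, h.symm, fun a => by
    have := hm a
    rwa [Nat.cast_one, one_mul] at this⟩

/-- The off-diagonal terms of a symmetric double sum come in equal pairs. -/
theorem _root_.Finset.even_sum_sum_of_symm {ι : Type*} (s : Finset ι) {f : ι → ι → ℤ}
    (hs : ∀ a b, f a b = f b a) (hd : ∀ a, Even (f a a)) : Even (∑ a ∈ s, ∑ b ∈ s, f a b) := by
  classical
  induction s using Finset.induction_on with
  | empty => simp
  | insert c s hc ih =>
    have h : ∑ a ∈ insert c s, ∑ b ∈ insert c s, f a b =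
        f c c + (∑ b ∈ s, f c b + ∑ b ∈ s, f c b) + ∑ a ∈ s, ∑ b ∈ s, f a b := by
      simp only [Finset.sum_insert hc, Finset.sum_add_distrib, hs _ c]
      ring
    rw [h]
    exact ((hd c).add (Even.add_self _)).add ih

theorem form_rootComb_rootComb (X : DynkinDiagram) (m n : X.Vertex → ℤ) :
    X.form (X.rootComb m) (X.rootComb n) =
      ∑ a, ∑ b, (X.cartan a b : ℚ) / X.t a * n a * m b := by
  simp only [form_eq_sum_coord_coord, coord_rootComb]

/-- The lattice of `s`-divisible combinations of roots is even after scaling the form by `s`, so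
that its nonzero elements have square length at least `2 / s`. -/
theorem Divisible.two_div_le {X : DynkinDiagram} {s : ℕ} (hs : 0 < s) {n : X.Vertex → ℤ}
    (h : X.Divisible s n) (hn : n ≠ 0) : (2 : ℚ) / s ≤ X.form (X.rootComb n) (X.rootComb n) := by
  choose m hm using h
  have hs' : (0 : ℚ) < s := Nat.cast_pos.2 hs
  have h1 : (s : ℚ) * X.form (X.rootComb n) (X.rootComb n) =
      (∑ a, ∑ b, X.cartan a b * m a * n b : ℤ) := by
    rw [form_rootComb_rootComb, Finset.mul_sum, Int.cast_sum]
    refine Finset.sum_congr rfl fun a _ => ?_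
    rw [Finset.mul_sum, Int.cast_sum]
    refine Finset.sum_congr rfl fun b _ => ?_
    have h2 : (s : ℚ) * n a = X.t a * m a := by exact_mod_cast hm a
    have := (X.cast_t_pos a).ne'
    push_cast
    field_simp
    linear_combination (X.cartan a b * n b : ℚ) * h2
  have h2 : Even (∑ a, ∑ b, X.cartan a b * m a * n b) := by
    refine Finset.even_sum_sum_of_symm (f := fun a b => X.cartan a b * m a * n b) _
      (fun a b => ?_) fun a => ?_
    · have ha : (X.t a : ℤ) ≠ 0 := by exact_mod_cast (X.t_pos a).ne'
      have hb : (X.t b : ℤ) ≠ 0 := by exact_mod_cast (X.t_pos b).ne'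
      refine mul_left_cancel₀ (mul_ne_zero ha hb) ?_
      linear_combination (-X.cartan a b * X.t b * n b) * hm a + (X.cartan b a * X.t a * n a) * hm b
        + (s * n a * n b) * X.t_mul_cartan a b
    · rw [cartan_self, mul_assoc]
      exact even_two_mul _
  have h3 : 0 < X.form (X.rootComb n) (X.rootComb n) :=
    X.form_self_pos fun h => hn (X.rootComb_injective (h.trans (map_zero _).symm))
  have h4 : (0 : ℚ) < (∑ a, ∑ b, X.cartan a b * m a * n b : ℤ) := h1 ▸ mul_pos hs' h3
  have h5 : 0 < ∑ a, ∑ b, X.cartan a b * m a * n b := by exact_mod_cast h4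
  have h6 : (2 : ℤ) ≤ ∑ a, ∑ b, X.cartan a b * m a * n b := by
    obtain ⟨q, hq⟩ := h2
    omega
  rw [div_le_iff₀ hs', mul_comm, h1]
  exact_mod_cast h6

theorem form_rootComb_nonpos (X : DynkinDiagram) {p q : X.Vertex → ℤ} (hp : ∀ a, 0 ≤ p a)
    (hq : ∀ a, 0 ≤ q a) (hd : ∀ a, p a = 0 ∨ q a = 0) :
    X.form (X.rootComb p) (X.rootComb q) ≤ 0 := by
  rw [form_rootComb_rootComb]
  refine Finset.sum_nonpos fun a _ => Finset.sum_nonpos fun b _ => ?_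
  by_cases h : a = b
  · subst h
    rcases hd a with h | h <;> simp [h]
  · refine mul_nonpos_of_nonpos_of_nonneg (mul_nonpos_of_nonpos_of_nonneg
      (div_nonpos_of_nonpos_of_nonneg ?_ (X.cast_t_pos a).le) ?_) ?_
    · exact_mod_cast X.cartan_nonpos a b h
    · exact_mod_cast hq a
    · exact_mod_cast hp b

/-- A vector of minimal length `2 / s` in the lattice of `s`-divisible combinations is non-negative
or non-positive: its positive and negative parts form an obtuse angle. -/
theorem Divisible.nonneg_or_nonpos {X : DynkinDiagram} {s : ℕ} (hs : 0 < s) {n : X.Vertex → ℤ}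
    (h : X.Divisible s n) (hn : X.form (X.rootComb n) (X.rootComb n) = 2 / s) :
    (∀ a, 0 ≤ n a) ∨ ∀ a, n a ≤ 0 := by
  by_contra! hcon
  obtain ⟨⟨a, ha⟩, b, hb⟩ := hcon
  have hs' : (0 : ℚ) < s := Nat.cast_pos.2 hs
  let p : X.Vertex → ℤ := fun a => max (n a) 0
  let q : X.Vertex → ℤ := fun a => max (-n a) 0
  have hpq : n = p - q := by
    funext a
    simp only [p, q, Pi.sub_apply]
    omega
  have hp : X.Divisible s p := fun a => by
    rcases max_choice (n a) 0 with h1 | h1 <;> simp only [p, h1]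
    · exact h a
    · simp
  have hq : X.Divisible s q := fun a => by
    rcases max_choice (-n a) 0 with h1 | h1 <;> simp only [q, h1]
    · rw [mul_neg, dvd_neg]
      exact h a
    · simp
  have h1 := hp.two_div_le hs (fun h0 => by have := congrFun h0 b; simp [p] at this; omega)
  have h2 := hq.two_div_le hs (fun h0 => by have := congrFun h0 a; simp [q] at this; omega)
  have h3 := X.form_rootComb_nonpos (p := p) (q := q) (fun a => le_max_right _ _)
    (fun a => le_max_right _ _) (fun a => by simp only [p, q]; omega)
  rw [hpq, map_sub, form_sub_left, form_sub_right, form_sub_right,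
    X.form_comm (X.rootComb q) (X.rootComb p)] at hn
  have h4 : (0 : ℚ) < 2 / s := by positivity
  linarith

theorem highestRoot_eq_rootComb (X : DynkinDiagram) :
    X.highestRoot = X.rootComb fun a => (X.t a * X.finComark a : ℕ) := by
  funext a
  rw [rootComb_apply, sum_cartan_mul_comark]

theorem form_highestRoot (X : DynkinDiagram) (x : X.Weight) :
    X.form x X.highestRoot = ∑ a, (X.finComark a : ℚ) * x a := by
  rw [highestRoot_eq_rootComb, form_rootComb]
  refine Finset.sum_congr rfl fun a _ => ?_
  have := (X.cast_t_pos a).ne'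
  push_cast
  field_simp

theorem form_highestRoot_self (X : DynkinDiagram) : X.form X.highestRoot X.highestRoot = 2 := by
  rw [form_highestRoot]
  exact_mod_cast X.sum_comark_mul_highestRoot

theorem highestRoot_mem_corootLattice (X : DynkinDiagram) : X.highestRoot ∈ X.corootLattice :=
  (X.mem_corootLattice_iff _).2 ⟨_, X.highestRoot_eq_rootComb.symm, fun a => by
    push_cast
    exact Dvd.intro _ rfl⟩

/-- The vectors of minimal length in the lattice of `s`-divisible combinations lie below `θ`. -/
theorem Divisible.le_highestRoot {X : DynkinDiagram} {s : ℕ} (hs : 0 < s) {n : X.Vertex → ℤ}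
    (h : X.Divisible s n) (hn : X.form (X.rootComb n) (X.rootComb n) = 2 / s) (a : X.Vertex) :
    n a ≤ (X.t a * X.finComark a : ℕ) := by
  by_contra! ha
  let c : X.Vertex → ℤ := fun a => (X.t a * X.finComark a : ℕ)
  have hc : ∀ a, 0 < c a := fun a => by
    simp only [c]
    exact_mod_cast Nat.mul_pos (X.t_pos a) (X.finComark_pos a)
  have hθ : X.highestRoot = X.rootComb c := X.highestRoot_eq_rootComb
  let p : X.Vertex → ℤ := fun a => max (c a - n a) 0
  let q : X.Vertex → ℤ := fun a => max (n a - c a) 0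
  have hpq : n = (c - p) + q := by
    funext a
    simp only [p, q, Pi.sub_apply, Pi.add_apply]
    omega
  have hq : X.Divisible s q := fun a => by
    rcases max_choice (n a - c a) 0 with h1 | h1 <;> simp only [q, h1]
    · rw [mul_sub]
      refine dvd_sub (h a) (Dvd.dvd.mul_left ?_ _)
      simp only [c]
      push_cast
      exact Dvd.intro _ rfl
    · simp
  have hqa : 0 < q a := by simp only [q, c]; omega
  have h2 := hq.two_div_le hs (fun h0 => hqa.ne' (congrFun h0 a))
  have h3 := X.form_rootComb_nonpos (p := p) (q := q) (fun a => le_max_right _ _)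
    (fun a => le_max_right _ _) (fun a => by simp only [p, q]; omega)
  have h4 : 0 ≤ X.form (X.rootComb c) (X.rootComb q) := by
    rw [← hθ, form_rootComb]
    refine Finset.sum_nonneg fun a _ => mul_nonneg ?_ (div_nonneg ?_ (X.cast_t_pos a).le)
    · exact_mod_cast le_max_right (n a - c a) 0
    · exact_mod_cast X.highestRoot_nonneg a
  have h5 : X.rootComb (c - p) ≠ 0 := by
    intro h0
    have h6 := congrFun (X.rootComb_injective (h0.trans (map_zero _).symm)) a
    have h7 := hc a
    simp only [p, q, Pi.sub_apply, Pi.zero_apply] at h6 hqa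
    omega
  have h6 := X.form_self_pos h5
  rw [hpq, map_add, form_add_left, form_add_right, form_add_right,
    X.form_comm (X.rootComb q) (X.rootComb (c - p))] at hn
  have h7 : X.form (X.rootComb (c - p)) (X.rootComb q) =
      X.form (X.rootComb c) (X.rootComb q) - X.form (X.rootComb p) (X.rootComb q) := by
    rw [map_sub, form_sub_left]
  linarith

theorem exists_divisible_of_mem_roots (X : DynkinDiagram) {β : X.Weight} (hβ : β ∈ X.roots) :
    ∃ (s : ℕ) (n : X.Vertex → ℤ), 0 < s ∧ β = X.rootComb n ∧ X.Divisible s n ∧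
      X.form (X.rootComb n) (X.rootComb n) = 2 / s := by
  obtain ⟨w, c, rfl⟩ := hβ
  have h1 : X.Divisible (X.t c) (Pi.single c 1) := fun b => by
    by_cases h : b = c
    · subst h
      simp
    · simp [Pi.single_eq_of_ne h]
  obtain ⟨n, hn, hd⟩ := X.exists_divisible_of_smul (X.t c) w h1
  rw [rootComb_single, one_smul] at hn
  exact ⟨X.t c, n, X.t_pos c, hn, hd, by rw [← hn, form_smul_smul, form_simpleRoot_self]⟩

/-- Every root is a combination of simple roots with coefficients of one sign, bounded by those of
the highest root. -/
theorem exists_rootComb_of_mem_roots (X : DynkinDiagram) {β : X.Weight} (hβ : β ∈ X.roots) :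
    ∃ n : X.Vertex → ℤ, β = X.rootComb n ∧ ((∀ a, 0 ≤ n a) ∨ ∀ a, n a ≤ 0) ∧
      (∀ a, n a ≤ (X.t a * X.finComark a : ℕ)) ∧ ∀ a, -n a ≤ (X.t a * X.finComark a : ℕ) := by
  obtain ⟨s, n, hs, h, hd, hn⟩ := X.exists_divisible_of_mem_roots hβ
  have hd' : X.Divisible s (-n) := fun a => by
    rw [Pi.neg_apply, mul_neg, dvd_neg]
    exact hd a
  refine ⟨n, h, hd.nonneg_or_nonpos hs hn, hd.le_highestRoot hs hn, hd'.le_highestRoot hs ?_⟩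
  rw [map_neg, form_neg_left, form_neg_right, neg_neg, hn]

theorem roots_finite (X : DynkinDiagram) : X.roots.Finite := by
  refine ((Set.finite_Icc (fun a => -((X.t a * X.finComark a : ℕ) : ℤ))
    (fun a => ((X.t a * X.finComark a : ℕ) : ℤ))).image X.rootComb).subset fun β hβ => ?_
  obtain ⟨n, h, -, h1, h2⟩ := X.exists_rootComb_of_mem_roots hβ
  exact ⟨n, ⟨fun a => neg_le.1 (h2 a), h1⟩, h.symm⟩

/-- A Weyl group element is determined by its action on the simple roots, by invariance and
non-degeneracy of the form. As there are finitely many roots, the Weyl group is finite. -/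
theorem eq_of_smul_simpleRoot_eq (X : DynkinDiagram) {w v : X.weylGroup}
    (h : ∀ a, w • X.simpleRoot a = v • X.simpleRoot a) : w = v := by
  refine Subtype.ext (LinearEquiv.ext fun x => ?_)
  change w • x = v • x
  rw [← inv_smul_eq_iff, eq_comm]
  funext a
  have h1 : X.form x (X.simpleRoot a) = X.form (v⁻¹ • w • x) (X.simpleRoot a) := by
    rw [form_smul_left, inv_inv, ← h, form_smul_smul]
  rw [form_simpleRoot, form_simpleRoot, div_left_inj' (X.cast_t_pos a).ne'] at h1
  exact_mod_cast h1

instance (X : DynkinDiagram) : Finite X.weylGroup := by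
  have : Finite X.roots := X.roots_finite
  refine Finite.of_injective (β := X.Vertex → X.roots)
    (fun w a => ⟨w • X.simpleRoot a, w, a, rfl⟩) fun w v h => ?_
  exact X.eq_of_smul_simpleRoot_eq fun a => congrArg Subtype.val (congrFun h a)

noncomputable instance (X : DynkinDiagram) : Fintype X.weylGroup := Fintype.ofFinite _

/-! ### Positive roots and signs -/

theorem coe_smul_def (X : DynkinDiagram) (w : X.weylGroup) (x : X.Weight) :
    (w : X.Weight ≃ₗ[ℤ] X.Weight) x = w • x := rfl

theorem positiveRoots_subset_roots (X : DynkinDiagram) : X.positiveRoots ⊆ X.roots := fun _ h => h.1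

/-- The positive roots as a finset. -/
noncomputable def posRoots (X : DynkinDiagram) : Finset X.Weight :=
  (X.roots_finite.subset X.positiveRoots_subset_roots).toFinset

theorem mem_posRoots (X : DynkinDiagram) {β : X.Weight} :
    β ∈ X.posRoots ↔ β ∈ X.roots ∧ ∃ n : X.Vertex → ℤ, β = X.rootComb n ∧ ∀ a, 0 ≤ n a := by
  rw [posRoots, Set.Finite.mem_toFinset]
  refine and_congr Iff.rfl ⟨?_, ?_⟩
  · rintro ⟨n, rfl⟩
    refine ⟨fun a => n a, ?_, fun a => Int.natCast_nonneg _⟩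
    simp only [rootComb_def, natCast_zsmul]
  · rintro ⟨n, rfl, hn⟩
    refine ⟨fun a => (n a).toNat, ?_⟩
    rw [rootComb_def]
    refine Finset.sum_congr rfl fun a _ => ?_
    rw [← natCast_zsmul, Int.toNat_of_nonneg (hn a)]

theorem simpleRoot_eq_rootComb (X : DynkinDiagram) (a : X.Vertex) :
    X.simpleRoot a = X.rootComb (Pi.single a 1) := by
  rw [rootComb_single, one_smul]

theorem simpleRoot_mem_posRoots (X : DynkinDiagram) (a : X.Vertex) :
    X.simpleRoot a ∈ X.posRoots :=
  X.mem_posRoots.2 ⟨X.simpleRoot_mem_roots a, _, X.simpleRoot_eq_rootComb a, fun b => by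
    by_cases h : b = a
    · subst h
      simp
    · simp [Pi.single_eq_of_ne h]⟩

theorem mem_posRoots_or_neg_mem (X : DynkinDiagram) {β : X.Weight} (hβ : β ∈ X.roots) :
    β ∈ X.posRoots ∨ -β ∈ X.posRoots := by
  obtain ⟨n, h, hn | hn, -⟩ := X.exists_rootComb_of_mem_roots hβ
  · exact Or.inl (X.mem_posRoots.2 ⟨hβ, n, h, hn⟩)
  · refine Or.inr (X.mem_posRoots.2 ⟨X.neg_mem_roots hβ, -n, ?_, fun a => ?_⟩)
    · rw [map_neg, h]
    · exact neg_nonneg.2 (hn a)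

theorem ne_zero_of_mem_roots (X : DynkinDiagram) {β : X.Weight} (hβ : β ∈ X.roots) : β ≠ 0 := by
  rintro rfl
  obtain ⟨w, a, h⟩ := hβ
  have h1 := X.form_smul_smul w (X.simpleRoot a) (X.simpleRoot a)
  rw [← h, form_zero_left, form_simpleRoot_self] at h1
  exact (div_pos two_pos (X.cast_t_pos a)).ne h1

theorem neg_notMem_posRoots (X : DynkinDiagram) {β : X.Weight} (hβ : β ∈ X.posRoots) :
    -β ∉ X.posRoots := by
  intro h
  obtain ⟨h0, n, rfl, hn⟩ := X.mem_posRoots.1 hβ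
  obtain ⟨-, m, h1, hm⟩ := X.mem_posRoots.1 h
  rw [← map_neg] at h1
  have h2 := X.rootComb_injective h1
  apply X.ne_zero_of_mem_roots h0
  have h3 : n = 0 := by
    funext a
    have h4 := congrFun h2 a
    have h5 := hn a
    have h6 := hm a
    simp only [Pi.neg_apply, Pi.zero_apply] at h4 ⊢
    omega
  rw [h3, map_zero]

/-- A simple reflection permutes the positive roots other than its own simple root. -/
theorem simpleRefl_smul_mem_posRoots (X : DynkinDiagram) (a : X.Vertex) {β : X.Weight}
    (hβ : β ∈ X.posRoots) (hne : β ≠ X.simpleRoot a) : X.simpleRefl a • β ∈ X.posRoots := by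
  obtain ⟨h0, n, rfl, hn⟩ := X.mem_posRoots.1 hβ
  refine (X.mem_posRoots_or_neg_mem (X.smul_mem_roots (X.simpleRefl a) h0)).resolve_right
    fun h => hne ?_
  obtain ⟨-, m, h1, hm⟩ := X.mem_posRoots.1 h
  rw [simpleRefl_smul, ← rootComb_single, ← map_sub, ← map_neg] at h1
  have h2 := X.rootComb_injective h1
  have h3 : n = Pi.single a (n a) := by
    funext b
    by_cases hb : b = a
    · subst hb
      rw [Pi.single_eq_same]
    · have h4 := congrFun h2 b
      have h5 := hn b
      have h6 := hm b
      rw [Pi.neg_apply, Pi.sub_apply, Pi.single_eq_of_ne hb] at h4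
      rw [Pi.single_eq_of_ne hb]
      omega
  -- The root `n_a α_a` is conjugate to a simple root, so that `n_a` divides `1`.
  obtain ⟨w, c, h4⟩ := h0
  obtain ⟨k, h5, -⟩ := X.exists_rootComb_of_mem_roots
    (X.smul_mem_roots w⁻¹ (X.simpleRoot_mem_roots a))
  rw [h3, rootComb_single, eq_comm, ← eq_inv_smul_iff, smul_comm, h5, ← map_zsmul,
    simpleRoot_eq_rootComb] at h4
  have h6 := congrFun (X.rootComb_injective h4) c
  rw [Pi.single_eq_same, Pi.smul_apply, smul_eq_mul] at h6
  have h7 : n a = 1 := by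
    have h8 : n a ∣ 1 := ⟨_, h6⟩
    exact Int.eq_one_of_dvd_one (hn a) h8
  rw [h3, h7, ← simpleRoot_eq_rootComb]

theorem mem_erase_iff_simpleRefl_smul (X : DynkinDiagram) (a : X.Vertex) (β : X.Weight) :
    β ∈ X.posRoots.erase (X.simpleRoot a) ↔
      X.simpleRefl a • β ∈ X.posRoots.erase (X.simpleRoot a) := by
  have h : ∀ β ∈ X.posRoots.erase (X.simpleRoot a),
      X.simpleRefl a • β ∈ X.posRoots.erase (X.simpleRoot a) := by
    intro β hβ
    obtain ⟨h1, h2⟩ := Finset.mem_erase.1 hβ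
    refine Finset.mem_erase.2 ⟨fun h3 => ?_, X.simpleRefl_smul_mem_posRoots a h2 h1⟩
    rw [← eq_inv_smul_iff, simpleRefl_inv, simpleRefl_simpleRoot] at h3
    exact X.neg_notMem_posRoots (X.simpleRoot_mem_posRoots a) (h3 ▸ h2)
  refine ⟨h β, fun h1 => ?_⟩
  have h2 := h _ h1
  rwa [← mul_smul, simpleRefl_mul_self, one_smul] at h2

/-- The effect of a simple reflection on a product over the positive roots. -/
theorem prod_posRoots_simpleRefl {M : Type*} [CommMonoid M] (X : DynkinDiagram) (a : X.Vertex)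
    (f : X.Weight → M) : ∏ β ∈ X.posRoots, f (X.simpleRefl a • β) =
      f (-X.simpleRoot a) * ∏ β ∈ X.posRoots.erase (X.simpleRoot a), f β := by
  rw [← Finset.mul_prod_erase _ _ (X.simpleRoot_mem_posRoots a), simpleRefl_simpleRoot]
  congr 1
  exact Finset.prod_equiv (MulAction.toPerm (X.simpleRefl a))
    (X.mem_erase_iff_simpleRefl_smul a) fun _ _ => rfl

/-- Comparing the sum of the positive roots with its image under `s_a` shows that all its
coordinates are `2`. -/
theorem sum_posRoots (X : DynkinDiagram) : ∑ β ∈ X.posRoots, β = 2 • X.rho := by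
  funext a
  have h1 := X.prod_posRoots_simpleRefl a (fun β => Multiplicative.ofAdd β)
  rw [← ofAdd_sum, ← ofAdd_sum, ← ofAdd_add, Multiplicative.ofAdd.injective.eq_iff,
    ← Finset.smul_sum, simpleRefl_smul] at h1
  rw [← Finset.add_sum_erase _ _ (X.simpleRoot_mem_posRoots a)] at h1
  have h2 := congrFun h1 a
  rw [← Finset.add_sum_erase _ _ (X.simpleRoot_mem_posRoots a)]
  simp only [Pi.add_apply, Pi.sub_apply, Pi.smul_apply, Pi.neg_apply, simpleRoot_self, smul_eq_mul,
    rho, nsmul_eq_mul, Nat.cast_ofNat, mul_one] at h2 ⊢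
  omega

/-- The product `∏ (x | β)` over the positive roots. -/
noncomputable def weylProd (X : DynkinDiagram) (x : X.Weight) : ℚ := ∏ β ∈ X.posRoots, X.form x β

theorem weylProd_simpleRefl_smul (X : DynkinDiagram) (a : X.Vertex) (x : X.Weight) :
    X.weylProd (X.simpleRefl a • x) = -X.weylProd x := by
  have h : X.weylProd (X.simpleRefl a • x) = ∏ β ∈ X.posRoots, X.form x (X.simpleRefl a • β) :=
    Finset.prod_congr rfl fun β _ => by rw [form_smul_left, simpleRefl_inv]
  rw [h, X.prod_posRoots_simpleRefl a (fun β => X.form x β), form_neg_right, neg_mul,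
    Finset.mul_prod_erase _ (fun β => X.form x β) (X.simpleRoot_mem_posRoots a), weylProd]

/-- A weight is dominant if its coordinates in the basis of fundamental weights are
non-negative. -/
def Dominant (X : DynkinDiagram) (x : X.Weight) : Prop := ∀ a, 0 ≤ x a

theorem Dominant.form_nonneg {X : DynkinDiagram} {x : X.Weight} (hx : X.Dominant x)
    {n : X.Vertex → ℤ} (hn : ∀ a, 0 ≤ n a) : 0 ≤ X.form x (X.rootComb n) := by
  rw [form_rootComb]
  refine Finset.sum_nonneg fun a _ => mul_nonneg ?_ (div_nonneg ?_ (X.cast_t_pos a).le)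
  · exact_mod_cast hn a
  · exact_mod_cast hx a

theorem form_pos_of_regular (X : DynkinDiagram) {x : X.Weight} (hx : ∀ a, 0 < x a)
    {n : X.Vertex → ℤ} (hn : ∀ a, 0 ≤ n a) (h0 : n ≠ 0) : 0 < X.form x (X.rootComb n) := by
  obtain ⟨c, hc⟩ := Function.ne_iff.1 h0
  rw [form_rootComb]
  refine Finset.sum_pos' (fun a _ => mul_nonneg ?_ (div_nonneg ?_ (X.cast_t_pos a).le))
    ⟨c, Finset.mem_univ c, mul_pos ?_ (div_pos ?_ (X.cast_t_pos c))⟩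
  · exact_mod_cast hn a
  · exact_mod_cast (hx a).le
  · exact_mod_cast lt_of_le_of_ne (hn c) (Ne.symm hc)
  · exact_mod_cast hx c

theorem form_pos_of_mem_posRoots (X : DynkinDiagram) {x : X.Weight} (hx : ∀ a, 0 < x a)
    {β : X.Weight} (hβ : β ∈ X.posRoots) : 0 < X.form x β := by
  obtain ⟨h0, n, rfl, hn⟩ := X.mem_posRoots.1 hβ
  refine X.form_pos_of_regular hx hn fun h => X.ne_zero_of_mem_roots h0 ?_
  rw [h, map_zero]

theorem rho_pos (X : DynkinDiagram) (a : X.Vertex) : 0 < X.rho a := one_pos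

theorem weylProd_rho_pos (X : DynkinDiagram) : 0 < X.weylProd X.rho :=
  Finset.prod_pos fun _ hβ => X.form_pos_of_mem_posRoots X.rho_pos hβ

/-- The sign `(-1)^{ℓ(w)}`. -/
noncomputable def sgn (X : DynkinDiagram) (w : X.weylGroup) : ℤ := (-1) ^ X.length w

theorem weylProd_wordProd_smul (X : DynkinDiagram) (l : List X.Vertex) (x : X.Weight) :
    X.weylProd (X.wordProd l • x) = (-1) ^ l.length * X.weylProd x := by
  induction l with
  | nil => rw [wordProd_nil, one_smul, List.length_nil, pow_zero, one_mul]
  | cons a l ih =>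
    rw [wordProd_cons, mul_smul, weylProd_simpleRefl_smul, ih, List.length_cons, pow_succ]
    ring

/-- The function `weylProd` is alternating. As `weylProd ρ ≠ 0`, this makes the sign a
homomorphism. -/
theorem weylProd_smul (X : DynkinDiagram) (w : X.weylGroup) (x : X.Weight) :
    X.weylProd (w • x) = X.sgn w * X.weylProd x := by
  obtain ⟨l, rfl, h⟩ := X.exists_wordProd_length w
  rw [weylProd_wordProd_smul, sgn, ← h]
  push_cast
  rfl

theorem sgn_mul (X : DynkinDiagram) (w v : X.weylGroup) : X.sgn (w * v) = X.sgn w * X.sgn v := by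
  have h := X.weylProd_smul (w * v) X.rho
  rw [mul_smul, weylProd_smul, weylProd_smul, ← mul_assoc,
    mul_left_inj' X.weylProd_rho_pos.ne'] at h
  exact_mod_cast h.symm

theorem sgn_mul_self (X : DynkinDiagram) (w : X.weylGroup) : X.sgn w * X.sgn w = 1 := by
  rw [sgn, ← mul_pow]
  norm_num

theorem sgn_one (X : DynkinDiagram) : X.sgn 1 = 1 := by
  have h := X.sgn_mul 1 1
  rw [mul_one, sgn_mul_self] at h
  exact h

theorem sgn_inv (X : DynkinDiagram) (w : X.weylGroup) : X.sgn w⁻¹ = X.sgn w := by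
  have h := X.sgn_mul w w⁻¹
  rw [mul_inv_cancel, sgn_one] at h
  have h2 := X.sgn_mul_self w
  calc X.sgn w⁻¹ = (X.sgn w * X.sgn w) * X.sgn w⁻¹ := by rw [h2, one_mul]
    _ = X.sgn w := by rw [mul_assoc, ← h, mul_one]

theorem sgn_simpleRefl (X : DynkinDiagram) (a : X.Vertex) : X.sgn (X.simpleRefl a) = -1 := by
  have h := X.weylProd_smul (X.simpleRefl a) X.rho
  rw [weylProd_simpleRefl_smul, neg_eq_neg_one_mul, mul_left_inj' X.weylProd_rho_pos.ne'] at h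
  exact_mod_cast h.symm

/-! ### The exchange property and dominant weights -/

/-- If `w α_b = α_a`, then `w s_b w⁻¹ = s_a`. -/
theorem mul_simpleRefl_of_smul_eq (X : DynkinDiagram) {w : X.weylGroup} {a b : X.Vertex}
    (h : w • X.simpleRoot b = X.simpleRoot a) : w * X.simpleRefl b = X.simpleRefl a * w := by
  have ht : (X.t a : ℚ) = X.t b := by
    have h1 := X.form_smul_smul w (X.simpleRoot b) (X.simpleRoot b)
    rw [h, form_simpleRoot_self, form_simpleRoot_self,
      div_eq_div_iff (X.cast_t_pos a).ne' (X.cast_t_pos b).ne'] at h1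
    linarith
  refine Subtype.ext (LinearEquiv.ext fun x => ?_)
  change (w * X.simpleRefl b) • x = (X.simpleRefl a * w) • x
  have h2 : (w • x) a = x b := by
    have h3 := X.form_smul_smul w x (X.simpleRoot b)
    rw [h, form_simpleRoot, form_simpleRoot, ht, div_left_inj' (X.cast_t_pos b).ne'] at h3
    exact_mod_cast h3
  rw [mul_smul, mul_smul, simpleRefl_smul, simpleRefl_smul, smul_sub, h2, smul_comm, h]

/-- The exchange property: if `s_1 ⋯ s_n α_b` is negative, then `s_1 ⋯ s_n s_b` is obtained by
deleting one letter of `s_1 ⋯ s_n`. -/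
theorem exists_wordProd_eq_mul_simpleRefl (X : DynkinDiagram) (l : List X.Vertex) (b : X.Vertex)
    (h : -(X.wordProd l • X.simpleRoot b) ∈ X.posRoots) :
    ∃ l', l'.length + 1 = l.length ∧ X.wordProd l' = X.wordProd l * X.simpleRefl b := by
  induction l with
  | nil =>
    rw [wordProd_nil, one_smul] at h
    exact absurd h (X.neg_notMem_posRoots (X.simpleRoot_mem_posRoots b))
  | cons a l ih =>
    rcases X.mem_posRoots_or_neg_mem
      (X.smul_mem_roots (X.wordProd l) (X.simpleRoot_mem_roots b)) with h1 | h1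
    · have h2 : X.wordProd l • X.simpleRoot b = X.simpleRoot a := by
        by_contra hne
        have h3 := X.simpleRefl_smul_mem_posRoots a h1 hne
        rw [← mul_smul, ← wordProd_cons] at h3
        exact X.neg_notMem_posRoots h3 h
      refine ⟨l, rfl, ?_⟩
      rw [wordProd_cons, mul_assoc, X.mul_simpleRefl_of_smul_eq h2, ← mul_assoc,
        simpleRefl_mul_self, one_mul]
    · obtain ⟨l', h2, h3⟩ := ih h1
      refine ⟨a :: l', by rw [List.length_cons, List.length_cons, h2], ?_⟩
      rw [wordProd_cons, wordProd_cons, h3, mul_assoc]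

/-- A nontrivial Weyl group element is the product of a shorter element, which maps `α_b` to a
positive root, and a simple reflection `s_b`. -/
theorem exists_eq_mul_simpleRefl (X : DynkinDiagram) {w : X.weylGroup} (hw : w ≠ 1) :
    ∃ (v : X.weylGroup) (b : X.Vertex), w = v * X.simpleRefl b ∧ X.length v < X.length w ∧
      v • X.simpleRoot b ∈ X.posRoots := by
  obtain ⟨l, rfl, hl⟩ := X.exists_wordProd_length w
  rcases List.eq_nil_or_concat l with rfl | ⟨l, b, rfl⟩
  · exact absurd X.wordProd_nil hw
  · rw [List.concat_eq_append] at hl ⊢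
    have h1 : X.wordProd (l ++ [b]) = X.wordProd l * X.simpleRefl b := by
      rw [wordProd_append, wordProd_singleton]
    have h2 := X.length_wordProd_le l
    rw [List.length_append, List.length_singleton] at hl
    refine ⟨X.wordProd l, b, h1, by omega, ?_⟩
    refine (X.mem_posRoots_or_neg_mem (X.smul_mem_roots (X.wordProd l)
      (X.simpleRoot_mem_roots b))).resolve_right fun h => ?_
    obtain ⟨l', h3, h4⟩ := X.exists_wordProd_eq_mul_simpleRefl l b h
    have h5 := X.length_wordProd_le l'
    rw [h4, ← h1] at h5
    omega

theorem eq_one_of_smul_mem_posRoots (X : DynkinDiagram) {w : X.weylGroup}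
    (h : ∀ b, w • X.simpleRoot b ∈ X.posRoots) : w = 1 := by
  by_contra hw
  obtain ⟨v, b, rfl, -, h1⟩ := X.exists_eq_mul_simpleRefl hw
  have h2 := h b
  rw [mul_smul, simpleRefl_simpleRoot, smul_neg] at h2
  exact X.neg_notMem_posRoots h1 h2

/-- A dominant weight is the highest one in its orbit. -/
theorem Dominant.exists_sub_smul_eq {X : DynkinDiagram} {x : X.Weight} (hx : X.Dominant x)
    (w : X.weylGroup) : ∃ n : X.Vertex → ℤ, x - w • x = X.rootComb n ∧ ∀ a, 0 ≤ n a := by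
  induction h : X.length w using Nat.strong_induction_on generalizing w with
  | _ N ih =>
    by_cases hw : w = 1
    · exact ⟨0, by rw [hw, one_smul, sub_self, map_zero], fun a => le_rfl⟩
    · obtain ⟨v, b, rfl, h1, h2⟩ := X.exists_eq_mul_simpleRefl hw
      obtain ⟨n, h3, hn⟩ := ih _ (h ▸ h1) v rfl
      obtain ⟨-, m, h4, hm⟩ := X.mem_posRoots.1 h2
      refine ⟨n + x b • m, ?_, fun a => ?_⟩
      · rw [map_add, map_zsmul, ← h3, ← h4, mul_smul, simpleRefl_smul, smul_sub, smul_comm]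
        abel
      · exact add_nonneg (hn a) (mul_nonneg (hx b) (hm a))

/-- The point of the orbit with the largest pairing with `ρ` is dominant. -/
theorem exists_smul_dominant (X : DynkinDiagram) (x : X.Weight) :
    ∃ w : X.weylGroup, X.Dominant (w • x) := by
  obtain ⟨w, hw⟩ := Finite.exists_max fun w : X.weylGroup => X.form (w • x) X.rho
  refine ⟨w, fun a => ?_⟩
  by_contra! ha
  have h1 := hw (X.simpleRefl a * w)
  rw [mul_smul, simpleRefl_smul, form_sub_left, form_zsmul_left, X.form_comm (X.simpleRoot a) X.rho,
    form_simpleRoot] at h1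
  have h2 : ((w • x) a : ℚ) < 0 := by exact_mod_cast ha
  have h3 : 0 < (X.rho a : ℚ) / X.t a :=
    div_pos (by exact_mod_cast X.rho_pos a) (X.cast_t_pos a)
  have h4 := mul_neg_of_neg_of_pos h2 h3
  linarith

/-- If `x` is dominant, then `(wx | ρ) < (x | ρ)` unless `wx = x`. -/
theorem Dominant.form_smul_rho_lt {X : DynkinDiagram} {x : X.Weight} (hx : X.Dominant x)
    {w : X.weylGroup} (hw : w • x ≠ x) : X.form (w • x) X.rho < X.form x X.rho := by
  obtain ⟨n, h, hn⟩ := hx.exists_sub_smul_eq w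
  have h1 : 0 < X.form X.rho (X.rootComb n) := by
    refine X.form_pos_of_regular X.rho_pos hn fun h0 => hw ?_
    rw [h0, map_zero, sub_eq_zero] at h
    exact h.symm
  rw [← h, form_comm, form_sub_left] at h1
  linarith

/-- All roots lie below the highest root. -/
theorem exists_sub_root_eq (X : DynkinDiagram) {β : X.Weight} (hβ : β ∈ X.roots) :
    ∃ n : X.Vertex → ℤ, X.highestRoot - β = X.rootComb n ∧ ∀ a, 0 ≤ n a := by
  obtain ⟨n, rfl, -, hn, -⟩ := X.exists_rootComb_of_mem_roots hβ
  exact ⟨_, by rw [highestRoot_eq_rootComb, ← map_sub]; rfl, fun a => sub_nonneg.2 (hn a)⟩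

/-- The highest root is conjugate to a long simple root `α_a`: the dominant conjugate `β` of `α_a`
lies below `θ` and has the same square length, so that `|θ - β|² = (θ | θ - β) - (β | θ - β)` cannot
be positive. -/
theorem exists_highestRoot_eq (X : DynkinDiagram) :
    ∃ (w : X.weylGroup) (a : X.Vertex), X.highestRoot = w • X.simpleRoot a ∧ X.t a = 1 := by
  obtain ⟨a, ha⟩ := X.exists_t_eq_one
  obtain ⟨w, hw⟩ := X.exists_smul_dominant (X.simpleRoot a)
  refine ⟨w, a, ?_, ha⟩
  obtain ⟨n, hn, hn0⟩ := X.exists_sub_root_eq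
    (X.smul_mem_roots w (X.simpleRoot_mem_roots a))
  have h1 := hw.form_nonneg hn0
  have h2 := Dominant.form_nonneg (X := X) (x := X.highestRoot) X.highestRoot_nonneg hn0
  have h3 : X.form (w • X.simpleRoot a) (w • X.simpleRoot a) = 2 := by
    rw [form_smul_smul, form_simpleRoot_self, ha, Nat.cast_one, div_one]
  rw [← hn] at h1 h2
  by_contra hne
  have h4 := X.form_self_pos (sub_ne_zero.2 hne)
  have h5 := X.form_highestRoot_self
  rw [form_sub_left] at h4
  rw [form_sub_right] at h1 h2 h4
  rw [form_sub_right] at h4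
  rw [X.form_comm (w • X.simpleRoot a) X.highestRoot] at h1 h4
  linarith

/-! ### The affine Weyl group and the alcove -/

/-- The integer `(x | θ)`. -/
def level (X : DynkinDiagram) (x : X.Weight) : ℤ := ∑ a, X.finComark a * x a

theorem form_highestRoot_eq_level (X : DynkinDiagram) (x : X.Weight) :
    X.form x X.highestRoot = X.level x := by
  rw [form_highestRoot, level]
  push_cast
  rfl

theorem level_rho (X : DynkinDiagram) : X.level X.rho + 1 = X.dualCoxeter := by
  rw [level, dualCoxeter, Fin.sum_univ_succ]
  simp only [rho, mul_one, comark, Fin.cons_zero, Fin.cons_succ]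
  push_cast
  ring

/-- The integral points of the open alcove of level `K`. -/
def InAlcove (X : DynkinDiagram) (K : ℕ) (x : X.Weight) : Prop :=
  (∀ a, 0 < x a) ∧ X.level x < K

theorem InAlcove.form_pos {X : DynkinDiagram} {K : ℕ} {x : X.Weight} (hx : X.InAlcove K x)
    {β : X.Weight} (hβ : β ∈ X.posRoots) : 0 < X.form x β :=
  X.form_pos_of_mem_posRoots hx.1 hβ

theorem InAlcove.form_lt {X : DynkinDiagram} {K : ℕ} {x : X.Weight} (hx : X.InAlcove K x)
    {β : X.Weight} (hβ : β ∈ X.roots) : X.form x β < K := by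
  obtain ⟨n, h, hn⟩ := X.exists_sub_root_eq hβ
  have h1 := Dominant.form_nonneg (X := X) (x := x) (fun a => (hx.1 a).le) hn
  rw [← h, form_sub_right, form_highestRoot_eq_level] at h1
  have h2 : (X.level x : ℚ) < K := by exact_mod_cast hx.2
  linarith

/-- The zero vector is the only element of `Q^∨` whose pairings with the roots are at most `1` in
absolute value: otherwise some simple reflection brings it closer to zero. -/
theorem eq_zero_of_abs_form_le_one (X : DynkinDiagram) {m : X.Weight} (hm : m ∈ X.corootLattice)
    (h : ∀ β ∈ X.roots, |X.form m β| ≤ 1) : m = 0 := by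
  obtain ⟨n, rfl, hn⟩ := (X.mem_corootLattice_iff m).1 hm
  choose p hp using hn
  induction hN : ∑ a, (p a).natAbs using Nat.strong_induction_on generalizing n p with
  | _ N ih =>
    by_contra hne
    have h1 := X.form_self_pos hne
    rw [form_rootComb] at h1
    obtain ⟨a, -, ha⟩ := Finset.exists_lt_of_sum_lt (s := Finset.univ) (f := fun _ => (0 : ℚ))
      (by simpa using h1)
    have ht := X.cast_t_pos a
    have h2 := h _ (X.simpleRoot_mem_roots a)
    obtain ⟨z, hz⟩ := X.exists_int_form (X.simpleRoot a) hm
    rw [form_comm] at hz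
    have hz' := hz
    rw [form_simpleRoot, div_eq_iff ht.ne'] at hz
    have hz2 : X.rootComb n a = z * X.t a := by exact_mod_cast hz
    rw [hz', ← Int.cast_abs] at h2
    have h3 : |z| ≤ 1 := by exact_mod_cast h2
    have h4 : 0 < p a * z := by
      rw [hp a, hz2] at ha
      push_cast at ha
      rw [mul_div_cancel_right₀ _ ht.ne', mul_assoc] at ha
      have h5 := (mul_pos_iff_of_pos_left ht).1 ha
      exact_mod_cast h5
    have h6 : X.simpleRefl a • X.rootComb n = X.rootComb (n - Pi.single a (z * X.t a)) := by
      rw [simpleRefl_smul, map_sub, rootComb_single, hz2]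
    have h7 := ih (∑ b, ((p - Pi.single a z : X.Vertex → ℤ) b).natAbs) ?_
      (n - Pi.single a (z * X.t a)) ?_ ?_ (p - Pi.single a z) ?_ rfl
    · rw [← h6, smul_eq_zero_iff_eq] at h7
      exact hne h7
    · rw [← hN]
      refine Finset.sum_lt_sum (fun b _ => ?_) ⟨a, Finset.mem_univ a, ?_⟩
      · by_cases hb : b = a
        · subst hb
          rw [Pi.sub_apply, Pi.single_eq_same]
          have h8 : z = 1 ∨ z = -1 := by
            have := abs_le.1 h3
            rcases lt_trichotomy z 0 with h | h | h
            · omega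
            · simp [h] at h4
            · omega
          rcases h8 with rfl | rfl <;> omega
        · rw [Pi.sub_apply, Pi.single_eq_of_ne hb, sub_zero]
      · rw [Pi.sub_apply, Pi.single_eq_same]
        have h8 : z = 1 ∨ z = -1 := by
          have := abs_le.1 h3
          rcases lt_trichotomy z 0 with h | h | h
          · omega
          · simp [h] at h4
          · omega
        rcases h8 with rfl | rfl <;> omega
    · rw [← h6]
      exact X.smul_mem_corootLattice _ hm
    · intro β hβ
      rw [← h6, form_smul_left]
      exact h _ (X.smul_mem_roots _ hβ)
    · intro b
      by_cases hb : b = a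
      · subst hb
        rw [Pi.sub_apply, Pi.sub_apply, Pi.single_eq_same, Pi.single_eq_same, hp b]
        ring
      · rw [Pi.sub_apply, Pi.sub_apply, Pi.single_eq_of_ne hb, Pi.single_eq_of_ne hb, sub_zero,
          sub_zero, hp b]

/-- The affine Weyl group acts freely on the open alcove and moves it off itself. -/
theorem InAlcove.eq_one_of_smul_eq {X : DynkinDiagram} {K : ℕ} {x y : X.Weight}
    (hx : X.InAlcove K x) (hy : X.InAlcove K y) {w : X.weylGroup} {m : X.Weight}
    (hm : m ∈ X.corootLattice) (h : w • x = y + K • m) : w = 1 ∧ x = y := by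
  -- The pairings of `x` and `y` with positive roots lie strictly between `0` and `K`, and
  -- `(x | w⁻¹ β) = (y | β) + K (m | β)`. So `(m | β)` is `0` or `-1` according to
  -- the sign of `w⁻¹ β`.
  have key : ∀ β ∈ X.posRoots, (w⁻¹ • β ∈ X.posRoots ∧ X.form m β = 0) ∨ X.form m β = -1 := by
    intro β hβ
    have hβ' := (X.mem_posRoots.1 hβ).1
    obtain ⟨z, hz⟩ := X.exists_int_form β hm
    have h1 : X.form x (w⁻¹ • β) = X.form y β + K * z := by
      rw [← form_smul_left, h, form_add_left, ← natCast_zsmul, form_zsmul_left, Int.cast_natCast,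
        X.form_comm m, hz]
    have h2 := hy.form_pos hβ
    have h3 := hy.form_lt hβ'
    have hK : (0 : ℚ) < K := h2.trans h3
    rw [X.form_comm m, hz]
    have h0 := X.smul_mem_roots w⁻¹ hβ'
    rcases X.mem_posRoots_or_neg_mem h0 with h4 | h4
    · have h5 := hx.form_pos h4
      have h6 := hx.form_lt h0
      have h7 : (-1 : ℚ) < z := by
        by_contra! h
        have := mul_le_mul_of_nonneg_left h hK.le
        linarith
      have h8 : (z : ℚ) < 1 := by
        by_contra! h
        have := mul_le_mul_of_nonneg_left h hK.le
        linarith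
      have h9 : -1 < z := by exact_mod_cast h7
      have h10 : z < 1 := by exact_mod_cast h8
      exact Or.inl ⟨h4, by rw [show z = 0 by omega, Int.cast_zero]⟩
    · have h5 := hx.form_pos h4
      have h6 := hx.form_lt (X.neg_mem_roots h0)
      rw [form_neg_right] at h5 h6
      have h7 : (-2 : ℚ) < z := by
        by_contra! h
        have := mul_le_mul_of_nonneg_left h hK.le
        linarith
      have h8 : (z : ℚ) < 0 := by
        by_contra! h
        have := mul_nonneg hK.le h
        linarith
      have h9 : -2 < z := by exact_mod_cast h7
      have h10 : z < 0 := by exact_mod_cast h8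
      exact Or.inr (by rw [show z = -1 by omega, Int.cast_neg, Int.cast_one])
  have hm0 : m = 0 := by
    refine X.eq_zero_of_abs_form_le_one hm fun β hβ => ?_
    have h1 : ∀ β ∈ X.posRoots, |X.form m β| ≤ 1 := by
      intro β hβ
      rcases key β hβ with ⟨-, h⟩ | h <;> rw [h] <;> norm_num
    rcases X.mem_posRoots_or_neg_mem hβ with h2 | h2
    · exact h1 β h2
    · have h3 := h1 _ h2
      rwa [form_neg_right, abs_neg] at h3
  have hw : w⁻¹ = 1 := by
    refine X.eq_one_of_smul_mem_posRoots fun b => ?_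
    rcases key _ (X.simpleRoot_mem_posRoots b) with h1 | h1
    · exact h1.1
    · rw [hm0, form_zero_left] at h1
      norm_num at h1
  have hw1 : w = 1 := inv_eq_one.1 hw
  rw [hw1, one_smul, hm0, smul_zero, add_zero] at h
  exact ⟨hw1, h⟩

/-- Some positive multiple of the weight lattice lies in `Q^∨`. -/
theorem exists_smul_mem_corootLattice (X : DynkinDiagram) :
    ∃ N : ℕ, 0 < N ∧ ∀ x : X.Weight, N • x ∈ X.corootLattice := by
  have hdet : X.cartan.det ≠ 0 := by
    intro h
    apply X.det_cartan_ne_zero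
    have h1 := (Int.castRingHom ℚ).map_det X.cartan
    rw [h, map_zero] at h1
    exact h1.symm
  have ht : ((∏ a, X.t a : ℕ) : ℤ) ≠ 0 := by
    exact_mod_cast Finset.prod_ne_zero_iff.2 fun a _ => (X.t_pos a).ne'
  have hmem : ∀ x : X.Weight, (((∏ a, X.t a : ℕ) : ℤ) * X.cartan.det) • x ∈ X.corootLattice := by
    intro x
    refine (X.mem_corootLattice_iff _).2
      ⟨fun a => ((∏ a, X.t a : ℕ) : ℤ) * X.cartan.adjugate.mulVec x a, ?_, fun a => ?_⟩
    · funext a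
      rw [rootComb_apply]
      have h1 : X.cartan.mulVec (X.cartan.adjugate.mulVec x) = X.cartan.det • x := by
        rw [Matrix.mulVec_mulVec, Matrix.mul_adjugate, Matrix.smul_mulVec, Matrix.one_mulVec]
      have h2 := congrFun h1 a
      rw [mul_smul, Pi.smul_apply, ← h2, smul_eq_mul, Matrix.mulVec, dotProduct, Finset.mul_sum]
      exact Finset.sum_congr rfl fun b _ => by ring
    · exact Dvd.dvd.mul_right (by exact_mod_cast Finset.dvd_prod_of_mem X.t (Finset.mem_univ a)) _
  refine ⟨(((∏ a, X.t a : ℕ) : ℤ) * X.cartan.det).natAbs,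
    Int.natAbs_pos.2 (mul_ne_zero ht hdet), fun x => ?_⟩
  rw [← natCast_zsmul]
  rcases Int.natAbs_eq (((∏ a, X.t a : ℕ) : ℤ) * X.cartan.det) with h | h
  · rw [← h]
    exact hmem x
  · have h2 := hmem (-x)
    rw [h, neg_smul, smul_neg, neg_neg] at h2
    exact h2

/-- The values of the form have a common denominator. -/
theorem exists_den_form (X : DynkinDiagram) :
    ∃ N : ℕ, 0 < N ∧ ∀ x y : X.Weight, ∃ z : ℤ, (N : ℚ) * X.form x y = z := by
  obtain ⟨N, hN, h⟩ := X.exists_smul_mem_corootLattice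
  refine ⟨N, hN, fun x y => ?_⟩
  obtain ⟨z, hz⟩ := X.exists_int_form x (h y)
  refine ⟨z, ?_⟩
  rw [← hz, ← natCast_zsmul, form_zsmul_right, Int.cast_natCast]

theorem form_self_nonneg (X : DynkinDiagram) (x : X.Weight) : 0 ≤ X.form x x := by
  by_cases h : x = 0
  · rw [h, form_zero_left]
  · exact (X.form_self_pos h).le

/-- Square lengths have a common denominator, so that they can be compared through natural numbers;
this allows induction on them. -/
theorem exists_natural_sq (X : DynkinDiagram) :
    ∃ f : X.Weight → ℕ, ∀ x y, X.form x x < X.form y y ↔ f x < f y := by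
  obtain ⟨N, hN, h⟩ := X.exists_den_form
  choose z hz using h
  have hN' : (0 : ℚ) < N := Nat.cast_pos.2 hN
  refine ⟨fun x => (z x x).toNat, fun x y => ?_⟩
  have h0 : ∀ x, 0 ≤ z x x := fun x => by
    have h1 : (0 : ℚ) ≤ z x x := hz x x ▸ mul_nonneg hN'.le (X.form_self_nonneg x)
    exact_mod_cast h1
  rw [← mul_lt_mul_iff_right₀ hN', hz, hz, Int.cast_lt]
  have := h0 x
  have := h0 y
  dsimp only
  omega

/-- The reflection in the highest root belongs to the Weyl group. -/
theorem exists_smul_eq_sub_level_smul (X : DynkinDiagram) :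
    ∃ v : X.weylGroup, X.sgn v = -1 ∧ ∀ x, v • x = x - X.level x • X.highestRoot := by
  obtain ⟨w, a, hw, ht⟩ := X.exists_highestRoot_eq
  refine ⟨w * X.simpleRefl a * w⁻¹, ?_, fun x => ?_⟩
  · rw [sgn_mul, sgn_mul, sgn_simpleRefl, sgn_inv, mul_right_comm, sgn_mul_self, one_mul]
  · have h1 : (w⁻¹ • x) a = X.level x := by
      have h2 := X.form_simpleRoot (w⁻¹ • x) a
      rw [ht, Nat.cast_one, div_one, form_smul_left, inv_inv, ← hw, form_highestRoot_eq_level] at h2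
      exact_mod_cast h2.symm
    rw [mul_smul, mul_smul, simpleRefl_smul, smul_sub, smul_inv_smul, h1, smul_comm, ← hw]

/-- Every weight is conjugate under the affine Weyl group to a point of the closed alcove: take the
point of its orbit closest to `ρ`. -/
theorem exists_mem_closedAlcove (X : DynkinDiagram) {K : ℕ} (hK : X.dualCoxeter ≤ K)
    (x : X.Weight) : ∃ (w : X.weylGroup) (m : X.Weight), m ∈ X.corootLattice ∧
      (∀ a, 0 ≤ (w • x + K • m) a) ∧ X.level (w • x + K • m) ≤ K := by
  obtain ⟨f, hf⟩ := X.exists_natural_sq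
  let g : X.weylGroup × X.corootLattice → ℕ := fun p => f (p.1 • x + K • p.2.1 - X.rho)
  obtain ⟨⟨w, m, hm⟩, hmin⟩ : ∃ p, ∀ q, g p ≤ g q := by
    obtain ⟨p, -, hp⟩ := (measure g).wf.has_min Set.univ ⟨(1, 0), trivial⟩
    exact ⟨p, fun q => not_lt.1 (hp q trivial)⟩
  have hmin' : ∀ (v : X.weylGroup) (m' : X.Weight), m' ∈ X.corootLattice → ∀ y,
      y = v • x + K • m' → X.form (w • x + K • m - X.rho) (w • x + K • m - X.rho) ≤
        X.form (y - X.rho) (y - X.rho) := by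
    rintro v m' hm' y rfl
    rw [← not_lt, hf, not_lt]
    exact hmin (v, ⟨m', hm'⟩)
  refine ⟨w, m, hm, fun a => ?_, ?_⟩
  · -- If a coordinate is negative, the simple reflection moves the point closer to `ρ`.
    by_contra! ha
    have h1 := hmin' (X.simpleRefl a * w) (X.simpleRefl a • m) (X.smul_mem_corootLattice _ hm)
      (X.simpleRefl a • (w • x + K • m))
      (by rw [smul_add, mul_smul, smul_comm (X.simpleRefl a) K m])
    generalize w • x + K • m = y at ha h1
    have h2 : ((y a : ℤ) : ℚ) < 0 := by exact_mod_cast ha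
    have h3 : 0 < (X.rho a : ℚ) / X.t a :=
      div_pos (by exact_mod_cast X.rho_pos a) (X.cast_t_pos a)
    have h4 := mul_neg_of_neg_of_pos h2 h3
    rw [form_sub_left, form_sub_right, form_sub_right, X.form_sub_left (X.simpleRefl a • y),
      form_sub_right, form_sub_right, form_smul_smul, X.form_comm X.rho (X.simpleRefl a • y),
      X.form_comm X.rho y, simpleRefl_smul, form_sub_left, form_zsmul_left,
      X.form_comm (X.simpleRoot a), form_simpleRoot] at h1
    linarith
  · -- If the level is too large, the affine reflection moves the point closer to `ρ`, which itself
    -- has level `h^∨ - 1 < K`.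
    by_contra! ha
    obtain ⟨v, -, hv⟩ := X.exists_smul_eq_sub_level_smul
    have h1 := hmin' (v * w) (v • m + X.highestRoot)
      (add_mem (X.smul_mem_corootLattice _ hm) X.highestRoot_mem_corootLattice)
      (v • (w • x + K • m) + K • X.highestRoot)
      (by rw [smul_add, mul_smul, smul_add K, smul_comm v K m, add_assoc])
    generalize w • x + K • m = y at ha h1
    have h2 : (K : ℚ) < X.level y := by exact_mod_cast ha
    have h3 : (X.level X.rho : ℚ) < K := by
      have := X.level_rho
      have h4 : X.level X.rho < K := by omega
      exact_mod_cast h4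
    have h5 : v • y + K • X.highestRoot - X.rho =
        (y - X.rho) - (X.level y - K) • X.highestRoot := by
      rw [hv, ← natCast_zsmul]
      module
    have h6 := X.form_highestRoot_self
    have h7 : X.form (y - X.rho) X.highestRoot = X.level y - X.level X.rho := by
      rw [form_sub_left, form_highestRoot_eq_level, form_highestRoot_eq_level]
    rw [h5] at h1
    generalize y - X.rho = z at h1 h7
    rw [X.form_sub_left z, X.form_sub_right z, X.form_sub_right (_ • _), form_zsmul_left,
      form_zsmul_left, form_zsmul_right, form_zsmul_right, X.form_comm X.highestRoot z, h6, h7]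
      at h1
    push_cast at h1
    nlinarith [mul_pos (sub_pos.2 h2) (sub_pos.2 h3)]

/-! ### Alternating exponential sums and the unitarity of the modular S-matrix -/

/-- The additive character `q ↦ exp (2πi q)` of `ℚ`. -/
noncomputable def e (q : ℚ) : ℂ := Complex.exp (2 * Real.pi * Complex.I * q)

theorem e_zero : e 0 = 1 := by simp [e]

theorem e_add (p q : ℚ) : e (p + q) = e p * e q := by
  rw [e, e, e, ← Complex.exp_add]
  push_cast
  ring_nf

theorem e_int (n : ℤ) : e n = 1 := by
  rw [e, Complex.exp_eq_one_iff]
  exact ⟨n, by push_cast; ring⟩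

theorem e_eq_one_iff (q : ℚ) : e q = 1 ↔ ∃ n : ℤ, q = n := by
  refine ⟨fun h => ?_, fun ⟨n, h⟩ => h ▸ e_int n⟩
  rw [e, Complex.exp_eq_one_iff] at h
  obtain ⟨n, hn⟩ := h
  rw [mul_comm] at hn
  have h1 := mul_right_cancel₀ Complex.two_pi_I_ne_zero hn
  exact ⟨n, by exact_mod_cast h1⟩

theorem conj_e (q : ℚ) : (starRingEnd ℂ) (e q) = e (-q) := by
  rw [e, e, ← Complex.exp_conj]
  congr 1
  simp only [map_mul, Complex.conj_ofReal, Complex.conj_I, Complex.conj_ofNat, map_ratCast]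
  push_cast
  ring

theorem e_natCast_mul (q : ℚ) (n : ℕ) : e (n * q) = e q ^ n := by
  induction n with
  | zero => simp [e_zero]
  | succ n ih => rw [pow_succ, ← ih, ← e_add]; congr 1; push_cast; ring

/-- The function `exp (-2πi (x | y) / K)`. -/
noncomputable def wave (X : DynkinDiagram) (K : ℕ) (x y : X.Weight) : ℂ := e (-(X.form x y / K))

section Wave

variable {X : DynkinDiagram} {K : ℕ}

theorem wave_add_left (x x' y : X.Weight) :
    X.wave K (x + x') y = X.wave K x y * X.wave K x' y := by
  rw [wave, wave, wave, ← e_add, form_add_left]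
  congr 1
  ring

theorem wave_add_right (x y y' : X.Weight) :
    X.wave K x (y + y') = X.wave K x y * X.wave K x y' := by
  rw [wave, wave, wave, ← e_add, form_add_right]
  congr 1
  ring

theorem wave_comm (x y : X.Weight) : X.wave K x y = X.wave K y x := by
  rw [wave, wave, form_comm]

theorem wave_smul_left (w : X.weylGroup) (x y : X.Weight) :
    X.wave K (w • x) y = X.wave K x (w⁻¹ • y) := by
  rw [wave, wave, form_smul_left]

theorem conj_wave (x y : X.Weight) : (starRingEnd ℂ) (X.wave K x y) = X.wave K (-x) y := by
  rw [wave, wave, conj_e, form_neg_left, neg_div]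

theorem wave_smul_mem (hK : 0 < K) (x : X.Weight) {m : X.Weight} (hm : m ∈ X.corootLattice) :
    X.wave K x (K • m) = 1 := by
  obtain ⟨n, hn⟩ := X.exists_int_form x hm
  have h0 : (K : ℚ) ≠ 0 := Nat.cast_ne_zero.2 hK.ne'
  rw [wave, ← natCast_zsmul, form_zsmul_right, hn, Int.cast_natCast, mul_div_cancel_left₀ _ h0,
    ← Int.cast_neg, e_int]

end Wave

/-- The alternating sum `∑_w (-1)^{ℓ(w)} exp (-2πi (w x | y) / K)`. -/
noncomputable def alternant (X : DynkinDiagram) (K : ℕ) (x y : X.Weight) : ℂ :=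
  ∑ w : X.weylGroup, (X.sgn w : ℂ) * X.wave K (w • x) y

section Alternant

variable {X : DynkinDiagram} {K : ℕ}

theorem alternant_comm (x y : X.Weight) : X.alternant K x y = X.alternant K y x := by
  rw [alternant, alternant, ← Equiv.sum_comp (Equiv.inv X.weylGroup)]
  refine Finset.sum_congr rfl fun w _ => ?_
  rw [Equiv.inv_apply, sgn_inv, wave_smul_left, inv_inv, wave_comm]

theorem alternant_smul_left (w : X.weylGroup) (x y : X.Weight) :
    X.alternant K (w • x) y = X.sgn w * X.alternant K x y := by
  rw [alternant, alternant, ← Equiv.sum_comp (Equiv.mulRight w⁻¹), Finset.mul_sum]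
  refine Finset.sum_congr rfl fun v _ => ?_
  rw [Equiv.coe_mulRight, smul_smul, inv_mul_cancel_right, sgn_mul, sgn_inv]
  push_cast
  ring

theorem alternant_smul_right (w : X.weylGroup) (x y : X.Weight) :
    X.alternant K x (w • y) = X.sgn w * X.alternant K x y := by
  rw [alternant_comm, alternant_smul_left, alternant_comm]

theorem alternant_add_right (hK : 0 < K) (x y : X.Weight) {m : X.Weight}
    (hm : m ∈ X.corootLattice) : X.alternant K x (y + K • m) = X.alternant K x y := by
  refine Finset.sum_congr rfl fun w _ => ?_
  rw [wave_add_right, wave_smul_mem hK _ hm, mul_one]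

theorem alternant_add_left (hK : 0 < K) (x y : X.Weight) {m : X.Weight}
    (hm : m ∈ X.corootLattice) : X.alternant K (x + K • m) y = X.alternant K x y := by
  rw [alternant_comm, alternant_add_right hK y x hm, alternant_comm]

theorem alternant_eq_zero_of_apply_eq_zero {x : X.Weight} (y : X.Weight) {a : X.Vertex}
    (h : x a = 0) : X.alternant K x y = 0 := by
  have h1 := alternant_smul_left (K := K) (X.simpleRefl a) x y
  rw [simpleRefl_smul, h, zero_smul, sub_zero, sgn_simpleRefl] at h1
  push_cast at h1
  linear_combination h1 / 2

theorem alternant_eq_zero_of_level_eq (hK : 0 < K) {x : X.Weight} (y : X.Weight)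
    (h : X.level x = K) : X.alternant K x y = 0 := by
  obtain ⟨v, hv, hx⟩ := X.exists_smul_eq_sub_level_smul
  have h1 := alternant_smul_left (K := K) v x y
  have h2 : v • x + K • X.highestRoot = x := by
    rw [hx, h, natCast_zsmul, sub_add_cancel]
  rw [hv, ← alternant_add_left hK _ _ X.highestRoot_mem_corootLattice, h2] at h1
  push_cast at h1
  linear_combination h1 / 2

/-- A weight whose alternant does not vanish is conjugate under the affine Weyl group to a point of
the open alcove: on its walls the alternants change sign under a reflection fixing the point. -/
theorem alternant_reduce (hK : X.dualCoxeter ≤ K) (hK0 : 0 < K) (x : X.Weight) :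
    (∀ y, X.alternant K x y = 0) ∨ ∃ (w : X.weylGroup) (m : X.Weight), m ∈ X.corootLattice ∧
      X.InAlcove K (w • x + K • m) := by
  obtain ⟨w, m, hm, h1, h2⟩ := X.exists_mem_closedAlcove hK x
  by_cases h3 : X.InAlcove K (w • x + K • m)
  · exact Or.inr ⟨w, m, hm, h3⟩
  · left
    intro y
    have h4 : X.alternant K (w • x + K • m) y = 0 := by
      by_cases h5 : ∃ a, (w • x + K • m) a = 0
      · obtain ⟨a, ha⟩ := h5
        exact alternant_eq_zero_of_apply_eq_zero y ha
      · push Not at h5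
        refine alternant_eq_zero_of_level_eq hK0 y (le_antisymm h2 ?_)
        by_contra! h6
        exact h3 ⟨fun a => lt_of_le_of_ne (h1 a) (h5 a).symm, h6⟩
    rw [alternant_add_left hK0 _ _ hm, alternant_smul_left] at h4
    have h5 : (X.sgn w : ℂ) * X.sgn w = 1 := by exact_mod_cast X.sgn_mul_self w
    linear_combination (X.sgn w : ℂ) * h4 - X.alternant K x y * h5

end Alternant

/-- The lattice `K Q^∨`. -/
def scaledLattice (X : DynkinDiagram) (K : ℕ) : AddSubgroup X.Weight :=
  X.corootLattice.map (nsmulAddMonoidHom K)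

theorem mem_scaledLattice {X : DynkinDiagram} {K : ℕ} {x : X.Weight} :
    x ∈ X.scaledLattice K ↔ ∃ m ∈ X.corootLattice, K • m = x := Iff.rfl

/-- The subgroup `K ℤ^n` is the kernel of the reduction `ℤ^n → (ℤ/K)^n`. -/
theorem index_range_nsmul (n K : ℕ) (hK : 0 < K) :
    (nsmulAddMonoidHom (α := Fin n → ℤ) K).range.index = K ^ n := by
  have : NeZero K := ⟨hK.ne'⟩
  have h1 : (nsmulAddMonoidHom (α := Fin n → ℤ) K).range =
      ((Int.castAddHom (ZMod K)).compLeft (Fin n)).ker := by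
    ext x
    rw [AddMonoidHom.mem_range, AddMonoidHom.mem_ker, funext_iff]
    constructor
    · rintro ⟨y, rfl⟩ a
      simp
    · intro h
      have h2 : ∀ a, ∃ z, x a = K * z := fun a =>
        (ZMod.intCast_zmod_eq_zero_iff_dvd (x a) K).1 (h a)
      choose y hy using h2
      exact ⟨y, funext fun a => by simp [hy a]⟩
  rw [h1, AddSubgroup.index_ker, AddMonoidHom.range_eq_top.2]
  · rw [Nat.card_congr (AddSubgroup.topEquiv).toEquiv]
    simp
  · intro y
    choose z hz using fun a => ZMod.intCast_surjective (y a)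
    exact ⟨z, funext hz⟩

theorem index_scaledLattice (X : DynkinDiagram) {K : ℕ} (hK : 0 < K) :
    (X.scaledLattice K).index = X.corootLattice.index * K ^ X.rank := by
  rw [scaledLattice, AddSubgroup.index_map_of_injective, index_range_nsmul _ _ hK]
  intro x y h
  exact smul_right_injective _ hK.ne' h

theorem index_corootLattice_ne_zero (X : DynkinDiagram) : X.corootLattice.index ≠ 0 := by
  obtain ⟨N, hN, h⟩ := X.exists_smul_mem_corootLattice
  have h1 : (nsmulAddMonoidHom (α := X.Weight) N).range ≤ X.corootLattice := by
    rintro _ ⟨x, rfl⟩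
    exact h x
  intro h0
  have h2 := AddSubgroup.index_dvd_of_le h1
  rw [h0, index_range_nsmul _ _ hN, zero_dvd_iff] at h2
  exact (pow_pos hN _).ne' h2

section Orthogonality

variable {X : DynkinDiagram} {K : ℕ}

theorem finite_quotient_scaledLattice (hK : 0 < K) : Finite (X.Weight ⧸ X.scaledLattice K) := by
  have h : (X.scaledLattice K).index ≠ 0 := by
    rw [X.index_scaledLattice hK]
    exact mul_ne_zero X.index_corootLattice_ne_zero (pow_pos hK _).ne'
  have : (X.scaledLattice K).FiniteIndex := ⟨h⟩
  exact AddSubgroup.finite_quotient_of_finiteIndex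

theorem out_eq_add (x : X.Weight) :
    ∃ m ∈ X.corootLattice, (QuotientAddGroup.mk x : X.Weight ⧸ X.scaledLattice K).out =
      x + K • m := by
  obtain ⟨⟨_, m, hm, rfl⟩, h⟩ := QuotientAddGroup.mk_out_eq_add (X.scaledLattice K) x
  exact ⟨m, hm, h⟩

theorem mk_eq_mk_iff {x y : X.Weight} :
    (QuotientAddGroup.mk x : X.Weight ⧸ X.scaledLattice K) = QuotientAddGroup.mk y ↔
      ∃ m ∈ X.corootLattice, x = y + K • m := by
  rw [eq_comm, QuotientAddGroup.eq, mem_scaledLattice]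
  refine exists_congr fun m => and_congr_right fun _ => ?_
  rw [neg_add_eq_sub, eq_sub_iff_add_eq, add_comm, eq_comm]

variable [Fintype (X.Weight ⧸ X.scaledLattice K)]

/-- Character orthogonality on `P / K Q^∨`. A character that is trivial on `P` comes from `K Q^∨`,
because `Q^∨` is dual to `P`. -/
theorem sum_wave (hK : 0 < K) (x : X.Weight) [Decidable (x ∈ X.scaledLattice K)] :
    ∑ g : X.Weight ⧸ X.scaledLattice K, X.wave K x g.out =
      if x ∈ X.scaledLattice K then ((X.scaledLattice K).index : ℂ) else 0 := by
  split_ifs with hx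
  · obtain ⟨m, hm, rfl⟩ := hx
    have h1 : ∀ y, X.wave K (nsmulAddMonoidHom K m) y = 1 := fun y => by
      rw [wave_comm]
      exact wave_smul_mem hK y hm
    simp only [h1, Finset.sum_const, Finset.card_univ, nsmul_eq_mul, mul_one]
    rw [AddSubgroup.index, Nat.card_eq_fintype_card]
  · obtain ⟨v, hv⟩ : ∃ v, X.wave K x v ≠ 1 := by
      by_contra! h
      refine hx ?_
      obtain ⟨m, hm, rfl⟩ := X.exists_eq_smul_of_form (K := K) (x := x) fun y => by
        have h1 := h y
        rw [wave, e_eq_one_iff] at h1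
        obtain ⟨n, hn⟩ := h1
        refine ⟨-n, ?_⟩
        have h0 : (K : ℚ) ≠ 0 := Nat.cast_ne_zero.2 hK.ne'
        rw [neg_eq_iff_eq_neg, div_eq_iff h0] at hn
        rw [hn]
        push_cast
        ring
      exact ⟨m, hm, rfl⟩
    have h1 : ∑ g : X.Weight ⧸ X.scaledLattice K, X.wave K x g.out =
        X.wave K x v * ∑ g : X.Weight ⧸ X.scaledLattice K, X.wave K x g.out := by
      conv_lhs => rw [← Equiv.sum_comp (Equiv.addRight (QuotientAddGroup.mk v))]
      rw [Finset.mul_sum]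
      refine Finset.sum_congr rfl fun g _ => ?_
      have h2 : g + QuotientAddGroup.mk v = QuotientAddGroup.mk (g.out + v) := by
        rw [QuotientAddGroup.mk_add, QuotientAddGroup.out_eq']
      obtain ⟨m, hm, h3⟩ := out_eq_add (K := K) (g.out + v)
      rw [Equiv.coe_addRight]
      beta_reduce
      rw [h2, h3, wave_add_right, wave_add_right, wave_smul_mem hK _ hm,
        mul_one, mul_comm]
    have h2 : (X.wave K x v - 1) *
        ∑ g : X.Weight ⧸ X.scaledLattice K, X.wave K x g.out = 0 := by
      linear_combination -h1
    exact (mul_eq_zero.1 h2).resolve_left (sub_ne_zero.2 hv)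

/-- Orthogonality of the alternants over the full period. Only the diagonal pairs of Weyl group
elements contribute, since the affine Weyl group acts freely on the alcove. -/
theorem sum_quotient_alternant (hK : 0 < K) {x y : X.Weight} (hx : X.InAlcove K x)
    (hy : X.InAlcove K y) :
    ∑ g : X.Weight ⧸ X.scaledLattice K,
      X.alternant K x g.out * (starRingEnd ℂ) (X.alternant K y g.out) =
      (Fintype.card X.weylGroup : ℂ) *
        if x = y then ((X.scaledLattice K).index : ℂ) else 0 := by
  classical
  have h1 : ∀ g : X.Weight ⧸ X.scaledLattice K,
      X.alternant K x g.out * (starRingEnd ℂ) (X.alternant K y g.out) =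
      ∑ w : X.weylGroup, ∑ v : X.weylGroup,
        (X.sgn w * X.sgn v : ℂ) * X.wave K (w • x - v • y) g.out := by
    intro g
    rw [alternant, alternant, map_sum, Finset.sum_mul_sum]
    refine Finset.sum_congr rfl fun w _ => Finset.sum_congr rfl fun v _ => ?_
    rw [map_mul, conj_wave, sub_eq_add_neg, wave_add_left]
    simp only [map_intCast]
    ring
  simp only [h1]
  rw [Finset.sum_comm]
  simp only [Finset.sum_comm (s := (Finset.univ : Finset (X.Weight ⧸ X.scaledLattice K))),
    ← Finset.mul_sum, sum_wave hK]
  have h2 : ∀ w v : X.weylGroup, w • x - v • y ∈ X.scaledLattice K ↔ w = v ∧ x = y := by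
    intro w v
    constructor
    · rintro ⟨m, hm, h⟩
      have h3 : (v⁻¹ * w) • x = y + K • (v⁻¹ • m) := by
        have h4 : K • m = w • x - v • y := h
        rw [smul_comm K, h4, mul_smul, smul_sub, inv_smul_smul]
        abel
      obtain ⟨h4, h5⟩ := hx.eq_one_of_smul_eq hy (X.smul_mem_corootLattice _ hm) h3
      exact ⟨(inv_mul_eq_one.1 h4).symm, h5⟩
    · rintro ⟨rfl, rfl⟩
      rw [sub_self]
      exact zero_mem _
  simp only [h2]
  split_ifs with h
  · simp only [h, and_true, mul_ite, mul_zero, Finset.sum_ite_eq, Finset.mem_univ, if_true]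
    have h3 : ∀ w : X.weylGroup, (X.sgn w : ℂ) * X.sgn w = 1 := fun w => by
      exact_mod_cast X.sgn_mul_self w
    simp only [h3, one_mul, Finset.sum_const, Finset.card_univ, nsmul_eq_mul]
  · simp [h]

end Orthogonality

/-! ### Level weights as points of the alcove -/

/-- The level `k` weights `x`, shifted by `ρ`, are the integral points of the alcove of level
`k + h^∨`. -/
def shift (X : DynkinDiagram) {k : ℕ} (x : X.LevelWeight k) : X.Weight := X.finitePart x + X.rho

theorem level_finitePart (X : DynkinDiagram) {k : ℕ} (x : X.LevelWeight k) :
    (x.1 0 : ℤ) + X.level (X.finitePart x) = k := by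
  have h := x.2
  rw [Fin.sum_univ_succ] at h
  simp only [comark, Fin.cons_zero, Fin.cons_succ, one_mul] at h
  have h1 := congrArg (Nat.cast : ℕ → ℤ) h
  push_cast at h1
  exact h1

theorem level_add (X : DynkinDiagram) (x y : X.Weight) :
    X.level (x + y) = X.level x + X.level y := by
  simp only [level, Pi.add_apply, mul_add, Finset.sum_add_distrib]

theorem inAlcove_shift (X : DynkinDiagram) {k : ℕ} (x : X.LevelWeight k) :
    X.InAlcove (k + X.dualCoxeter) (X.shift x) := by
  refine ⟨fun a => ?_, ?_⟩
  · simp only [shift, finitePart, Pi.add_apply, rho]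
    omega
  · rw [shift, level_add]
    have := X.level_finitePart x
    have := X.level_rho
    push_cast
    omega

theorem shift_injective (X : DynkinDiagram) {k : ℕ} :
    Function.Injective (X.shift : X.LevelWeight k → X.Weight) := by
  intro x y h
  have h1 : X.finitePart x = X.finitePart y := add_right_cancel h
  have h2 := X.level_finitePart x
  rw [h1, ← X.level_finitePart y] at h2
  refine Subtype.ext (funext fun i => ?_)
  refine Fin.cases ?_ (fun a => ?_) i
  · omega
  · have := congrFun h1 a
    simp only [finitePart] at this
    omega

theorem exists_shift_eq (X : DynkinDiagram) {k : ℕ} {y : X.Weight}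
    (hy : X.InAlcove (k + X.dualCoxeter) y) : ∃ x : X.LevelWeight k, X.shift x = y := by
  have h1 := X.level_rho
  have h2 := hy.2
  have h3 := X.level_add (y - X.rho) X.rho
  rw [sub_add_cancel] at h3
  push_cast at h2
  refine ⟨⟨Fin.cons (k - X.level (y - X.rho)).toNat fun a => (y a - 1).toNat, ?_⟩, ?_⟩
  · rw [Fin.sum_univ_succ]
    simp only [comark, Fin.cons_zero, Fin.cons_succ, one_mul]
    have h4 : ((∑ a, X.finComark a * (y a - 1).toNat : ℕ) : ℤ) = X.level (y - X.rho) := by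
      rw [level, Nat.cast_sum]
      refine Finset.sum_congr rfl fun a _ => ?_
      have := hy.1 a
      rw [Nat.cast_mul, Int.toNat_of_nonneg (by omega)]
      rfl
    zify
    push_cast at h4
    rw [h4]
    omega
  · funext a
    have := hy.1 a
    simp only [shift, finitePart, Pi.add_apply, rho, Fin.cons_succ]
    omega

theorem shift_vacuum (X : DynkinDiagram) (k : ℕ) : X.shift (X.vacuum k) = X.rho := by
  funext a
  simp [shift, finitePart, vacuum, multipleFundamental]

theorem dualCoxeter_pos (X : DynkinDiagram) : 0 < X.dualCoxeter := by
  rw [dualCoxeter, Fin.sum_univ_succ]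
  exact Nat.add_pos_left (X.comark_pos 0) _

section Unitarity

variable {X : DynkinDiagram} {k : ℕ}

open scoped Classical in
/-- Orthogonality of the alternants over the alcove. The product of an alternant and a conjugate
alternant is invariant under the affine Weyl group and vanishes on the walls, so the sum over
`P / K Q^∨` is `|W|` times the sum over the alcove. -/
theorem sum_alternant (x y : X.LevelWeight k) :
    ∑ u : X.LevelWeight k, X.alternant (k + X.dualCoxeter) (X.shift x) (X.shift u) *
      (starRingEnd ℂ) (X.alternant (k + X.dualCoxeter) (X.shift y) (X.shift u)) =
      if x = y then ((X.scaledLattice (k + X.dualCoxeter)).index : ℂ) else 0 := by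
  have hK : 0 < k + X.dualCoxeter := Nat.add_pos_right _ X.dualCoxeter_pos
  have hle : X.dualCoxeter ≤ k + X.dualCoxeter := Nat.le_add_left _ _
  have hfin := finite_quotient_scaledLattice (X := X) hK
  have := Fintype.ofFinite (X.Weight ⧸ X.scaledLattice (k + X.dualCoxeter))
  have h1 := sum_quotient_alternant hK (X.inAlcove_shift x) (X.inAlcove_shift y)
  simp only [X.shift_injective.eq_iff] at h1
  have hcard : (Fintype.card X.weylGroup : ℂ) ≠ 0 := Nat.cast_ne_zero.2 Fintype.card_ne_zero
  refine mul_left_cancel₀ hcard (Eq.trans ?_ h1)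
  rw [← Finset.card_univ, ← nsmul_eq_mul, ← Finset.sum_const, ← Finset.sum_product']
  refine Finset.sum_of_injOn (fun p => QuotientAddGroup.mk (p.1 • X.shift p.2)) ?_
    (fun _ _ => Finset.mem_coe.2 (Finset.mem_univ _)) ?_ ?_
  · rintro ⟨w, u⟩ - ⟨v, u'⟩ - h
    obtain ⟨m, hm, h2⟩ := mk_eq_mk_iff.1 h
    dsimp only at h2
    have h3 : (v⁻¹ * w) • X.shift u = X.shift u' + (k + X.dualCoxeter) • (v⁻¹ • m) := by
      rw [mul_smul, h2, smul_add, inv_smul_smul, smul_comm v⁻¹ _ m]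
    obtain ⟨h4, h5⟩ := (X.inAlcove_shift u).eq_one_of_smul_eq (X.inAlcove_shift u')
      (X.smul_mem_corootLattice _ hm) h3
    rw [X.shift_injective h5, inv_mul_eq_one.1 h4]
  · intro g _ hg
    rcases alternant_reduce hle hK g.out with h | ⟨w, m, hm, h⟩
    · rw [alternant_comm, h, zero_mul]
    · exfalso
      obtain ⟨u, hu⟩ := X.exists_shift_eq h
      refine hg ⟨(w⁻¹, u), by simp, ?_⟩
      dsimp only
      rw [← QuotientAddGroup.out_eq' g, mk_eq_mk_iff]
      refine ⟨w⁻¹ • m, X.smul_mem_corootLattice _ hm, ?_⟩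
      rw [hu, smul_add, inv_smul_smul, smul_comm w⁻¹ _ m]
  · rintro ⟨w, u⟩ -
    dsimp only
    obtain ⟨m, hm, h2⟩ := out_eq_add (K := k + X.dualCoxeter) (w • X.shift u)
    rw [h2, alternant_add_right hK _ _ hm, alternant_add_right hK _ _ hm, alternant_smul_right,
      alternant_smul_right, map_mul, map_intCast]
    have h3 : (X.sgn w : ℂ) * X.sgn w = 1 := by exact_mod_cast X.sgn_mul_self w
    linear_combination (-X.alternant (k + X.dualCoxeter) (X.shift x) (X.shift u) *
      (starRingEnd ℂ) (X.alternant (k + X.dualCoxeter) (X.shift y) (X.shift u))) * h3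

/-- The scalar in front of the alternating sum in the modular S-matrix. -/
noncomputable def modularScalar (X : DynkinDiagram) (k : ℕ) : ℂ :=
  Complex.I ^ X.positiveRoots.ncard /
    (Real.sqrt ((X.corootLattice.index : ℝ) * ((k : ℝ) + X.dualCoxeter) ^ X.rank) : ℂ)

theorem modularS_eq (x y : X.LevelWeight k) : X.modularS x y =
    X.modularScalar k * X.alternant (k + X.dualCoxeter) (X.shift x) (X.shift y) := by
  rw [modularS, modularScalar, alternant, finsum_eq_sum_of_fintype]
  congr 1
  refine Finset.sum_congr rfl fun w _ => ?_
  rw [sgn, wave, e, coe_smul_def, shift, shift]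
  push_cast
  congr 2
  ring

/-- The square of the absolute value of the scalar is `1 / |P / K Q^∨|`. -/
theorem modularScalar_mul_conj (X : DynkinDiagram) (k : ℕ) :
    X.modularScalar k * (starRingEnd ℂ) (X.modularScalar k) *
      (X.scaledLattice (k + X.dualCoxeter)).index = 1 := by
  have hK : 0 < k + X.dualCoxeter := Nat.add_pos_right _ X.dualCoxeter_pos
  have h0 : (0 : ℝ) < (X.corootLattice.index : ℝ) * ((k : ℝ) + X.dualCoxeter) ^ X.rank := by
    have h1 : 0 < X.corootLattice.index := Nat.pos_of_ne_zero X.index_corootLattice_ne_zero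
    have h2 : (0 : ℝ) < (k : ℝ) + X.dualCoxeter := by exact_mod_cast hK
    positivity
  rw [Complex.mul_conj, Complex.normSq_eq_norm_sq, modularScalar, norm_div, norm_pow,
    Complex.norm_I, one_pow, Complex.norm_real, Real.norm_eq_abs,
    abs_of_nonneg (Real.sqrt_nonneg _), div_pow, one_pow, Real.sq_sqrt h0.le, X.index_scaledLattice hK]
  have h1 := h0.ne'
  have h2 : (((X.corootLattice.index : ℝ) * ((k : ℝ) + X.dualCoxeter) ^ X.rank : ℝ) : ℂ) ≠ 0 := by
    exact_mod_cast h1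
  rw [Complex.ofReal_div, Complex.ofReal_one]
  push_cast at h2 ⊢
  rw [one_div, inv_mul_cancel₀ h2]

open scoped Classical in
/-- The S-matrix is unitary. -/
theorem sum_modularS_mul_conj (x y : X.LevelWeight k) :
    ∑ u : X.LevelWeight k, X.modularS x u * (starRingEnd ℂ) (X.modularS y u) =
      if x = y then 1 else 0 := by
  have h1 := sum_alternant x y
  have h2 := modularScalar_mul_conj X k
  simp only [modularS_eq, map_mul]
  have h3 : ∀ u : X.LevelWeight k, X.modularScalar k *
      X.alternant (k + X.dualCoxeter) (X.shift x) (X.shift u) *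
      ((starRingEnd ℂ) (X.modularScalar k) *
        (starRingEnd ℂ) (X.alternant (k + X.dualCoxeter) (X.shift y) (X.shift u))) =
      (X.modularScalar k * (starRingEnd ℂ) (X.modularScalar k)) *
      (X.alternant (k + X.dualCoxeter) (X.shift x) (X.shift u) *
      (starRingEnd ℂ) (X.alternant (k + X.dualCoxeter) (X.shift y) (X.shift u))) := fun u => by ring
  simp only [h3]
  rw [← Finset.mul_sum, h1]
  split_ifs
  · exact h2
  · rw [mul_zero]

theorem modularS_comm (x y : X.LevelWeight k) : X.modularS x y = X.modularS y x := by
  rw [modularS_eq, modularS_eq, alternant_comm]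

theorem exists_modularS_ne_zero (u : X.LevelWeight k) : ∃ x, X.modularS x u ≠ 0 := by
  classical
  by_contra! h
  have h1 := sum_modularS_mul_conj u u
  rw [if_pos rfl, Finset.sum_eq_zero fun x _ => by rw [modularS_comm, h x, zero_mul]] at h1
  exact zero_ne_one h1

end Unitarity

/-! ### Integrality of the Verlinde numbers -/

/-- The Weyl group orbit of a weight. -/
noncomputable def orbit (X : DynkinDiagram) (x : X.Weight) : Finset X.Weight :=
  letI := Classical.decEq X.Weight
  Finset.univ.image fun w : X.weylGroup => w • x

theorem mem_orbit {X : DynkinDiagram} {x y : X.Weight} :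
    y ∈ X.orbit x ↔ ∃ w : X.weylGroup, w • x = y := by
  classical
  simp [orbit]

theorem sum_orbit_smul {X : DynkinDiagram} (x : X.Weight) (w : X.weylGroup) (g : X.Weight → ℂ) :
    ∑ y ∈ X.orbit x, g (w • y) = ∑ y ∈ X.orbit x, g y := by
  refine Finset.sum_nbij' (fun y => w • y) (fun y => w⁻¹ • y) ?_ ?_ (fun y _ => inv_smul_smul w y)
    (fun y _ => smul_inv_smul w y) (fun y _ => rfl)
  · intro y hy
    obtain ⟨v, rfl⟩ := mem_orbit.1 hy
    exact mem_orbit.2 ⟨w * v, mul_smul _ _ _⟩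
  · intro y hy
    obtain ⟨v, rfl⟩ := mem_orbit.1 hy
    exact mem_orbit.2 ⟨w⁻¹ * v, mul_smul _ _ _⟩

/-- The alternant of `x` as a function on the level weights. -/
noncomputable def alternantFun (X : DynkinDiagram) (k : ℕ) (x : X.Weight) :
    X.LevelWeight k → ℂ := fun u => X.alternant (k + X.dualCoxeter) x (X.shift u)

/-- The sum of exponentials over the orbit of `x` as a function on the level weights. -/
noncomputable def orbitFun (X : DynkinDiagram) (k : ℕ) (x : X.Weight) :
    X.LevelWeight k → ℂ := fun u => ∑ y ∈ X.orbit x, X.wave (k + X.dualCoxeter) y (X.shift u)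

/-- An orbit sum times an alternant is a sum of alternants. -/
theorem orbitFun_mul_alternantFun (X : DynkinDiagram) (k : ℕ) (x y : X.Weight) :
    X.orbitFun k x * X.alternantFun k y = ∑ z ∈ X.orbit x, X.alternantFun k (z + y) := by
  funext u
  rw [Finset.sum_apply, Pi.mul_apply]
  simp only [orbitFun, alternantFun, alternant]
  rw [Finset.mul_sum, Finset.sum_comm]
  refine Finset.sum_congr rfl fun w _ => ?_
  rw [← sum_orbit_smul x w, Finset.sum_mul]
  refine Finset.sum_congr rfl fun z _ => ?_
  rw [smul_add, wave_add_left]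
  ring

theorem alternantFun_smul (X : DynkinDiagram) (k : ℕ) (w : X.weylGroup) (x : X.Weight) :
    X.alternantFun k (w • x) = X.sgn w • X.alternantFun k x := by
  funext u
  rw [Pi.smul_apply, zsmul_eq_mul]
  exact alternant_smul_left w x _

/-- The additive group generated by all alternants. -/
def alternantGroup (X : DynkinDiagram) (k : ℕ) : AddSubgroup (X.LevelWeight k → ℂ) :=
  AddSubgroup.closure (Set.range (X.alternantFun k))

theorem alternantFun_mem (X : DynkinDiagram) (k : ℕ) (x : X.Weight) :
    X.alternantFun k x ∈ X.alternantGroup k := AddSubgroup.subset_closure ⟨x, rfl⟩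

theorem orbitFun_mul_mem (X : DynkinDiagram) (k : ℕ) (x : X.Weight) {g : X.LevelWeight k → ℂ}
    (hg : g ∈ X.alternantGroup k) : X.orbitFun k x * g ∈ X.alternantGroup k := by
  induction hg using AddSubgroup.closure_induction with
  | mem g hg =>
    obtain ⟨y, rfl⟩ := hg
    rw [orbitFun_mul_alternantFun]
    exact sum_mem fun z _ => X.alternantFun_mem k _
  | zero => rw [mul_zero]; exact zero_mem _
  | add g g' _ _ h h' => rw [mul_add]; exact add_mem h h'
  | neg g _ h => rw [mul_neg]; exact neg_mem h

/-- Every alternant is a multiple of the alternant of `ρ`, the factor being a virtual character: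
a function that preserves the group of alternants. By induction on the square length: for dominant
`λ` the orbit sum of `λ` times the alternant of `ρ` is the alternant of `λ + ρ` plus alternants of
shorter vectors. -/
theorem exists_alternantFun_eq_mul (X : DynkinDiagram) (k : ℕ) (x : X.Weight) :
    ∃ f : X.LevelWeight k → ℂ, (∀ g ∈ X.alternantGroup k, f * g ∈ X.alternantGroup k) ∧
      X.alternantFun k x = f * X.alternantFun k X.rho := by
  classical
  obtain ⟨N, hN⟩ := X.exists_natural_sq
  induction hn : N x using Nat.strong_induction_on generalizing x with
  | _ n ih =>
    obtain ⟨w, hw⟩ := X.exists_smul_dominant x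
    suffices h : ∃ f : X.LevelWeight k → ℂ,
        (∀ g ∈ X.alternantGroup k, f * g ∈ X.alternantGroup k) ∧
        X.alternantFun k (w • x) = f * X.alternantFun k X.rho by
      obtain ⟨f, hf, h⟩ := h
      refine ⟨X.sgn w • f, fun g hg => ?_, ?_⟩
      · rw [smul_mul_assoc]
        exact zsmul_mem (hf g hg) _
      · rw [smul_mul_assoc, ← h, alternantFun_smul, smul_smul, sgn_mul_self, one_smul]
    by_cases h0 : ∃ a, (w • x) a = 0
    · obtain ⟨a, ha⟩ := h0
      refine ⟨0, fun g _ => by rw [zero_mul]; exact zero_mem _, ?_⟩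
      rw [zero_mul]
      funext u
      exact alternant_eq_zero_of_apply_eq_zero _ ha
    push Not at h0
    have hdom : X.Dominant (w • x - X.rho) := fun a => by
      have h1 : 0 ≤ (w • x) a := hw a
      have h2 := h0 a
      simp only [Pi.sub_apply, rho]
      omega
    set y := w • x - X.rho with hy
    have hlt : ∀ z ∈ (X.orbit y).erase y, N (z + X.rho) < n := by
      intro z hz
      obtain ⟨hne, hz⟩ := Finset.mem_erase.1 hz
      obtain ⟨v, rfl⟩ := mem_orbit.1 hz
      have h1 := hdom.form_smul_rho_lt hne
      rw [← hn, ← hN, ← X.form_smul_smul w x x, ← sub_add_cancel (w • x) X.rho, ← hy]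
      rw [form_add_left, form_add_right, form_add_right, X.form_add_left y, X.form_add_right y,
        form_add_right, form_smul_smul, X.form_comm X.rho (v • y), X.form_comm X.rho y]
      linarith
    have h2 : ∀ z, ∃ f : X.LevelWeight k → ℂ, z ∈ (X.orbit y).erase y →
        (∀ g ∈ X.alternantGroup k, f * g ∈ X.alternantGroup k) ∧
        X.alternantFun k (z + X.rho) = f * X.alternantFun k X.rho := by
      intro z
      by_cases hz : z ∈ (X.orbit y).erase y
      · obtain ⟨f, hf⟩ := ih _ (hlt z hz) _ rfl
        exact ⟨f, fun _ => hf⟩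
      · exact ⟨0, fun h => absurd h hz⟩
    choose F hF using h2
    refine ⟨X.orbitFun k y - ∑ z ∈ (X.orbit y).erase y, F z, fun g hg => ?_, ?_⟩
    · rw [sub_mul, Finset.sum_mul]
      exact sub_mem (X.orbitFun_mul_mem k y hg) (sum_mem fun z hz => (hF z hz).1 g hg)
    · have hmem : y ∈ X.orbit y := mem_orbit.2 ⟨1, one_smul _ _⟩
      rw [sub_mul, orbitFun_mul_alternantFun, ← Finset.add_sum_erase _ _ hmem, Finset.sum_mul,
        Finset.sum_congr rfl fun z hz => (hF z hz).2, add_sub_cancel_right, hy, sub_add_cancel]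

/-- The alternants of the shifted level weights generate the group of alternants. -/
theorem exists_eq_sum_alternantFun (X : DynkinDiagram) (k : ℕ) {g : X.LevelWeight k → ℂ}
    (hg : g ∈ X.alternantGroup k) :
    ∃ n : X.LevelWeight k → ℤ, g = ∑ z, n z • X.alternantFun k (X.shift z) := by
  classical
  have hK : 0 < k + X.dualCoxeter := Nat.add_pos_right _ X.dualCoxeter_pos
  induction hg using AddSubgroup.closure_induction with
  | mem g hg =>
    obtain ⟨x, rfl⟩ := hg
    rcases alternant_reduce (Nat.le_add_left _ k) hK x with h | ⟨w, m, hm, h⟩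
    · refine ⟨0, ?_⟩
      funext u
      rw [Finset.sum_eq_zero fun z _ => by rw [Pi.zero_apply, zero_smul]]
      exact h _
    · obtain ⟨z, hz⟩ := X.exists_shift_eq h
      refine ⟨Pi.single z (X.sgn w), ?_⟩
      rw [Finset.sum_eq_single z (fun z' _ h' => by rw [Pi.single_eq_of_ne h', zero_smul])
        (fun h' => absurd (Finset.mem_univ z) h'), Pi.single_eq_same, hz]
      have h1 : X.alternantFun k (w • x + (k + X.dualCoxeter) • m) = X.alternantFun k (w • x) :=
        funext fun u => alternant_add_left hK _ _ hm
      rw [h1, alternantFun_smul, smul_smul, sgn_mul_self, one_smul]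
  | zero => exact ⟨0, by simp⟩
  | add g g' _ _ h h' =>
    obtain ⟨n, rfl⟩ := h
    obtain ⟨n', rfl⟩ := h'
    exact ⟨n + n', by simp only [Pi.add_apply, add_smul, Finset.sum_add_distrib]⟩
  | neg g _ h =>
    obtain ⟨n, rfl⟩ := h
    exact ⟨-n, by simp only [Pi.neg_apply, neg_smul, Finset.sum_neg_distrib]⟩

section Fusion

variable {X : DynkinDiagram} {k : ℕ}

theorem modularScalar_ne_zero (X : DynkinDiagram) (k : ℕ) : X.modularScalar k ≠ 0 := by
  intro h
  have h1 := X.modularScalar_mul_conj k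
  rw [h, zero_mul, zero_mul] at h1
  exact zero_ne_one h1

/-- All entries of a column of the S-matrix are multiples of the entry in the vacuum row, and the
column is non-zero. -/
theorem modularS_vacuum_ne_zero (u : X.LevelWeight k) : X.modularS (X.vacuum k) u ≠ 0 := by
  intro h
  obtain ⟨x, hx⟩ := exists_modularS_ne_zero u
  rw [modularS_eq, shift_vacuum, mul_eq_zero, or_iff_right (X.modularScalar_ne_zero k)] at h
  obtain ⟨f, -, hf⟩ := X.exists_alternantFun_eq_mul k (X.shift x)
  refine hx ?_
  have h1 := congrFun hf u
  rw [Pi.mul_apply] at h1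
  simp only [alternantFun] at h1
  rw [modularS_eq, h1, h, mul_zero, mul_zero]

/-- The Verlinde numbers are integers, and they are the structure constants of the products of the
rows of the S-matrix. -/
theorem exists_modularS_mul_eq (x y : X.LevelWeight k) : ∃ n : X.LevelWeight k → ℤ,
    (∀ z, X.verlinde x y z = n z) ∧ ∀ u, X.modularS x u * X.modularS y u =
      X.modularS (X.vacuum k) u * ∑ z, (n z : ℂ) * X.modularS z u := by
  classical
  obtain ⟨f, hf, hx⟩ := X.exists_alternantFun_eq_mul k (X.shift x)
  obtain ⟨n, hn⟩ := X.exists_eq_sum_alternantFun k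
    (hf _ (X.alternantFun_mem k (X.shift y)))
  have key : ∀ u, X.modularS x u * X.modularS y u =
      X.modularS (X.vacuum k) u * ∑ z, (n z : ℂ) * X.modularS z u := by
    intro u
    have h1 := congrFun hx u
    have h2 := congrFun hn u
    rw [Pi.mul_apply] at h1 h2
    rw [Finset.sum_apply] at h2
    simp only [alternantFun, Pi.smul_apply, zsmul_eq_mul] at h1 h2
    have h3 : ∑ z, (n z : ℂ) * X.modularS z u = X.modularScalar k *
        ∑ z, (n z : ℂ) * X.alternant (k + X.dualCoxeter) (X.shift z) (X.shift u) := by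
      rw [Finset.mul_sum]
      refine Finset.sum_congr rfl fun z _ => ?_
      rw [modularS_eq]
      ring
    rw [h3, ← h2, modularS_eq, modularS_eq, modularS_eq, shift_vacuum, h1]
    ring
  refine ⟨n, fun z => ?_, key⟩
  have h4 : ∀ u, X.modularS x u * X.modularS y u * (starRingEnd ℂ) (X.modularS z u) /
      X.modularS (X.vacuum k) u =
      ∑ z', (n z' : ℂ) * (X.modularS z' u * (starRingEnd ℂ) (X.modularS z u)) := by
    intro u
    rw [key, div_eq_iff (modularS_vacuum_ne_zero u), Finset.mul_sum, Finset.sum_mul,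
      Finset.sum_mul]
    exact Finset.sum_congr rfl fun z' _ => by ring
  rw [verlinde, Finset.sum_congr rfl fun u _ => h4 u, Finset.sum_comm]
  simp only [← Finset.mul_sum, sum_modularS_mul_conj]
  simp

end Fusion

/-! ### Simple currents -/

section SimpleCurrent

variable {X : DynkinDiagram} {c : X.Vertex}

theorem form_fundamental_rootComb (ht : X.t c = 1) (n : X.Vertex → ℤ) :
    X.form (X.fundamental c.succ) (X.rootComb n) = n c := by
  rw [form_rootComb, Finset.sum_eq_single c]
  · rw [fundamental_succ, if_pos rfl, ht]
    simp
  · intro b _ hb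
    rw [fundamental_succ, if_neg hb.symm]
    simp
  · exact fun h => absurd (Finset.mem_univ c) h

/-- If `α_c` is long and has comark `1`, then its coefficient in a positive root is `0` or `1`. -/
theorem form_fundamental_of_mem_posRoots (ht : X.t c = 1) (hc : X.finComark c = 1)
    {β : X.Weight} (hβ : β ∈ X.posRoots) :
    X.form (X.fundamental c.succ) β = 0 ∨ X.form (X.fundamental c.succ) β = 1 := by
  obtain ⟨h0, n, rfl, hn⟩ := X.mem_posRoots.1 hβ
  obtain ⟨n', h, -, hle, -⟩ := X.exists_rootComb_of_mem_roots h0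
  obtain rfl := X.rootComb_injective h
  have h1 := hle c
  have h2 := hn c
  rw [ht, hc] at h1
  push_cast at h1
  rw [form_fundamental_rootComb ht]
  have h3 : n c = 0 ∨ n c = 1 := by omega
  rcases h3 with h3 | h3 <;> simp [h3]

theorem inAlcove_rho (X : DynkinDiagram) : X.InAlcove X.dualCoxeter X.rho :=
  ⟨X.rho_pos, by have := X.level_rho; omega⟩

theorem highestRoot_mem_roots (X : DynkinDiagram) : X.highestRoot ∈ X.roots := by
  obtain ⟨w, a, h, -⟩ := X.exists_highestRoot_eq
  rw [h]
  exact X.smul_mem_roots w (X.simpleRoot_mem_roots a)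

/-- If no root is orthogonal to `y` and all pairings of `y` with the roots are less than the dual
Coxeter number, then `y` is conjugate to `ρ`. -/
theorem exists_smul_eq_rho (X : DynkinDiagram) {y : X.Weight}
    (h0 : ∀ β ∈ X.roots, X.form y β ≠ 0) (hlt : ∀ β ∈ X.roots, X.form y β < X.dualCoxeter) :
    ∃ w : X.weylGroup, w • y = X.rho := by
  -- The dominant conjugate has coordinates at least `1`, and its level is at most that of `ρ`.
  obtain ⟨w, hw⟩ := X.exists_smul_dominant y
  refine ⟨w, ?_⟩
  have h1 : ∀ a, 1 ≤ (w • y) a := by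
    intro a
    have h2 : 0 ≤ (w • y) a := hw a
    have h3 : (w • y) a ≠ 0 := by
      intro h
      have h4 := X.form_simpleRoot (w • y) a
      rw [h, Int.cast_zero, zero_div, form_smul_left] at h4
      exact h0 _ (X.smul_mem_roots _ (X.simpleRoot_mem_roots a)) h4
    omega
  have h2 := hlt _ (X.smul_mem_roots w⁻¹ X.highestRoot_mem_roots)
  rw [← form_smul_left, form_highestRoot_eq_level] at h2
  have h3 : X.level (w • y) < X.dualCoxeter := by exact_mod_cast h2
  have h4 : ∀ a, X.finComark a * X.rho a ≤ X.finComark a * (w • y) a := fun a =>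
    mul_le_mul_of_nonneg_left (h1 a) (Int.natCast_nonneg _)
  have h5 := X.level_rho
  have h6 : X.level X.rho = X.level (w • y) :=
    le_antisymm (Finset.sum_le_sum fun a _ => h4 a) (by omega)
  funext a
  have h7 := (Finset.sum_eq_sum_iff_of_le fun a _ => h4 a).1 h6 a (Finset.mem_univ a)
  exact (mul_left_cancel₀ (Int.natCast_ne_zero.2 (X.finComark_pos a).ne') h7).symm

/-- The vector `ρ - h^∨ ω_c` is conjugate to `ρ`, by an element of sign `(-1)^{2 (ω_c | ρ)}`:
the roots on which it is negative are those pairing to `1` with `ω_c`. -/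
theorem exists_smul_rho_sub_eq_rho (ht : X.t c = 1) (hc : X.finComark c = 1) :
    ∃ w : X.weylGroup, w • (X.rho - X.dualCoxeter • X.fundamental c.succ) = X.rho ∧
      (X.sgn w : ℂ) = e (X.form (X.fundamental c.succ) X.rho) := by
  classical
  set ω := X.fundamental c.succ with hω
  have hform : ∀ β, X.form (X.rho - X.dualCoxeter • ω) β =
      X.form X.rho β - X.dualCoxeter * X.form ω β := fun β => by
    rw [form_sub_left, ← natCast_zsmul, form_zsmul_left, Int.cast_natCast]
  have hpos : ∀ β ∈ X.posRoots, 0 < X.form X.rho β ∧ X.form X.rho β < X.dualCoxeter :=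
    fun β hβ => ⟨X.inAlcove_rho.form_pos hβ, X.inAlcove_rho.form_lt (X.mem_posRoots.1 hβ).1⟩
  have hbound : ∀ β ∈ X.posRoots, X.form (X.rho - X.dualCoxeter • ω) β ≠ 0 ∧
      X.form (X.rho - X.dualCoxeter • ω) β < X.dualCoxeter ∧
      -X.form (X.rho - X.dualCoxeter • ω) β < X.dualCoxeter := by
    intro β hβ
    obtain ⟨h1, h2⟩ := hpos β hβ
    rw [hform]
    rcases form_fundamental_of_mem_posRoots ht hc hβ with h | h <;> rw [← hω] at h <;> rw [h]
    · exact ⟨by linarith, by linarith, by linarith⟩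
    · exact ⟨by linarith, by linarith, by linarith⟩
  obtain ⟨w, hw⟩ := X.exists_smul_eq_rho (y := X.rho - X.dualCoxeter • ω)
    (fun β hβ => by
      rcases X.mem_posRoots_or_neg_mem hβ with h | h
      · exact (hbound β h).1
      · have := (hbound _ h).1
        rwa [form_neg_right, neg_ne_zero] at this)
    (fun β hβ => by
      rcases X.mem_posRoots_or_neg_mem hβ with h | h
      · exact (hbound β h).2.1
      · have := (hbound _ h).2.2
        rwa [form_neg_right, neg_neg] at this)
  refine ⟨w, hw, ?_⟩
  set N := #{β ∈ X.posRoots | X.form ω β = 1} with hN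
  have h1 : (N : ℚ) = 2 * X.form ω X.rho := by
    have h2 : X.form ω (∑ β ∈ X.posRoots, β) = ∑ β ∈ X.posRoots, X.form ω β := by
      rw [X.form_comm, form_sum_left]
      exact Finset.sum_congr rfl fun β _ => X.form_comm _ _
    rw [sum_posRoots, ← natCast_zsmul, form_zsmul_right] at h2
    push_cast at h2
    rw [h2, hN, Finset.card_filter]
    push_cast
    refine Finset.sum_congr rfl fun β hβ => ?_
    rcases form_fundamental_of_mem_posRoots ht hc hβ with h | h <;> rw [← hω] at h <;>
      simp [h]
  have h2 : 0 < (-1 : ℚ) ^ N * X.weylProd (X.rho - X.dualCoxeter • ω) := by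
    have h3 : (-1 : ℚ) ^ N = ∏ β ∈ X.posRoots, if X.form ω β = 1 then (-1 : ℚ) else 1 := by
      rw [Finset.prod_ite, Finset.prod_const, Finset.prod_const_one, mul_one]
    rw [h3, weylProd, ← Finset.prod_mul_distrib]
    refine Finset.prod_pos fun β hβ => ?_
    obtain ⟨h4, h5⟩ := hpos β hβ
    rw [hform]
    rcases form_fundamental_of_mem_posRoots ht hc hβ with h | h <;> rw [← hω] at h <;> rw [h]
    · simpa using h4
    · simpa using h5
  have h3 := X.weylProd_smul w (X.rho - X.dualCoxeter • ω)
  rw [hw] at h3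
  have h4 := X.weylProd_rho_pos
  rw [h3] at h4
  -- Both signs are those of `weylProd (ρ - h^∨ ω)`.
  have h5 : X.sgn w = (-1) ^ N := by
    have h6 : X.sgn w = 1 ∨ X.sgn w = -1 := mul_self_eq_one_iff.1 (X.sgn_mul_self w)
    rcases h6 with h6 | h6 <;> rcases neg_one_pow_eq_or ℚ N with h7 | h7 <;>
      rcases neg_one_pow_eq_or ℤ N with h8 | h8 <;>
      rw [h6] at h4 ⊢ <;> rw [h7] at h2 <;> rw [h8] <;> push_cast at h4 <;>
      first | rfl | (exfalso; linarith) | skip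
    all_goals
      exfalso
      have h9 : (((-1 : ℤ) ^ N : ℤ) : ℚ) = (-1) ^ N := by push_cast; rfl
      rw [h7, h8] at h9
      norm_num at h9
  have h6 : e (1 / 2) = -1 := by
    rw [e, ← Complex.exp_pi_mul_I]
    congr 1
    push_cast
    ring
  have h7 : X.form ω X.rho = N * (1 / 2) := by rw [h1]; ring
  rw [h5, h7, e_natCast_mul, h6]
  push_cast
  rfl

/-- The weights `w ω_c` and `ω_c` are congruent modulo `Q^∨`. -/
theorem smul_fundamental_sub_mem (ht : X.t c = 1) (w : X.weylGroup) :
    w • X.fundamental c.succ - X.fundamental c.succ ∈ X.corootLattice := by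
  induction w using X.weyl_induction with
  | one => rw [one_smul, sub_self]; exact zero_mem _
  | mul a w ih =>
    have h1 : X.simpleRefl a • X.fundamental c.succ - X.fundamental c.succ ∈ X.corootLattice := by
      rw [simpleRefl_smul, sub_sub_cancel_left, fundamental_succ]
      split_ifs with h
      · subst h
        rw [one_smul]
        exact neg_mem (X.simpleRoot_mem_corootLattice ht)
      · rw [zero_smul, neg_zero]
        exact zero_mem _
    have h2 := add_mem (X.smul_mem_corootLattice (X.simpleRefl a) ih) h1
    rwa [smul_sub, sub_add_sub_cancel, ← mul_smul] at h2

theorem shift_multipleFundamental_succ (k : ℕ) (hc : X.comark c.succ = 1) :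
    X.shift (X.multipleFundamental k c.succ hc) = k • X.fundamental c.succ + X.rho := by
  funext a
  simp only [shift, finitePart, multipleFundamental, Pi.add_apply, Pi.smul_apply,
    fundamental_succ, Pi.single_apply, Fin.succ_inj, eq_comm (a := a)]
  split_ifs <;> simp

end SimpleCurrent

/-- The row of a simple current in the S-matrix is the vacuum row times a character. -/
theorem modularS_multipleFundamental (X : DynkinDiagram) {k : ℕ} {i : X.ExtVertex}
    (hi : X.comark i = 1) (ht : i = 0 ∨ ∃ c : X.Vertex, i = c.succ ∧ X.t c = 1)
    (u : X.LevelWeight k) : X.modularS (X.multipleFundamental k i hi) u =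
      e (-X.form (X.fundamental i) (X.finitePart u)) * X.modularS (X.vacuum k) u := by
  rcases ht with rfl | ⟨c, rfl, ht⟩
  · rw [fundamental_zero, form_zero_left, neg_zero, e_zero, one_mul]
    rfl
  · obtain ⟨w, hw, hs⟩ := exists_smul_rho_sub_eq_rho ht hi
    have hK : ((k + X.dualCoxeter : ℕ) : ℚ) ≠ 0 :=
      Nat.cast_ne_zero.2 (Nat.add_pos_right _ X.dualCoxeter_pos).ne'
    have h1 : X.shift (X.multipleFundamental k c.succ hi) =
        (k + X.dualCoxeter) • X.fundamental c.succ +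
          (X.rho - X.dualCoxeter • X.fundamental c.succ) := by
      rw [shift_multipleFundamental_succ, add_smul]
      abel
    have h2 : ∀ v : X.weylGroup, X.wave (k + X.dualCoxeter)
        (v • (k + X.dualCoxeter) • X.fundamental c.succ) (X.shift u) =
        e (-X.form (X.fundamental c.succ) (X.shift u)) := by
      intro v
      obtain ⟨n, hn⟩ := X.exists_int_form (X.shift u) (smul_fundamental_sub_mem ht v)
      rw [X.form_comm, form_sub_left] at hn
      rw [smul_comm v, wave, ← natCast_zsmul, form_zsmul_left, Int.cast_natCast,
        mul_div_cancel_left₀ _ hK]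
      have h3 : -X.form (v • X.fundamental c.succ) (X.shift u) =
          -X.form (X.fundamental c.succ) (X.shift u) + (-n : ℤ) := by
        push_cast
        linarith
      rw [h3, e_add, e_int, mul_one]
    have h3 : X.alternant (k + X.dualCoxeter) (X.shift (X.multipleFundamental k c.succ hi))
        (X.shift u) = e (-X.form (X.fundamental c.succ) (X.shift u)) *
          X.alternant (k + X.dualCoxeter) (X.rho - X.dualCoxeter • X.fundamental c.succ)
            (X.shift u) := by
      rw [h1, alternant, alternant, Finset.mul_sum]
      refine Finset.sum_congr rfl fun v _ => ?_
      rw [smul_add, wave_add_left, h2]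
      ring
    have h4 : X.alternant (k + X.dualCoxeter) (X.rho - X.dualCoxeter • X.fundamental c.succ)
        (X.shift u) = X.sgn w * X.alternant (k + X.dualCoxeter) X.rho (X.shift u) := by
      have h5 : (X.sgn w : ℂ) * X.sgn w = 1 := by exact_mod_cast X.sgn_mul_self w
      rw [← one_mul (X.alternant _ _ _), ← h5, mul_assoc, ← alternant_smul_left, hw]
    have h5 : e (-X.form (X.fundamental c.succ) (X.shift u)) *
        e (X.form (X.fundamental c.succ) X.rho) =
        e (-X.form (X.fundamental c.succ) (X.finitePart u)) := by
      rw [← e_add, shift, form_add_right]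
      congr 1
      ring
    rw [modularS_eq, modularS_eq, shift_vacuum, h3, h4, hs, ← h5]
    ring

/-! ### The fusion ring and the boundary Q-system -/

section FusionRing

variable {X : DynkinDiagram} {k : ℕ}

/-- The functions `u ↦ ∑_z c_z S_{z,u} / S_{0,u}` on the level weights, for integral `c`. The map is
an embedding under which the fusion product becomes the pointwise product. -/
noncomputable def characterHom (X : DynkinDiagram) (k : ℕ) :
    (X.LevelWeight k → ℤ) →+ (X.LevelWeight k → ℂ) where
  toFun c u := ∑ z, (c z : ℂ) * (X.modularS z u / X.modularS (X.vacuum k) u)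
  map_zero' := by
    funext u
    simp
  map_add' c d := by
    funext u
    simp only [Pi.add_apply, Int.cast_add, add_mul, Finset.sum_add_distrib]

theorem characterHom_apply (c : X.LevelWeight k → ℤ) (u : X.LevelWeight k) :
    X.characterHom k c u = ∑ z, (c z : ℂ) * (X.modularS z u / X.modularS (X.vacuum k) u) := rfl

theorem characterHom_injective : Function.Injective (X.characterHom k) := by
  classical
  rw [injective_iff_map_eq_zero]
  intro c hc
  have h1 : ∀ u, ∑ z, (c z : ℂ) * X.modularS z u = 0 := fun u => by
    have h2 := congrFun hc u
    rw [characterHom_apply] at h2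
    simp only [← mul_div_assoc] at h2
    rw [← Finset.sum_div, Pi.zero_apply, div_eq_zero_iff] at h2
    exact h2.resolve_right (modularS_vacuum_ne_zero u)
  funext y
  have h2 : ∑ u, (∑ z, (c z : ℂ) * X.modularS z u) * (starRingEnd ℂ) (X.modularS y u) = c y := by
    simp only [Finset.sum_mul, mul_assoc]
    rw [Finset.sum_comm]
    simp only [← Finset.mul_sum, sum_modularS_mul_conj]
    simp
  simp only [h1, zero_mul, Finset.sum_const_zero] at h2
  exact_mod_cast h2.symm

theorem coeff_V [DecidableEq (X.LevelWeight k)] (x z : X.LevelWeight k) :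
    X.coeff (X.V x) z = if x = z then 1 else 0 := Finsupp.single_apply

theorem characterHom_coeff_V (x u : X.LevelWeight k) :
    X.characterHom k (X.coeff (X.V x)) u = X.modularS x u / X.modularS (X.vacuum k) u := by
  classical
  simp [characterHom_apply, coeff_V]

theorem characterHom_eq_sum (c : X.LevelWeight k → ℤ) :
    X.characterHom k c = ∑ x, c x • X.characterHom k (X.coeff (X.V x)) := by
  funext u
  rw [characterHom_apply, Finset.sum_apply]
  refine Finset.sum_congr rfl fun x _ => ?_
  rw [Pi.smul_apply, characterHom_coeff_V, zsmul_eq_mul]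

theorem exists_characterHom_mul_eq (x y : X.LevelWeight k) : ∃ n : X.LevelWeight k → ℤ,
    (∀ z, X.verlinde x y z = n z) ∧ X.characterHom k (X.coeff (X.V x)) *
      X.characterHom k (X.coeff (X.V y)) = X.characterHom k n := by
  obtain ⟨n, hn, h⟩ := exists_modularS_mul_eq x y
  refine ⟨n, hn, ?_⟩
  funext u
  have h0 := modularS_vacuum_ne_zero u
  rw [Pi.mul_apply, characterHom_coeff_V, characterHom_coeff_V, div_mul_div_comm, h u,
    mul_div_mul_left _ _ h0, characterHom_apply, Finset.sum_div]
  exact Finset.sum_congr rfl fun z _ => mul_div_assoc _ _ _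

theorem characterHom_coeff_V_vacuum : X.characterHom k (X.coeff (X.V (X.vacuum k))) = 1 := by
  funext u
  rw [characterHom_coeff_V, div_self (modularS_vacuum_ne_zero u)]
  rfl

theorem characterHom_mul_mem {f g : X.LevelWeight k → ℂ} (hf : f ∈ (X.characterHom k).range)
    (hg : g ∈ (X.characterHom k).range) : f * g ∈ (X.characterHom k).range := by
  obtain ⟨c, rfl⟩ := hf
  obtain ⟨d, rfl⟩ := hg
  rw [characterHom_eq_sum c, characterHom_eq_sum d, Finset.sum_mul_sum]
  refine sum_mem fun x _ => sum_mem fun y _ => ?_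
  rw [smul_mul_smul_comm]
  obtain ⟨n, -, hn⟩ := exists_characterHom_mul_eq x y
  rw [hn]
  exact zsmul_mem (AddMonoidHom.mem_range.2 ⟨n, rfl⟩) _

/-- The image of the fusion ring in the ring of functions on the level weights. -/
noncomputable def characterRing (X : DynkinDiagram) (k : ℕ) : Subring (X.LevelWeight k → ℂ) where
  __ := (X.characterHom k).range
  mul_mem' := characterHom_mul_mem
  one_mem' := ⟨_, characterHom_coeff_V_vacuum⟩

/-- The identification of the free module with the ring of characters. -/
noncomputable def characterEquiv (X : DynkinDiagram) (k : ℕ) :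
    X.FusionModule k ≃ X.characterRing k :=
  (Finsupp.equivFunOnFinite : (X.LevelWeight k →₀ ℤ) ≃ (X.LevelWeight k → ℤ)).trans
    (Equiv.ofInjective _ characterHom_injective)

theorem coe_characterEquiv (f : X.FusionModule k) :
    (X.characterEquiv k f : X.LevelWeight k → ℂ) = X.characterHom k (X.coeff f) := rfl

/-- The ring structure is transported from the ring of characters. -/
theorem exists_isFusionRing (X : DynkinDiagram) (k : ℕ) :
    ∃ R : CommRing (X.FusionModule k), X.IsFusionRing k R := by
  refine ⟨(X.characterEquiv k).commRing, fun f g z => ?_, fun x y z => ?_⟩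
  · let _ := (X.characterEquiv k).commRing
    have h1 : X.characterEquiv k (f + g) = X.characterEquiv k f + X.characterEquiv k g :=
      map_add (X.characterEquiv k).ringEquiv f g
    have h2 := congrArg (Subtype.val) h1
    rw [Subring.coe_add, coe_characterEquiv, coe_characterEquiv, coe_characterEquiv, ← map_add]
      at h2
    exact congrFun (characterHom_injective h2) z
  · let _ := (X.characterEquiv k).commRing
    have h1 : X.characterEquiv k (X.V x * X.V y) =
        X.characterEquiv k (X.V x) * X.characterEquiv k (X.V y) :=
      map_mul (X.characterEquiv k).ringEquiv _ _
    have h2 := congrArg (Subtype.val) h1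
    obtain ⟨n, hn, h⟩ := exists_characterHom_mul_eq x y
    rw [Subring.coe_mul, coe_characterEquiv, coe_characterEquiv, coe_characterEquiv, h] at h2
    rw [hn, ← congrFun (characterHom_injective h2) z]
    rfl

theorem FusionModule.ext {f g : X.FusionModule k} (h : ∀ z, X.coeff f z = X.coeff g z) : f = g :=
  Finsupp.ext h

/-- Every fusion ring embeds into the ring of functions on the level weights. -/
theorem IsFusionRing.exists_ringHom (R : CommRing (X.FusionModule k)) (hR : X.IsFusionRing k R) :
    ∃ φ : X.FusionModule k →+* (X.LevelWeight k → ℂ), Function.Injective φ ∧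
      ∀ f, φ f = X.characterHom k (X.coeff f) := by
  let coeffHom : X.FusionModule k →+ (X.LevelWeight k → ℤ) :=
    AddMonoidHom.mk' X.coeff fun f g => funext fun z => hR.coeff_add f g z
  have hcoe : Function.Injective coeffHom := fun f g h => FusionModule.ext (congrFun h)
  let φ : X.FusionModule k →+ (X.LevelWeight k → ℂ) := (X.characterHom k).comp coeffHom
  have hφ : ∀ f, φ f = X.characterHom k (X.coeff f) := fun _ => rfl
  -- The basis elements generate the additive group of the given ring, whose addition is known only
  -- through the coefficients.
  have hexp : ∀ f : X.FusionModule k, f = ∑ x, X.coeff f x • X.V x := by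
    classical
    intro f
    apply hcoe
    rw [map_sum]
    funext z
    rw [Finset.sum_apply]
    simp only [map_zsmul, Pi.smul_apply]
    have h1 : ∀ x, coeffHom (X.V x) z = if x = z then 1 else 0 := fun x => coeff_V x z
    simp only [h1, smul_eq_mul, mul_ite, mul_one, mul_zero, Finset.sum_ite_eq', Finset.mem_univ,
      if_true]
    rfl
  have hV : ∀ x y : X.LevelWeight k, φ (X.V x * X.V y) = φ (X.V x) * φ (X.V y) := by
    intro x y
    obtain ⟨n, hn, h⟩ := exists_characterHom_mul_eq x y
    rw [hφ, hφ, hφ, h]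
    congr 1
    funext z
    have h1 := hR.coeff_mul x y z
    rw [hn] at h1
    exact_mod_cast h1
  have hmul : ∀ f g, φ (f * g) = φ f * φ g := by
    intro f g
    rw [hexp f, hexp g, Finset.sum_mul_sum, map_sum, map_sum, map_sum, Finset.sum_mul_sum]
    refine Finset.sum_congr rfl fun x _ => ?_
    rw [map_sum]
    refine Finset.sum_congr rfl fun y _ => ?_
    rw [smul_mul_smul_comm, map_zsmul, map_zsmul, map_zsmul, smul_mul_smul_comm, hV]
  have hone : φ 1 = 1 := by
    have h1 := hmul 1 (X.V (X.vacuum k))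
    rw [one_mul, hφ (X.V _), characterHom_coeff_V_vacuum, mul_one] at h1
    exact h1.symm
  exact ⟨{ φ with map_one' := hone, map_mul' := hmul },
    characterHom_injective.comp hcoe, hφ⟩

/-- The Q-system for the characters of the simple currents: the ratio of the two sides is
`exp (2πi m)` with `m = -(∑_b C_{ab} ω_{τ_b} | x)`, which is an integer. -/
theorem e_form_tauZero_sq (X : DynkinDiagram) (a : X.Vertex) (x : X.Weight) :
    e (-X.form (X.fundamental (X.tauZero a)) x) ^ 2 =
      ∏ b with X.cartan a b < 0,
        e (-X.form (X.fundamental (X.tauZero b)) x) ^ (-X.cartan a b).toNat := by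
  obtain ⟨n, hn⟩ := X.exists_int_form x (X.sum_cartan_smul_tau_mem a)
  rw [X.form_comm, form_sum_left] at hn
  simp only [form_zsmul_left] at hn
  rw [← Finset.sum_filter_add_sum_filter_not _ (fun b => X.cartan a b < 0)] at hn
  have h1 : ∑ b with ¬X.cartan a b < 0, (X.cartan a b : ℚ) *
      X.form (X.fundamental (X.tauZero b)) x = 2 * X.form (X.fundamental (X.tauZero a)) x := by
    rw [Finset.sum_eq_single a]
    · rw [cartan_self]
      push_cast
      rfl
    · intro b hb hne
      have h2 := X.cartan_nonpos a b hne.symm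
      have h3 : X.cartan a b = 0 := by
        have := (Finset.mem_filter.1 hb).2
        omega
      rw [h3, Int.cast_zero, zero_mul]
    · intro h
      exact absurd (Finset.mem_filter.2 ⟨Finset.mem_univ a, by rw [cartan_self]; norm_num⟩) h
  have h2 : ∀ (s : Finset X.Vertex) (q : X.Vertex → ℚ), ∏ b ∈ s, e (q b) = e (∑ b ∈ s, q b) := by
    classical
    intro s q
    induction s using Finset.induction_on with
    | empty => rw [Finset.prod_empty, Finset.sum_empty, e_zero]
    | insert b s hb ih => rw [Finset.prod_insert hb, Finset.sum_insert hb, ih, e_add]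
  rw [← e_natCast_mul]
  simp only [← e_natCast_mul]
  rw [h2]
  have h3 : ∑ b with X.cartan a b < 0, ((-X.cartan a b).toNat : ℚ) *
      -X.form (X.fundamental (X.tauZero b)) x =
      ∑ b with X.cartan a b < 0, (X.cartan a b : ℚ) *
        X.form (X.fundamental (X.tauZero b)) x := by
    refine Finset.sum_congr rfl fun b hb => ?_
    have h4 : ((-X.cartan a b).toNat : ℤ) = -X.cartan a b :=
      Int.toNat_of_nonneg (by have := (Finset.mem_filter.1 hb).2; omega)
    have h5 : ((-X.cartan a b).toNat : ℚ) = -(X.cartan a b : ℚ) := by exact_mod_cast h4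
    rw [h5, neg_mul_neg]
  rw [h3, eq_sub_of_add_eq hn, h1, sub_eq_add_neg, e_add, e_int, one_mul]
  congr 1
  push_cast
  ring

end FusionRing

end DynkinDiagram

theorem theorem5p1 (X : DynkinDiagram) (k : ℕ) (hk : 2 ≤ k) :
    (∃ R : CommRing (X.FusionModule k), X.IsFusionRing k R) ∧
    ∀ R : CommRing (X.FusionModule k), X.IsFusionRing k R →
      @DynkinDiagram.IsBoundarySolution X (X.FusionModule k) R
        (fun a => X.V (X.tauWeight k a)) := by
  refine ⟨X.exists_isFusionRing k, fun R hR a => ?_⟩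
  obtain ⟨φ, hinj, hφ⟩ := DynkinDiagram.IsFusionRing.exists_ringHom R hR
  have h1 : ∀ b u, φ (X.V (X.tauWeight k b)) u =
      DynkinDiagram.e (-X.form (X.fundamental (X.tauZero b)) (X.finitePart u)) := by
    intro b u
    rw [hφ, DynkinDiagram.characterHom_coeff_V, DynkinDiagram.tauWeight,
      X.modularS_multipleFundamental _ (X.tauZero_eq_zero_or b),
      mul_div_cancel_right₀ _ (DynkinDiagram.modularS_vacuum_ne_zero u)]
  apply hinj
  rw [map_pow, map_prod]
  funext u
  rw [Pi.pow_apply, Finset.prod_apply]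
  simp only [map_pow, Pi.pow_apply, h1]
  exact X.e_form_tauZero_sq a _
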